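/- **Notation.** Let $\tau\in\mathbb C$, $\operatorname{Im}\tau>0$; let $\theta_j(\cdot\,|\,\tau)$ be the Jacobi theta functions with nome $e^{\pi i\tau}$, let $k=\theta_2(0)^2/\theta_3(0)^2$, and let $$\mathrm{cd}(u)=\frac{\mathrm{cn}(u,k)}{\mathrm{dn}(u,k)}=\frac{\theta_3(0)\,\theta_2(v)}{\theta_2(0)\,\theta_3(v)},\qquad v=u/\theta_3(0)^2 .$$ Let $c_1,\dots,c_8,\eta,x,y$ be independent complex variables, $c_{1234}=c_1+c_2+c_3+c_4$, and $$\lambda=\tfrac12\sum_{i=1}^8c_i .$$ Write $\langle u,v;w\rangle=\dfrac{1-\mathrm{cd}(u)/\mathrm{cd}(w)}{1-\mathrm{cd}(v)/\mathrm{cd}(w)}$. **Lattice.** On $\mathrm{Pic}=\mathbb ZH_0\oplus\mathbb ZH_1\oplus\bigoplus_{i=1}^8\mathbb ZE_i$ with the form $(H_i|H_j)=1-\delta_{ij}$, $(H_i|E_j)=0$, $(E_i|E_j)=-\delta_{ij}$ let $\delta=2H_0+2H_1-\sum E_i$, $\alpha_0=E_7-E_8$, $\alpha_1=H_1-H_0$,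 $\alpha_2=H_0-E_1-E_2$, $\alpha_i=E_{i-1}-E_i$ $(3\le i\le7)$, $\alpha_8=E_1-E_2$, and let $s_i$ $(0\le i\le 8)$ be the reflection $v\mapsto v-\frac{2(v|\alpha_i)}{(\alpha_i|\alpha_i)}\alpha_i$. **Birational action.** The $s_i$ act as follows on $c_1,\dots,c_8,\eta,x,y$ (variables not listed are fixed): $s_0:c_7\leftrightarrow c_8$; $s_1:\eta\mapsto-\eta,\ x\leftrightarrow y$; $s_k:c_{k-1}\leftrightarrow c_k$ for $k=3,\dots,7$; $s_8:c_1\leftrightarrow c_2$; $s_2(\eta)=\eta-\frac{2\eta+c_1+c_2}4$, $s_2(c_i)=c_i-\frac{3(2\eta+c_1+c_2)}4$ for $i=1,2$, $s_2(c_i)=c_i+\frac{2\eta+c_1+c_2}4$ for $i\ge3$, and $s_2(y)$ is determined by $$\frac{s_2(y)-\mathrm{cd}(2\eta-\frac{c_1-c_2}2)}{s_2(y)-\mathrm{cd}(2\eta+\frac{c_1-c_2}2)}\cdot\frac{x-\mathrm{cd}(\eta+c_1)}{x-\mathrm{cd}(\eta+c_2)}\cdot\frac{y-\mathrm{cd}(\eta-c_2)}{y-\mathrm{cd}(\eta-c_1)}=\langle\eta-c_2,\eta-c_1;\eta\rangle\,\langle\eta+c_1,\eta+c_2;\eta\rangle\,\langle2\eta-\tfrac{c_1-c_2}2,2\eta+\tfrac{c_1-c_2}2;\tfrac{c_1+c_2}2\rangle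 .$$ Elements act on functions by $w.F=F(w.c_i,w.\eta,w.x,w.y)$, and $s_{i_1\cdots i_m}=s_{i_1}\cdots s_{i_m}$. Put $$R=s_{23483256457067348356452348321},\qquad T=R^2 .$$ **Coefficient functions.** With $S=a_1+a_2+a_3+a_4$ and $m=\frac{a_1+a_2}2$, $$G(a_1,a_2,a_3,a_4,b)=\langle a_4+m,a_3+m;a_2+m\rangle\langle b-a_4,b-a_3;b-a_1\rangle\langle b+a_4-\tfrac S2,b+a_3-\tfrac S2;b+a_2+\tfrac S2\rangle\langle a_3+m,a_4+m;2b+a_2-m\rangle .$$ With $p_i=\mathrm{cd}(b+a_i)$, $m_i=\mathrm{cd}(b-a_i)$, $t_i=\mathrm{cd}(b+a_i+\frac{a_5}2)$, $r=\mathrm{cd}(b+a_3-\frac{a_5}2)$, $$Q(a_1,\dots,a_5,b;X)=(r-t_2)(t_1-t_4)(p_4p_1+p_2X)+(r-t_1)(t_4-t_2)(p_4p_2+p_1X)-(r-t_4)(t_1-t_2)(p_1p_2+p_4X),$$ $$\begin{aligned}P(a_1,a_2,a_3,b;X,Y)=&\big[(m_3-m_2)p_1+(m_1-m_3)p_2+(m_2-m_1)p_3\big]XY\\&+\big[(m_2-m_3)m_1p_1+(m_3-m_1)m_2p_2+(m_1-m_2)m_3p_3\big]X\\&+\big[(p_3-p_2)m_1p_1+(p_1-p_3)m_2p_2+(p_2-p_1)m_3p_3\big]Y\\&+(p_2m_3-m_2p_3)m_1p_1+(p_3m_1-m_3p_1)m_2p_2+(p_1m_2-m_1p_2)m_3p_3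 .\end{aligned}$$ Finally, for $d=(d_1,\dots,d_6)$, $$N_d(z,b;X,Y)=\frac{Q(d_5,d_6,d_3,z,c_{1234},b;X)}{P(d_1,d_2,d_4,b;X,Y)}-\frac{X-\mathrm{cd}(b+d_3)}{X-\mathrm{cd}(b+d_4)}\cdot\frac{Q(d_5,d_6,d_4,z,c_{1234},b;X)}{G(d_1,d_2,d_3,d_4,b)\,P(d_1,d_2,d_3,b;X,Y)} .$$ **Theorem.** 1. On the root lattice, $T(\alpha_1)=\alpha_1-2\delta$, $T(\alpha_2)=\alpha_2+\delta$, and $T(\alpha_i)=\alpha_i$ for $i\ne1,2$. On the parameters, $T(c_i)=c_i$ $(1\le i\le 8)$ and $T(\eta)=\eta+\lambda$. 2. $\bar x=T(x)$ and $\bar y=T(y)$ satisfy, with $d=(c_1,\dots,c_6)$, $$\begin{aligned}&\frac{\bar y-\mathrm{cd}(\eta-c_8+\lambda)}{\bar y-\mathrm{cd}(\eta-c_7+\lambda)}\cdot\frac{x-\mathrm{cd}(\eta+c_7)}{x-\mathrm{cd}(\eta+c_8)}\\&=\langle\eta-c_8+\lambda,\eta-c_7+\lambda;3\eta+c_6+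\lambda\rangle\,\langle2\eta+\tfrac{c_7-c_8}2+\lambda,2\eta-\tfrac{c_7-c_8}2+\lambda;c_6+\tfrac{c_7+c_8}2-\lambda\rangle\\&\quad\times\langle2\eta-\tfrac{c_7-c_8}2+\lambda,2\eta+\tfrac{c_7-c_8}2+\lambda;2\eta+c_6-\tfrac{c_7+c_8}2+\lambda\rangle\,\langle\eta+c_8+\tfrac{c_{1234}}2,\eta+c_7+\tfrac{c_{1234}}2;\eta+c_5+\tfrac{c_{1234}}2\rangle\,\frac{N_d(c_7,\eta;x,y)}{N_d(c_8,\eta;x,y)}\end{aligned}$$ and, with $d'=(\frac\lambda2-c_8,\frac\lambda2-c_7,\frac\lambda2-c_6,\frac\lambda2-c_5,\frac\lambda2-c_4,\frac\lambda2-c_3)$, $$\begin{aligned}&\frac{\bar x-\mathrm{cd}(\eta+c_1+\lambda)}{\bar x-\mathrm{cd}(\eta+c_2+\lambda)}\cdot\frac{\bar y-\mathrm{cd}(\eta-c_2+\lambda)}{\bar y-\mathrm{cd}(\eta-c_1+\lambda)}=A\cdot\frac{N_{d'}(\frac\lambda2-c_2,\eta+\frac\lambda2;\bar y,x)}{N_{d'}(\frac\lambda2-c_1,\eta+\frac\lambda2;\bar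 y,x)},\end{aligned}$$ $$\begin{aligned}A=\ &\langle\eta+c_1+\lambda,\eta+c_2+\lambda;3\eta-c_3+3\lambda\rangle\,\langle2\eta+\tfrac{c_1-c_2}2+2\lambda,2\eta-\tfrac{c_1-c_2}2+2\lambda;c_3+\tfrac{c_1+c_2}2\rangle\\&\times\langle2\eta-\tfrac{c_1-c_2}2+2\lambda,2\eta+\tfrac{c_1-c_2}2+2\lambda;2\eta-c_3+\tfrac{c_1+c_2}2+2\lambda\rangle\,\langle\eta-c_1+\tfrac{c_{1234}}2+\lambda,\eta-c_2+\tfrac{c_{1234}}2+\lambda;\eta-c_4+\tfrac{c_{1234}}2+\lambda\rangle .\end{aligned}$$ 3. On the parameter subspace $c_5+c_4=c_6+c_3=c_7+c_2=c_8+c_1=\frac\lambda2$ one has $R:(c_1,\dots,c_8,\eta,x,y)\mapsto(c_1,\dots,c_8,\eta+\frac\lambda2,\tilde x,x)$ where $\tilde x=R(x)$. With $\tilde{\tilde x}=R(R(x))$ and $d''=(c_1,c_2,c_3,c_4,\frac\lambda2-c_4,\frac\lambda2-c_3)$ this gives the scalar second-order equation $$\frac{\tilde{\tilde x}-\mathrm{cd}(\eta+c_1+\lambda)}{\tilde{\tilde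 x}-\mathrm{cd}(\eta+c_2+\lambda)}\cdot\frac{\tilde x-\mathrm{cd}(\eta-c_2+\lambda)}{\tilde x-\mathrm{cd}(\eta-c_1+\lambda)}=A\cdot\frac{N_{d''}(\frac\lambda2-c_2,\eta+\frac\lambda2;\tilde x,x)}{N_{d''}(\frac\lambda2-c_1,\eta+\frac\lambda2;\tilde x,x)} .$$ The equations are identities between meromorphic functions: each holds at every point $(c,\eta,x,y)$ at which all the successive reflections in $T=R^2$ are defined with finite values (no $\mathrm{cd}$ evaluated at a pole, no vanishing denominator, $s_2(y)$ uniquely determined) and all terms of the equation are defined. In 2 the set of points where this is so for both equations is open and dense in $\mathbb C^{11}$; in 3 the corresponding set is relatively open and dense in the set of all points with parameters in the subspace. -/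

import Mathlib

noncomputable section

namespace EllipticPainleve

/-! ### Jacobi theta functions and Jacobian elliptic functions

The period ratio is `τ` with `0 < τ.im`, the nome is `q = exp (π i τ)`, and
`theta₃ τ v` is the classical `θ₃(π v | τ) = ∑ q^(n²) exp (2 i n π v)`, and so on.
In these terms `k = θ₂(0)² / θ₃(0)²`, `K = π θ₃(0)² / 2`, `i K' = K τ`. -/

def theta₃ (τ v : ℂ) : ℂ := jacobiTheta₂ v τ

def theta₄ (τ v : ℂ) : ℂ := jacobiTheta₂ (v + 1 / 2) τ

def theta₂ (τ v : ℂ) : ℂ :=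
  Complex.exp (Real.pi * Complex.I * τ / 4 + Real.pi * Complex.I * v) *
    jacobiTheta₂ (v + τ / 2) τ

/-- The argument `u / (π θ₃(0)²) = u / (2 K)` of the theta functions. -/
def thetaArg (τ u : ℂ) : ℂ := u / (Real.pi * theta₃ τ 0 ^ 2)

def jacobiCn (τ u : ℂ) : ℂ :=
  (theta₄ τ 0 * theta₂ τ (thetaArg τ u)) / (theta₂ τ 0 * theta₄ τ (thetaArg τ u))

def jacobiDn (τ u : ℂ) : ℂ :=
  (theta₄ τ 0 * theta₃ τ (thetaArg τ u)) / (theta₃ τ 0 * theta₄ τ (thetaArg τ u))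

/-- The Jacobian elliptic function `cd = cn / dn`, with the removable singularities of the
quotient at the poles of `cn` and `dn` removed (see `cd_eq_cn_div_dn`). -/
def cd (τ u : ℂ) : ℂ :=
  (theta₃ τ 0 * theta₂ τ (thetaArg τ u)) / (theta₂ τ 0 * theta₃ τ (thetaArg τ u))

theorem cd_eq_cn_div_dn (τ u : ℂ) (h0 : theta₄ τ 0 ≠ 0) (hu : theta₄ τ (thetaArg τ u) ≠ 0) :
    cd τ u = jacobiCn τ u / jacobiDn τ u := by
  unfold cd jacobiCn jacobiDn
  rw [div_div_div_eq]
  rw [show theta₄ τ 0 * theta₂ τ (thetaArg τ u) * (theta₃ τ 0 * theta₄ τ (thetaArg τ u)) =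
      (theta₄ τ 0 * theta₄ τ (thetaArg τ u)) * (theta₃ τ 0 * theta₂ τ (thetaArg τ u)) by ring,
    show theta₂ τ 0 * theta₄ τ (thetaArg τ u) * (theta₄ τ 0 * theta₃ τ (thetaArg τ u)) =
      (theta₄ τ 0 * theta₄ τ (thetaArg τ u)) * (theta₂ τ 0 * theta₃ τ (thetaArg τ u)) by ring]
  rw [mul_div_mul_left _ _ (mul_ne_zero h0 hu)]

/-- `u` is not a pole of `cd`. -/
def CdReg (τ u : ℂ) : Prop := theta₃ τ (thetaArg τ u) ≠ 0

/-! ### Two kinds of quotients that occur in all formulas, with their domains of definition -/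

/-- `(1 - cd u / cd w) / (1 - cd v / cd w)` -/
def cdQuot (τ u v w : ℂ) : ℂ := (1 - cd τ u / cd τ w) / (1 - cd τ v / cd τ w)

def CdQuotReg (τ u v w : ℂ) : Prop :=
  CdReg τ u ∧ CdReg τ v ∧ CdReg τ w ∧ cd τ w ≠ 0 ∧ 1 - cd τ v / cd τ w ≠ 0

/-- `(X - cd u) / (X - cd v)` -/
def linQuot (τ X u v : ℂ) : ℂ := (X - cd τ u) / (X - cd τ v)

def LinQuotReg (τ X u v : ℂ) : Prop := CdReg τ u ∧ CdReg τ v ∧ X - cd τ v ≠ 0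

/-! ### The Picard lattice and the linear action of the reflections

An element `(h, e)` stands for `h 0 • H₀ + h 1 • H₁ + ∑ i, e i • E_{i+1}`. -/

abbrev Pic : Type := (Fin 2 → ℤ) × (Fin 8 → ℤ)

/-- The intersection form: `(H_i|H_j) = 1 - δ_ij`, `(H_i|E_j) = 0`, `(E_i|E_j) = -δ_ij`. -/
def interForm (v w : Pic) : ℤ := v.1 0 * w.1 1 + v.1 1 * w.1 0 - ∑ i, v.2 i * w.2 i

def picH (i : Fin 2) : Pic := (Pi.single i 1, 0)

/-- `picE j` is the exceptional class `E_{j+1}`. -/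
def picE (j : Fin 8) : Pic := (0, Pi.single j 1)

/-- The simple roots `α₀, …, α₈`. -/
def simpleRoot : Fin 9 → Pic :=
  ![picE 6 - picE 7,
    picH 1 - picH 0,
    picH 0 - picE 0 - picE 1,
    picE 1 - picE 2,
    picE 2 - picE 3,
    picE 3 - picE 4,
    picE 4 - picE 5,
    picE 5 - picE 6,
    picE 0 - picE 1]

/-- The anti-canonical class `δ = 2 H₀ + 2 H₁ - ∑ E_i`. -/
def antiCanonical : Pic := 2 • picH 0 + 2 • picH 1 - ∑ j, picE j

/-- The reflection `s_i` on the Picard lattice (here `(α_i|α_i) = -2`, so the division is exact). -/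
def picReflection (i : Fin 9) (v : Pic) : Pic :=
  v - ((2 * interForm v (simpleRoot i)) / interForm (simpleRoot i) (simpleRoot i)) • simpleRoot i

/-- `s_{i₁ ⋯ i_m} . v = s_{i₁} . (s_{i₂} . ( ⋯ (s_{i_m} . v)))` -/
def picWord (w : List (Fin 9)) (v : Pic) : Pic := w.foldr picReflection v

/-! ### The birational action on parameters and coordinates -/

/-- The space with coordinates `(c, η, x, y)`, where `c j` is `c_{j+1}`. -/
abbrev State : Type := (Fin 8 → ℂ) × ℂ × ℂ × ℂ

def State.c (p : State) : Fin 8 → ℂ := p.1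

def State.η (p : State) : ℂ := p.2.1

def State.x (p : State) : ℂ := p.2.2.1

def State.y (p : State) : ℂ := p.2.2.2

/-- `λ = (c₁ + ⋯ + c₈) / 2` -/
def State.lam (p : State) : ℂ := (∑ j, p.c j) / 2

/-- The constant on the right of the relation that defines `s₂(y)`. -/
def s₂Const (τ c₁ c₂ η : ℂ) : ℂ :=
  cdQuot τ (η - c₂) (η - c₁) η * cdQuot τ (η + c₁) (η + c₂) η *
    cdQuot τ (2 * η - (c₁ - c₂) / 2) (2 * η + (c₁ - c₂) / 2) ((c₁ + c₂) / 2)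

/-- The relation that defines `Y = s₂(y)`. -/
def S₂Relation (τ c₁ c₂ η x y Y : ℂ) : Prop :=
  linQuot τ Y (2 * η - (c₁ - c₂) / 2) (2 * η + (c₁ - c₂) / 2) *
      linQuot τ x (η + c₁) (η + c₂) * linQuot τ y (η - c₂) (η - c₁) =
    s₂Const τ c₁ c₂ η

def s₂Num (τ c₁ c₂ η x y : ℂ) : ℂ :=
  s₂Const τ c₁ c₂ η * (x - cd τ (η + c₂)) * (y - cd τ (η - c₁))

def s₂Den (τ c₁ c₂ η x y : ℂ) : ℂ := (x - cd τ (η + c₁)) * (y - cd τ (η - c₂))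

/-- `s₂(y)`: the relation `S₂Relation` solved for `Y` (see `s₂Relation_iff`). -/
def s₂Y (τ c₁ c₂ η x y : ℂ) : ℂ :=
  (cd τ (2 * η - (c₁ - c₂) / 2) * s₂Den τ c₁ c₂ η x y -
      cd τ (2 * η + (c₁ - c₂) / 2) * s₂Num τ c₁ c₂ η x y) /
    (s₂Den τ c₁ c₂ η x y - s₂Num τ c₁ c₂ η x y)

/-- The relation that defines `s₂(y)` makes sense and has a unique finite solution. -/
def S₂Reg (τ c₁ c₂ η x y : ℂ) : Prop :=
  CdQuotReg τ (η - c₂) (η - c₁) η ∧ CdQuotReg τ (η + c₁) (η + c₂) η ∧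
  CdQuotReg τ (2 * η - (c₁ - c₂) / 2) (2 * η + (c₁ - c₂) / 2) ((c₁ + c₂) / 2) ∧
  x - cd τ (η + c₂) ≠ 0 ∧ y - cd τ (η - c₁) ≠ 0 ∧
  cd τ (2 * η - (c₁ - c₂) / 2) ≠ cd τ (2 * η + (c₁ - c₂) / 2) ∧
  s₂Den τ c₁ c₂ η x y ≠ 0 ∧ s₂Den τ c₁ c₂ η x y - s₂Num τ c₁ c₂ η x y ≠ 0

theorem s₂Relation_iff (τ c₁ c₂ η x y Y : ℂ) (h : S₂Reg τ c₁ c₂ η x y) :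
    (Y - cd τ (2 * η + (c₁ - c₂) / 2) ≠ 0 ∧ S₂Relation τ c₁ c₂ η x y Y) ↔
      Y = s₂Y τ c₁ c₂ η x y := by
  obtain ⟨-, -, -, hx, hy, hAB, hD, hDN⟩ := h
  unfold S₂Relation s₂Y linQuot
  unfold s₂Num s₂Den at *
  generalize cd τ (2 * η - (c₁ - c₂) / 2) = A at *
  generalize cd τ (2 * η + (c₁ - c₂) / 2) = B at *
  generalize s₂Const τ c₁ c₂ η = g at *
  generalize x - cd τ (η + c₂) = x₂ at *
  generalize x - cd τ (η + c₁) = x₁ at *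
  generalize y - cd τ (η - c₁) = y₁ at *
  generalize y - cd τ (η - c₂) = y₂ at *
  rw [eq_div_iff hDN]
  constructor
  · rintro ⟨hB, hR⟩
    field_simp at hR
    linear_combination hR
  · intro hY
    have hB : Y - B ≠ 0 := by
      intro h0
      have : (A - B) * (x₁ * y₂) = 0 := by
        rw [sub_eq_zero] at h0
        subst h0
        linear_combination -hY
      exact (mul_ne_zero (sub_ne_zero.mpr hAB) hD) this
    refine ⟨hB, ?_⟩
    field_simp
    linear_combination hY

/-- `s_i` on the coordinates: `step τ i p` has the coordinates
`(s_i(c), s_i(η), s_i(x), s_i(y))` evaluated at `p`. -/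
def step (τ : ℂ) (i : Fin 9) (p : State) : State :=
  match i with
  | 0 => (p.c ∘ Equiv.swap 6 7, p.η, p.x, p.y)
  | 1 => (p.c, -p.η, p.y, p.x)
  | 2 =>
    (fun j =>
        if j = 0 ∨ j = 1 then p.c j - 3 * (2 * p.η + p.c 0 + p.c 1) / 4
        else p.c j + (2 * p.η + p.c 0 + p.c 1) / 4,
      p.η - (2 * p.η + p.c 0 + p.c 1) / 4, p.x, s₂Y τ (p.c 0) (p.c 1) p.η p.x p.y)
  | 3 => (p.c ∘ Equiv.swap 1 2, p.η, p.x, p.y)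
  | 4 => (p.c ∘ Equiv.swap 2 3, p.η, p.x, p.y)
  | 5 => (p.c ∘ Equiv.swap 3 4, p.η, p.x, p.y)
  | 6 => (p.c ∘ Equiv.swap 4 5, p.η, p.x, p.y)
  | 7 => (p.c ∘ Equiv.swap 5 6, p.η, p.x, p.y)
  | 8 => (p.c ∘ Equiv.swap 0 1, p.η, p.x, p.y)

/-- `s_i` acts on a function `F` by acting on its arguments: `s_i.F = F(s_i.c, s_i.η, s_i.x, s_i.y)`. -/
def act {α : Type*} (τ : ℂ) (i : Fin 9) (F : State → α) : State → α := fun p => F (step τ i p)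

/-- `s_{i₁ ⋯ i_m} . F = s_{i₁} . (s_{i₂} . ( ⋯ (s_{i_m} . F)))` -/
def actWord {α : Type*} (τ : ℂ) (w : List (Fin 9)) (F : State → α) : State → α :=
  w.foldr (act τ) F

/-- All the reflections of the word are defined (with finite values) along the way from `p`. -/
def WordReg (τ : ℂ) : List (Fin 9) → State → Prop
  | [], _ => True
  | i :: w, p => (i = 2 → S₂Reg τ (p.c 0) (p.c 1) p.η p.x p.y) ∧ WordReg τ w (step τ i p)

/-- `R = s_{23483256457067348356452348321}` -/
def RJ2 : List (Fin 9) :=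
  [2, 3, 4, 8, 3, 2, 5, 6, 4, 5, 7, 0, 6, 7, 3, 4, 8, 3, 5, 6, 4, 5, 2, 3, 4, 8, 3, 2, 1]

/-- `T = R²` -/
def TJ2 : List (Fin 9) := RJ2 ++ RJ2

/-! ### The coefficient functions of the equations -/

def gG (τ a₁ a₂ a₃ a₄ b : ℂ) : ℂ :=
  cdQuot τ (a₄ + (a₁ + a₂) / 2) (a₃ + (a₁ + a₂) / 2) (a₂ + (a₁ + a₂) / 2) *
  cdQuot τ (b - a₄) (b - a₃) (b - a₁) *
  cdQuot τ (b + a₄ - (a₁ + a₂ + a₃ + a₄) / 2) (b + a₃ - (a₁ + a₂ + a₃ + a₄) / 2)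
    (b + a₂ + (a₁ + a₂ + a₃ + a₄) / 2) *
  cdQuot τ (a₃ + (a₁ + a₂) / 2) (a₄ + (a₁ + a₂) / 2) (2 * b + a₂ - (a₁ + a₂) / 2)

def GReg (τ a₁ a₂ a₃ a₄ b : ℂ) : Prop :=
  CdQuotReg τ (a₄ + (a₁ + a₂) / 2) (a₃ + (a₁ + a₂) / 2) (a₂ + (a₁ + a₂) / 2) ∧
  CdQuotReg τ (b - a₄) (b - a₃) (b - a₁) ∧
  CdQuotReg τ (b + a₄ - (a₁ + a₂ + a₃ + a₄) / 2) (b + a₃ - (a₁ + a₂ + a₃ + a₄) / 2)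
    (b + a₂ + (a₁ + a₂ + a₃ + a₄) / 2) ∧
  CdQuotReg τ (a₃ + (a₁ + a₂) / 2) (a₄ + (a₁ + a₂) / 2) (2 * b + a₂ - (a₁ + a₂) / 2)

def qQ (τ a₁ a₂ a₃ a₄ a₅ b X : ℂ) : ℂ :=
  (cd τ (b + a₃ - a₅ / 2) - cd τ (b + a₂ + a₅ / 2)) *
      (cd τ (b + a₁ + a₅ / 2) - cd τ (b + a₄ + a₅ / 2)) *
      (cd τ (b + a₄) * cd τ (b + a₁) + cd τ (b + a₂) * X) +
  (cd τ (b + a₃ - a₅ / 2) - cd τ (b + a₁ + a₅ / 2)) *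
      (cd τ (b + a₄ + a₅ / 2) - cd τ (b + a₂ + a₅ / 2)) *
      (cd τ (b + a₄) * cd τ (b + a₂) + cd τ (b + a₁) * X) -
  (cd τ (b + a₃ - a₅ / 2) - cd τ (b + a₄ + a₅ / 2)) *
      (cd τ (b + a₁ + a₅ / 2) - cd τ (b + a₂ + a₅ / 2)) *
      (cd τ (b + a₁) * cd τ (b + a₂) + cd τ (b + a₄) * X)

def QReg (τ a₁ a₂ a₃ a₄ a₅ b : ℂ) : Prop :=
  CdReg τ (b + a₁) ∧ CdReg τ (b + a₂) ∧ CdReg τ (b + a₄) ∧ CdReg τ (b + a₃ - a₅ / 2) ∧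
  CdReg τ (b + a₁ + a₅ / 2) ∧ CdReg τ (b + a₂ + a₅ / 2) ∧ CdReg τ (b + a₄ + a₅ / 2)

def pP (τ a₁ a₂ a₃ b X Y : ℂ) : ℂ :=
  ((cd τ (b - a₃) - cd τ (b - a₂)) * cd τ (b + a₁) +
      (cd τ (b - a₁) - cd τ (b - a₃)) * cd τ (b + a₂) +
      (cd τ (b - a₂) - cd τ (b - a₁)) * cd τ (b + a₃)) * X * Y +
  ((cd τ (b - a₂) - cd τ (b - a₃)) * cd τ (b - a₁) * cd τ (b + a₁) +
      (cd τ (b - a₃) - cd τ (b - a₁)) * cd τ (b - a₂) * cd τ (b + a₂) +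
      (cd τ (b - a₁) - cd τ (b - a₂)) * cd τ (b - a₃) * cd τ (b + a₃)) * X +
  ((cd τ (b + a₃) - cd τ (b + a₂)) * cd τ (b - a₁) * cd τ (b + a₁) +
      (cd τ (b + a₁) - cd τ (b + a₃)) * cd τ (b - a₂) * cd τ (b + a₂) +
      (cd τ (b + a₂) - cd τ (b + a₁)) * cd τ (b - a₃) * cd τ (b + a₃)) * Y +
  ((cd τ (b + a₂) * cd τ (b - a₃) - cd τ (b - a₂) * cd τ (b + a₃)) *
        cd τ (b - a₁) * cd τ (b + a₁) +
      (cd τ (b + a₃) * cd τ (b - a₁) - cd τ (b - a₃) * cd τ (b + a₁)) *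
        cd τ (b - a₂) * cd τ (b + a₂) +
      (cd τ (b + a₁) * cd τ (b - a₂) - cd τ (b - a₁) * cd τ (b + a₂)) *
        cd τ (b - a₃) * cd τ (b + a₃))

def PReg (τ a₁ a₂ a₃ b : ℂ) : Prop :=
  CdReg τ (b + a₁) ∧ CdReg τ (b + a₂) ∧ CdReg τ (b + a₃) ∧
  CdReg τ (b - a₁) ∧ CdReg τ (b - a₂) ∧ CdReg τ (b - a₃)

/-- The common shape of the numerators and denominators of the last factors of the equations:
`Q(d₅,d₆,d₃,z,s,b;X) / P(d₁,d₂,d₄,b;X,Y) -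
(X - cd(b+d₃))/(X - cd(b+d₄)) * Q(d₅,d₆,d₄,z,s,b;X) / (G(d₁,d₂,d₃,d₄,b) P(d₁,d₂,d₃,b;X,Y))`. -/
def mixN (τ d₁ d₂ d₃ d₄ d₅ d₆ z s b X Y : ℂ) : ℂ :=
  qQ τ d₅ d₆ d₃ z s b X / pP τ d₁ d₂ d₄ b X Y -
    linQuot τ X (b + d₃) (b + d₄) *
      (qQ τ d₅ d₆ d₄ z s b X / (gG τ d₁ d₂ d₃ d₄ b * pP τ d₁ d₂ d₃ b X Y))

def MixNReg (τ d₁ d₂ d₃ d₄ d₅ d₆ z s b X Y : ℂ) : Prop :=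
  QReg τ d₅ d₆ d₃ z s b ∧ QReg τ d₅ d₆ d₄ z s b ∧
  PReg τ d₁ d₂ d₄ b ∧ PReg τ d₁ d₂ d₃ b ∧ GReg τ d₁ d₂ d₃ d₄ b ∧
  pP τ d₁ d₂ d₄ b X Y ≠ 0 ∧ pP τ d₁ d₂ d₃ b X Y ≠ 0 ∧ gG τ d₁ d₂ d₃ d₄ b ≠ 0 ∧
  LinQuotReg τ X (b + d₃) (b + d₄)

/-! ### The equations, and the conditions that all their terms are defined -/

/-- First equation of the MSY system; `Y` stands for `ȳ`, `l` for `λ`. -/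
def MSYFirst (τ c₁ c₂ c₃ c₄ c₅ c₆ c₇ c₈ η l x y Y : ℂ) : Prop :=
  linQuot τ Y (η - c₈ + l) (η - c₇ + l) * linQuot τ x (η + c₇) (η + c₈) =
    cdQuot τ (η - c₈ + l) (η - c₇ + l) (3 * η + c₆ + l) *
    cdQuot τ (2 * η + (c₇ - c₈) / 2 + l) (2 * η - (c₇ - c₈) / 2 + l) (c₆ + (c₇ + c₈) / 2 - l) *
    cdQuot τ (2 * η - (c₇ - c₈) / 2 + l) (2 * η + (c₇ - c₈) / 2 + l)
      (2 * η + c₆ - (c₇ + c₈) / 2 + l) *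
    cdQuot τ (η + c₈ + (c₁ + c₂ + c₃ + c₄) / 2) (η + c₇ + (c₁ + c₂ + c₃ + c₄) / 2)
      (η + c₅ + (c₁ + c₂ + c₃ + c₄) / 2) *
    (mixN τ c₁ c₂ c₃ c₄ c₅ c₆ c₇ (c₁ + c₂ + c₃ + c₄) η x y /
      mixN τ c₁ c₂ c₃ c₄ c₅ c₆ c₈ (c₁ + c₂ + c₃ + c₄) η x y)

def MSYFirstReg (τ c₁ c₂ c₃ c₄ c₅ c₆ c₇ c₈ η l x y Y : ℂ) : Prop :=
  LinQuotReg τ Y (η - c₈ + l) (η - c₇ + l) ∧ LinQuotReg τ x (η + c₇) (η + c₈) ∧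
  CdQuotReg τ (η - c₈ + l) (η - c₇ + l) (3 * η + c₆ + l) ∧
  CdQuotReg τ (2 * η + (c₇ - c₈) / 2 + l) (2 * η - (c₇ - c₈) / 2 + l) (c₆ + (c₇ + c₈) / 2 - l) ∧
  CdQuotReg τ (2 * η - (c₇ - c₈) / 2 + l) (2 * η + (c₇ - c₈) / 2 + l)
    (2 * η + c₆ - (c₇ + c₈) / 2 + l) ∧
  CdQuotReg τ (η + c₈ + (c₁ + c₂ + c₃ + c₄) / 2) (η + c₇ + (c₁ + c₂ + c₃ + c₄) / 2)
    (η + c₅ + (c₁ + c₂ + c₃ + c₄) / 2) ∧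
  MixNReg τ c₁ c₂ c₃ c₄ c₅ c₆ c₇ (c₁ + c₂ + c₃ + c₄) η x y ∧
  MixNReg τ c₁ c₂ c₃ c₄ c₅ c₆ c₈ (c₁ + c₂ + c₃ + c₄) η x y ∧
  mixN τ c₁ c₂ c₃ c₄ c₅ c₆ c₈ (c₁ + c₂ + c₃ + c₄) η x y ≠ 0

/-- Second equation of the MSY system; `X`, `Y` stand for `x̄`, `ȳ`, and `l` for `λ`. Note that
`η + l/2 + (l/2 - c₆) = η - c₆ + l`. -/
def MSYSecond (τ c₁ c₂ c₃ c₄ c₅ c₆ c₇ c₈ η l x X Y : ℂ) : Prop :=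
  linQuot τ X (η + c₁ + l) (η + c₂ + l) * linQuot τ Y (η - c₂ + l) (η - c₁ + l) =
    cdQuot τ (η + c₁ + l) (η + c₂ + l) (3 * η - c₃ + 3 * l) *
    cdQuot τ (2 * η + (c₁ - c₂) / 2 + 2 * l) (2 * η - (c₁ - c₂) / 2 + 2 * l)
      (c₃ + (c₁ + c₂) / 2) *
    cdQuot τ (2 * η - (c₁ - c₂) / 2 + 2 * l) (2 * η + (c₁ - c₂) / 2 + 2 * l)
      (2 * η - c₃ + (c₁ + c₂) / 2 + 2 * l) *
    cdQuot τ (η - c₁ + (c₁ + c₂ + c₃ + c₄) / 2 + l) (η - c₂ + (c₁ + c₂ + c₃ + c₄) / 2 + l)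
      (η - c₄ + (c₁ + c₂ + c₃ + c₄) / 2 + l) *
    (mixN τ (l / 2 - c₈) (l / 2 - c₇) (l / 2 - c₆) (l / 2 - c₅) (l / 2 - c₄) (l / 2 - c₃)
        (l / 2 - c₂) (c₁ + c₂ + c₃ + c₄) (η + l / 2) Y x /
      mixN τ (l / 2 - c₈) (l / 2 - c₇) (l / 2 - c₆) (l / 2 - c₅) (l / 2 - c₄) (l / 2 - c₃)
        (l / 2 - c₁) (c₁ + c₂ + c₃ + c₄) (η + l / 2) Y x)

def MSYSecondReg (τ c₁ c₂ c₃ c₄ c₅ c₆ c₇ c₈ η l x X Y : ℂ) : Prop :=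
  LinQuotReg τ X (η + c₁ + l) (η + c₂ + l) ∧ LinQuotReg τ Y (η - c₂ + l) (η - c₁ + l) ∧
  CdQuotReg τ (η + c₁ + l) (η + c₂ + l) (3 * η - c₃ + 3 * l) ∧
  CdQuotReg τ (2 * η + (c₁ - c₂) / 2 + 2 * l) (2 * η - (c₁ - c₂) / 2 + 2 * l)
    (c₃ + (c₁ + c₂) / 2) ∧
  CdQuotReg τ (2 * η - (c₁ - c₂) / 2 + 2 * l) (2 * η + (c₁ - c₂) / 2 + 2 * l)
    (2 * η - c₃ + (c₁ + c₂) / 2 + 2 * l) ∧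
  CdQuotReg τ (η - c₁ + (c₁ + c₂ + c₃ + c₄) / 2 + l) (η - c₂ + (c₁ + c₂ + c₃ + c₄) / 2 + l)
    (η - c₄ + (c₁ + c₂ + c₃ + c₄) / 2 + l) ∧
  MixNReg τ (l / 2 - c₈) (l / 2 - c₇) (l / 2 - c₆) (l / 2 - c₅) (l / 2 - c₄) (l / 2 - c₃)
    (l / 2 - c₂) (c₁ + c₂ + c₃ + c₄) (η + l / 2) Y x ∧
  MixNReg τ (l / 2 - c₈) (l / 2 - c₇) (l / 2 - c₆) (l / 2 - c₅) (l / 2 - c₄) (l / 2 - c₃)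
    (l / 2 - c₁) (c₁ + c₂ + c₃ + c₄) (η + l / 2) Y x ∧
  mixN τ (l / 2 - c₈) (l / 2 - c₇) (l / 2 - c₆) (l / 2 - c₅) (l / 2 - c₄) (l / 2 - c₃)
    (l / 2 - c₁) (c₁ + c₂ + c₃ + c₄) (η + l / 2) Y x ≠ 0

/-- The projectively reduced scalar equation; `x₁`, `x₂` stand for the first and the second
iterate of `x`, and `l` for `λ`. -/
def Reduced (τ c₁ c₂ c₃ c₄ η l x x₁ x₂ : ℂ) : Prop :=
  linQuot τ x₂ (η + c₁ + l) (η + c₂ + l) * linQuot τ x₁ (η - c₂ + l) (η - c₁ + l) =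
    cdQuot τ (η + c₁ + l) (η + c₂ + l) (3 * η - c₃ + 3 * l) *
    cdQuot τ (2 * η + (c₁ - c₂) / 2 + 2 * l) (2 * η - (c₁ - c₂) / 2 + 2 * l)
      (c₃ + (c₁ + c₂) / 2) *
    cdQuot τ (2 * η - (c₁ - c₂) / 2 + 2 * l) (2 * η + (c₁ - c₂) / 2 + 2 * l)
      (2 * η - c₃ + (c₁ + c₂) / 2 + 2 * l) *
    cdQuot τ (η - c₁ + (c₁ + c₂ + c₃ + c₄) / 2 + l) (η - c₂ + (c₁ + c₂ + c₃ + c₄) / 2 + l)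
      (η - c₄ + (c₁ + c₂ + c₃ + c₄) / 2 + l) *
    (mixN τ c₁ c₂ c₃ c₄ (l / 2 - c₄) (l / 2 - c₃) (l / 2 - c₂)
        (c₁ + c₂ + c₃ + c₄) (η + l / 2) x₁ x /
      mixN τ c₁ c₂ c₃ c₄ (l / 2 - c₄) (l / 2 - c₃) (l / 2 - c₁)
        (c₁ + c₂ + c₃ + c₄) (η + l / 2) x₁ x)

def ReducedReg (τ c₁ c₂ c₃ c₄ η l x x₁ x₂ : ℂ) : Prop :=
  LinQuotReg τ x₂ (η + c₁ + l) (η + c₂ + l) ∧ LinQuotReg τ x₁ (η - c₂ + l) (η - c₁ + l) ∧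
  CdQuotReg τ (η + c₁ + l) (η + c₂ + l) (3 * η - c₃ + 3 * l) ∧
  CdQuotReg τ (2 * η + (c₁ - c₂) / 2 + 2 * l) (2 * η - (c₁ - c₂) / 2 + 2 * l)
    (c₃ + (c₁ + c₂) / 2) ∧
  CdQuotReg τ (2 * η - (c₁ - c₂) / 2 + 2 * l) (2 * η + (c₁ - c₂) / 2 + 2 * l)
    (2 * η - c₃ + (c₁ + c₂) / 2 + 2 * l) ∧
  CdQuotReg τ (η - c₁ + (c₁ + c₂ + c₃ + c₄) / 2 + l) (η - c₂ + (c₁ + c₂ + c₃ + c₄) / 2 + l)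
    (η - c₄ + (c₁ + c₂ + c₃ + c₄) / 2 + l) ∧
  MixNReg τ c₁ c₂ c₃ c₄ (l / 2 - c₄) (l / 2 - c₃) (l / 2 - c₂)
    (c₁ + c₂ + c₃ + c₄) (η + l / 2) x₁ x ∧
  MixNReg τ c₁ c₂ c₃ c₄ (l / 2 - c₄) (l / 2 - c₃) (l / 2 - c₁)
    (c₁ + c₂ + c₃ + c₄) (η + l / 2) x₁ x ∧
  mixN τ c₁ c₂ c₃ c₄ (l / 2 - c₄) (l / 2 - c₃) (l / 2 - c₁)
    (c₁ + c₂ + c₃ + c₄) (η + l / 2) x₁ x ≠ 0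

/-! ### The transformed coordinates as functions on the state space -/

/-- `x̄ = T(x)` -/
def xBar (τ : ℂ) : State → ℂ := actWord τ TJ2 State.x

/-- `ȳ = T(y)` -/
def yBar (τ : ℂ) : State → ℂ := actWord τ TJ2 State.y

/-- `R(x)` -/
def xTilde (τ : ℂ) : State → ℂ := actWord τ RJ2 State.x

/-- `R(R(x))` -/
def xTildeTilde (τ : ℂ) : State → ℂ := actWord τ RJ2 (xTilde τ)

/-- The points at which `T` is defined and all terms of the two MSY equations make sense. -/
def MSYDomain (τ : ℂ) : Set State :=
  {p | WordReg τ TJ2 p ∧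
    MSYFirstReg τ (p.c 0) (p.c 1) (p.c 2) (p.c 3) (p.c 4) (p.c 5) (p.c 6) (p.c 7)
      p.η p.lam p.x p.y (yBar τ p) ∧
    MSYSecondReg τ (p.c 0) (p.c 1) (p.c 2) (p.c 3) (p.c 4) (p.c 5) (p.c 6) (p.c 7)
      p.η p.lam p.x (xBar τ p) (yBar τ p)}

/-- The points whose parameters satisfy `c₅ + c₄ = c₆ + c₃ = c₇ + c₂ = c₈ + c₁ = λ / 2`. -/
def SpecialSet : Set State :=
  {p | p.c 4 + p.c 3 = p.lam / 2 ∧ p.c 5 + p.c 2 = p.lam / 2 ∧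
    p.c 6 + p.c 1 = p.lam / 2 ∧ p.c 7 + p.c 0 = p.lam / 2}

/-- The special points at which `R` and `R²` are defined and all terms of the reduced equation
make sense. -/
def ReducedDomain (τ : ℂ) : Set State :=
  {p | p ∈ SpecialSet ∧ WordReg τ (RJ2 ++ RJ2) p ∧
    ReducedReg τ (p.c 0) (p.c 1) (p.c 2) (p.c 3) p.η p.lam p.x (xTilde τ p) (xTildeTilde τ p)}

end EllipticPainleve

end

noncomputable section

namespace EllipticPainleve

open Complex Filter Topology

/-! ### Product and duplication formulas for theta functions -/

/-! Write cd = f/g with f, g even entire (multiples of θ₂ and θ₃). The point is that f(u)g(v) −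
f(v)g(u) = σ(u−v)σ(u+v) for an odd theta function σ. The Plücker relation between the vectors (f(a),
g(a)) becomes the three-term identity of σ (`three_term`), and the forms y·g(a) − f(a), with y
arbitrary, obey a similar relation (`cdForm_three_term`). All the algebra rests on these two.

The reflection s₂ fixes x. Choose u with x = cd u, which is possible for every x, and describe y by
its two forms at 2η−u and 2η+u. In these coordinates s₂ is diagonal (`s₂_step`): up to a common
factor it multiplies them by σ(u+η+c₁)σ(u+η+c₂) and σ(u−η−c₁)σ(u−η−c₂), while 2η becomes
η−(c₁+c₂)/2. The four s₂ in R use the pairs (c₁,c₂), …, (c₇,c₈) in turn, and the sums η+cᵢ of the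
pairs still to come do not change. Together they multiply the two forms by the products of
σ(u±(η+cᵢ)) over all eight i (`stageY₄_cdForm`). The other letters of R permute the c's and finally
exchange x and y, so R sends c_j to λ/2−c_{9−j}, η to η+λ/2 and (x,y) to (ȳ,x), with the same ȳ as
for T = R².

For the first equation, the numerator of N_d at fixed x is affine in y, hence determined by its
values at y = cd(2η∓u). There P, Q and their combination factor into sigma functions (`pForm_curve`,
`qQ_combination`, `mixForm_curve`). Expanding the form of ȳ at η−c₈+λ in those at 2η+λ±u shows that
it is proportional to the numerator with z = c₇ (`mixForm_mul_eq`), and likewise with 7 and 8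
exchanged; the quotient is the equation. The argument divides by σ(2u), σ(4η) and σ(4η+2λ); points
where one of these vanishes are reached by continuity (`msyFirst`). The second equation is the first
one at R(p). On the special subspace R fixes the c's, so the second equation relates three
successive iterates of x.

The domains are open by continuity. For density, the parameters move along a line whose direction
lies in the special subspace. Each condition on the parameters says that a nonzero entire function
does not vanish at an affine argument of nonzero slope, so it holds for all small nonzero times.
Over such parameters s₂ is invertible in y, so preimages of dense sets are dense, and the remaining
conditions are nonvanishing of nonzero polynomials in (x,y). -/

theorem hasSum_mul_jacobiTheta₂_term (x y : ℂ) {t : ℂ} (ht : 0 < t.im) :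
    HasSum (fun p : ℤ × ℤ => jacobiTheta₂_term p.1 x t * jacobiTheta₂_term p.2 y t)
      (jacobiTheta₂ x t * jacobiTheta₂ y t) := by
  have hx := hasSum_jacobiTheta₂_term x ht
  have hy := hasSum_jacobiTheta₂_term y ht
  have hs := summable_mul_of_summable_norm (f := fun n : ℤ => jacobiTheta₂_term n x t)
    (g := fun n : ℤ => jacobiTheta₂_term n y t) hx.summable.norm hy.summable.norm
  exact HasSum.mul (f := fun n : ℤ => jacobiTheta₂_term n x t)
    (g := fun n : ℤ => jacobiTheta₂_term n y t) hx hy hs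

/-- The pairs (a+b, a−b) are the index pairs of equal parity and (a+b+1, a−b) those of opposite
parity. Since (a+b)² + (a−b)² = 2a² + 2b², each half of the double series is again a product, of
period 2t. -/
theorem jacobiTheta₂_mul_jacobiTheta₂ (x y : ℂ) {t : ℂ} (ht : 0 < t.im) :
    jacobiTheta₂ x t * jacobiTheta₂ y t =
      jacobiTheta₂ (x + y) (2 * t) * jacobiTheta₂ (x - y) (2 * t) +
      cexp (2 * Real.pi * I * x + Real.pi * I * t) *
        (jacobiTheta₂ (x + y + t) (2 * t) * jacobiTheta₂ (x - y + t) (2 * t)) := by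
  have ht2 : 0 < (2 * t).im := by simpa using ht
  have h := hasSum_mul_jacobiTheta₂_term x y ht
  have h1 := hasSum_mul_jacobiTheta₂_term (x + y) (x - y) ht2
  have h2 := (hasSum_mul_jacobiTheta₂_term (x + y + t) (x - y + t) ht2).mul_left
    (cexp (2 * Real.pi * I * x + Real.pi * I * t))
  set F : ℤ × ℤ → ℂ := fun p => jacobiTheta₂_term p.1 x t * jacobiTheta₂_term p.2 y t with hF
  let φ : ℤ × ℤ → ℤ × ℤ := fun p => (p.1 + p.2, p.1 - p.2)
  let ψ : ℤ × ℤ → ℤ × ℤ := fun p => (p.1 + p.2 + 1, p.1 - p.2)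
  have hφ : Function.Injective φ := by
    rintro ⟨a, b⟩ ⟨c, d⟩ hh
    simp only [φ, Prod.mk.injEq] at hh ⊢
    omega
  have hψ : Function.Injective ψ := by
    rintro ⟨a, b⟩ ⟨c, d⟩ hh
    simp only [ψ, Prod.mk.injEq] at hh ⊢
    omega
  have hc : IsCompl (Set.range φ) (Set.range ψ) := by
    refine ⟨Set.disjoint_left.2 ?_, codisjoint_iff_le_sup.2 ?_⟩
    · rintro _ ⟨⟨a, b⟩, rfl⟩ ⟨⟨c, d⟩, hh⟩
      simp only [φ, ψ, Prod.mk.injEq] at hh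
      omega
    · rintro ⟨m, n⟩ -
      rcases Int.even_or_odd' (m + n) with ⟨k, hk | hk⟩
      · exact Or.inl ⟨(k, m - k), by simp only [φ, Prod.mk.injEq]; omega⟩
      · exact Or.inr ⟨(k, m - k - 1), by simp only [ψ, Prod.mk.injEq]; omega⟩
  have e1 : F ∘ φ = fun p : ℤ × ℤ =>
      jacobiTheta₂_term p.1 (x + y) (2 * t) * jacobiTheta₂_term p.2 (x - y) (2 * t) := by
    funext ⟨a, b⟩
    simp only [hF, φ, Function.comp, jacobiTheta₂_term, ← Complex.exp_add]
    push_cast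
    congr 1
    ring
  have e2 : F ∘ ψ = fun p : ℤ × ℤ => cexp (2 * Real.pi * I * x + Real.pi * I * t) *
      (jacobiTheta₂_term p.1 (x + y + t) (2 * t) *
        jacobiTheta₂_term p.2 (x - y + t) (2 * t)) := by
    funext ⟨a, b⟩
    simp only [hF, ψ, Function.comp, jacobiTheta₂_term, ← Complex.exp_add]
    push_cast
    congr 1
    ring
  rw [← e1] at h1
  rw [← e2] at h2
  exact h.unique ((hφ.hasSum_range_iff.2 h1).add_isCompl hc (hψ.hasSum_range_iff.2 h2))

/-- The point 1/2 + t is fixed by v ↦ −v modulo the periods 1 and 2t, and the quasi-periodicity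
factor there is −1. -/
theorem jacobiTheta₂_half_add_half (t : ℂ) : jacobiTheta₂ (1 / 2 + t) (2 * t) = 0 := by
  have h1 := jacobiTheta₂_add_left' (1 / 2 - t) (2 * t)
  have h2 : jacobiTheta₂ (1 / 2 - t) (2 * t) = jacobiTheta₂ (1 / 2 + t) (2 * t) := by
    rw [← jacobiTheta₂_neg_left, ← jacobiTheta₂_add_left]
    congr 1
    ring
  rw [h2, show (1 : ℂ) / 2 - t + 2 * t = 1 / 2 + t by ring,
    show -(Real.pi : ℂ) * I * (2 * t + 2 * (1 / 2 - t)) = -(Real.pi * I) by ring,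
    Complex.exp_neg, Complex.exp_pi_mul_I] at h1
  have h3 : (2 : ℂ) * jacobiTheta₂ (1 / 2 + t) (2 * t) = 0 := by
    linear_combination h1
  simpa using h3

theorem jacobiTheta₂_half_two_mul_sq {t : ℂ} (ht : 0 < t.im) :
    jacobiTheta₂ (1 / 2) (2 * t) ^ 2 = jacobiTheta₂ (1 / 2) t * jacobiTheta₂ 0 t := by
  rw [jacobiTheta₂_mul_jacobiTheta₂ _ _ ht]
  simp only [add_zero, sub_zero]
  rw [jacobiTheta₂_half_add_half]
  ring

/-- Since n and n² have the same parity, the sign (−1)ⁿ can be absorbed into the shift t ↦ t+1. This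
makes the estimate for `jacobiTheta` available. -/
theorem jacobiTheta₂_half_eq (t : ℂ) : jacobiTheta₂ (1 / 2) t = jacobiTheta (t + 1) := by
  rw [jacobiTheta_eq_jacobiTheta₂]
  refine tsum_congr fun n => ?_
  simp only [jacobiTheta₂_term]
  rw [Complex.exp_eq_exp_iff_exists_int]
  obtain ⟨k, hk⟩ : ∃ k : ℤ, n - n ^ 2 = 2 * k := by
    rcases Int.even_mul_succ_self (n - 1) with ⟨k, hk⟩
    exact ⟨-k, by linear_combination -hk⟩
  refine ⟨k, ?_⟩
  have hk' : (n : ℂ) - n ^ 2 = 2 * k := by exact_mod_cast hk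
  linear_combination Real.pi * I * hk'

theorem jacobiTheta₂_half_ne_zero_of_one_le {t : ℂ} (ht : 1 ≤ t.im) :
    jacobiTheta₂ (1 / 2) t ≠ 0 := by
  intro h0
  rw [jacobiTheta₂_half_eq] at h0
  have h := norm_jacobiTheta_sub_one_le (τ := t + 1) (by simpa using by linarith)
  have him : (t + 1).im = t.im := by simp
  rw [h0, him] at h
  simp only [zero_sub, norm_neg, norm_one] at h
  set q := Real.exp (-Real.pi * t.im) with hq
  have hq0 : 0 < q := Real.exp_pos _
  -- For q below 1/3 the bound 2q/(1−q) on |θ−1| is below 1.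
  have hq1 : q < 1 / 3 := by
    have h3 : Real.exp (-Real.pi * t.im) ≤ Real.exp (-3) := by
      apply Real.exp_le_exp.2
      nlinarith [Real.pi_gt_three]
    have h4 : Real.exp (-3) < 1 / 3 := by
      rw [Real.exp_neg, one_div]
      apply inv_strictAnti₀ (by norm_num)
      have := Real.add_one_lt_exp (x := 3) (by norm_num)
      linarith
    linarith
  have h5 : 2 / (1 - q) * q < 1 := by
    rw [div_mul_eq_mul_div, div_lt_one (by linarith)]
    linarith
  linarith

/-- By `jacobiTheta₂_half_two_mul_sq` a zero at t forces one at 2t. Doubling eventually reaches Im t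
≥ 1, where the series estimate excludes it. -/
theorem jacobiTheta₂_half_ne_zero {t : ℂ} (ht : 0 < t.im) : jacobiTheta₂ (1 / 2) t ≠ 0 := by
  have key : ∀ n : ℕ, ∀ t : ℂ, 1 ≤ 2 ^ n * t.im → jacobiTheta₂ (1 / 2) t ≠ 0 := by
    intro n
    induction n with
    | zero => intro t h; exact jacobiTheta₂_half_ne_zero_of_one_le (by simpa using h)
    | succ n ih =>
      intro t h h0
      have ht : 0 < t.im := by
        by_contra hc
        have : 2 ^ (n + 1) * t.im ≤ 0 :=
          mul_nonpos_of_nonneg_of_nonpos (by positivity) (not_lt.1 hc)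
        linarith
      have h2 := jacobiTheta₂_half_two_mul_sq ht
      rw [h0, zero_mul] at h2
      refine ih (2 * t) ?_ (by simpa using h2)
      simp only [mul_im, re_ofNat, im_ofNat, zero_mul, add_zero]
      rw [pow_succ] at h
      linarith
  obtain ⟨n, hn⟩ := pow_unbounded_of_one_lt (1 / t.im) (one_lt_two)
  refine key n t ?_
  rw [div_lt_iff₀ ht] at hn
  exact hn.le

theorem jacobiTheta₂_zero_ne_zero {t : ℂ} (ht : 0 < t.im) : jacobiTheta₂ 0 t ≠ 0 := by
  intro h0
  have h2 := jacobiTheta₂_half_two_mul_sq ht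
  rw [h0, mul_zero] at h2
  exact jacobiTheta₂_half_ne_zero (t := 2 * t) (by simpa using ht) (by simpa using h2)

/-- The inversion t ↦ −1/t carries the half period t/2 to 1/2. -/
theorem jacobiTheta₂_half_period_ne_zero {t : ℂ} (ht : 0 < t.im) :
    jacobiTheta₂ (t / 2) t ≠ 0 := by
  have ht0 : t ≠ 0 := by
    rintro rfl
    simp at ht
  have him : 0 < (-1 / t).im := by
    rw [neg_div, neg_im, one_div, inv_im, neg_div, neg_neg]
    exact div_pos ht (normSq_pos.2 ht0)
  rw [jacobiTheta₂_functional_equation]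
  refine mul_ne_zero (mul_ne_zero (one_div_ne_zero ?_) (Complex.exp_ne_zero _)) ?_
  · simp [ht0]
  · rw [show t / 2 / t = 1 / 2 by field_simp]
    exact jacobiTheta₂_half_ne_zero him

/-! ### The theta functions `θ₂`, `θ₃` and the sigma function for the periods of `cd` -/

theorem theta₃_zero_ne_zero {τ : ℂ} (hτ : 0 < τ.im) : theta₃ τ 0 ≠ 0 :=
  jacobiTheta₂_zero_ne_zero hτ

theorem theta₂_zero_ne_zero {τ : ℂ} (hτ : 0 < τ.im) : theta₂ τ 0 ≠ 0 := by
  unfold theta₂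
  rw [zero_add]
  exact mul_ne_zero (Complex.exp_ne_zero _) (jacobiTheta₂_half_period_ne_zero hτ)

/-- The odd theta function whose zeros are the periods of `cd`. -/
def sigmaTheta (τ v : ℂ) : ℂ :=
  cexp (Real.pi * I * τ / 8 + Real.pi * I * v / 2) *
    jacobiTheta₂ (v / 2 + 1 / 2 + τ / 4) (τ / 2)

theorem theta₃_neg (τ v : ℂ) : theta₃ τ (-v) = theta₃ τ v := jacobiTheta₂_neg_left v τ

theorem theta₂_neg (τ v : ℂ) : theta₂ τ (-v) = theta₂ τ v := by
  unfold theta₂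
  rw [← jacobiTheta₂_neg_left (-v + τ / 2), show -(-v + τ / 2) = v - τ / 2 by ring,
    show v + τ / 2 = (v - τ / 2) + τ by ring, jacobiTheta₂_add_left', ← mul_assoc,
    ← Complex.exp_add]
  congr 2
  ring

theorem theta₃_add_one (τ v : ℂ) : theta₃ τ (v + 1) = theta₃ τ v := jacobiTheta₂_add_left v τ

theorem theta₂_add_one (τ v : ℂ) : theta₂ τ (v + 1) = -theta₂ τ v := by
  unfold theta₂
  rw [show v + 1 + τ / 2 = v + τ / 2 + 1 by ring, jacobiTheta₂_add_left,
    show (Real.pi * I * τ / 4 + Real.pi * I * (v + 1) : ℂ) =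
      (Real.pi * I * τ / 4 + Real.pi * I * v) + Real.pi * I by ring, Complex.exp_add,
    Complex.exp_pi_mul_I]
  ring

theorem theta₃_add_tau (τ v : ℂ) :
    theta₃ τ (v + τ) = cexp (-Real.pi * I * (τ + 2 * v)) * theta₃ τ v :=
  jacobiTheta₂_add_left' v τ

theorem theta₂_add_tau (τ v : ℂ) :
    theta₂ τ (v + τ) = cexp (-Real.pi * I * (τ + 2 * v)) * theta₂ τ v := by
  unfold theta₂
  rw [show v + τ + τ / 2 = v + τ / 2 + τ by ring, jacobiTheta₂_add_left', ← mul_assoc,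
    ← mul_assoc, ← Complex.exp_add, ← Complex.exp_add]
  congr 2
  ring

theorem sigmaTheta_neg (τ v : ℂ) : sigmaTheta τ (-v) = -sigmaTheta τ v := by
  unfold sigmaTheta
  rw [← jacobiTheta₂_neg_left (-v / 2 + 1 / 2 + τ / 4), ← jacobiTheta₂_add_left,
    show v / 2 + 1 / 2 + τ / 4 = (-(-v / 2 + 1 / 2 + τ / 4) + 1) + τ / 2 by ring,
    jacobiTheta₂_add_left', ← mul_assoc, ← Complex.exp_add,
    show (Real.pi * I * τ / 8 + Real.pi * I * v / 2 +
      -Real.pi * I * (τ / 2 + 2 * (-(-v / 2 + 1 / 2 + τ / 4) + 1)) : ℂ) =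
      (Real.pi * I * τ / 8 + Real.pi * I * (-v) / 2) - Real.pi * I by ring,
    Complex.exp_sub, Complex.exp_pi_mul_I]
  ring

/-- Up to normalization `sigmaTheta` is θ₁(v/2 | τ/2). In the product formula at period τ/2 the sum
and difference of (u+v)/2 and (u−v)/2 give back u and v at period τ. -/
theorem theta₂_mul_theta₃_sub {τ : ℂ} (hτ : 0 < τ.im) (u v : ℂ) :
    theta₂ τ u * theta₃ τ v - theta₂ τ v * theta₃ τ u =
      sigmaTheta τ (u - v) * sigmaTheta τ (u + v) := by
  have ht : 0 < (τ / 2).im := by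
    simp only [div_ofNat_im]
    linarith
  have key := jacobiTheta₂_mul_jacobiTheta₂ ((u - v) / 2 + 1 / 2 + τ / 4)
    ((u + v) / 2 + 1 / 2 + τ / 4) ht
  rw [show 2 * (τ / 2) = τ by ring,
    show (u - v) / 2 + 1 / 2 + τ / 4 + ((u + v) / 2 + 1 / 2 + τ / 4) + τ / 2 = u + τ + 1 by ring,
    show (u - v) / 2 + 1 / 2 + τ / 4 - ((u + v) / 2 + 1 / 2 + τ / 4) + τ / 2 = -(v - τ / 2) by ring,
    show (u - v) / 2 + 1 / 2 + τ / 4 + ((u + v) / 2 + 1 / 2 + τ / 4) = u + τ / 2 + 1 by ring,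
    show (u - v) / 2 + 1 / 2 + τ / 4 - ((u + v) / 2 + 1 / 2 + τ / 4) = -v by ring,
    jacobiTheta₂_add_left, jacobiTheta₂_add_left, jacobiTheta₂_neg_left, jacobiTheta₂_neg_left,
    jacobiTheta₂_add_left'] at key
  have h2 := jacobiTheta₂_add_left' (v - τ / 2) τ
  rw [show v - τ / 2 + τ = v + τ / 2 by ring] at h2
  unfold sigmaTheta theta₂ theta₃
  rw [h2, mul_mul_mul_comm, key]
  have e1 : cexp (Real.pi * I * τ / 8 + Real.pi * I * (u - v) / 2) *
      cexp (Real.pi * I * τ / 8 + Real.pi * I * (u + v) / 2) =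
      cexp (Real.pi * I * τ / 4 + Real.pi * I * u) := by
    rw [← Complex.exp_add]
    congr 1
    ring
  have e2 : cexp (Real.pi * I * τ / 4 + Real.pi * I * u) *
      (cexp (2 * Real.pi * I * ((u - v) / 2 + 1 / 2 + τ / 4) + Real.pi * I * (τ / 2)) *
        cexp (-Real.pi * I * (τ + 2 * u))) =
      -(cexp (Real.pi * I * τ / 4 + Real.pi * I * v) *
        cexp (-Real.pi * I * (τ + 2 * (v - τ / 2)))) := by
    rw [← Complex.exp_add, ← Complex.exp_add, ← Complex.exp_add, ← Complex.exp_add_pi_mul_I]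
    congr 1
    ring
  rw [e1]
  linear_combination -(jacobiTheta₂ u τ * jacobiTheta₂ (v - τ / 2) τ) * e2

end EllipticPainleve

end

/-! ### Entire functions, and the presentation of cd as a quotient f/g. -/

noncomputable section

namespace EllipticPainleve

open Complex Filter Topology

theorem differentiable_theta₃ {τ : ℂ} (hτ : 0 < τ.im) : Differentiable ℂ (theta₃ τ) :=
  fun v => differentiableAt_jacobiTheta₂_fst v hτ

theorem differentiable_theta₂ {τ : ℂ} (hτ : 0 < τ.im) : Differentiable ℂ (theta₂ τ) := by
  have h : Differentiable ℂ (fun v => jacobiTheta₂ v τ) := differentiable_theta₃ hτ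
  have h2 : Differentiable ℂ (fun v => jacobiTheta₂ (v + τ / 2) τ) :=
    h.comp (differentiable_id.add_const _)
  unfold theta₂
  exact Differentiable.mul (by fun_prop) h2

theorem differentiable_sigmaTheta {τ : ℂ} (hτ : 0 < τ.im) :
    Differentiable ℂ (sigmaTheta τ) := by
  have h : Differentiable ℂ (fun v => jacobiTheta₂ v (τ / 2)) :=
    differentiable_theta₃ (τ := τ / 2) (by simp only [div_ofNat_im]; linarith)
  have h2 : Differentiable ℂ (fun v => jacobiTheta₂ (v / 2 + 1 / 2 + τ / 4) (τ / 2)) :=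
    h.comp (by fun_prop)
  unfold sigmaTheta
  exact Differentiable.mul (by fun_prop) h2

/-- A nonzero entire function vanishes nowhere in a punctured neighbourhood of each point. -/
theorem eventually_ne_zero_of_entire {F : ℂ → ℂ} (hF : Differentiable ℂ F) (h0 : ∃ u, F u ≠ 0)
    (u : ℂ) : ∀ᶠ v in 𝓝[≠] u, F v ≠ 0 := by
  rcases (hF.analyticAt u).eventually_eq_zero_or_eventually_ne_zero with h | h
  · obtain ⟨w, hw⟩ := h0
    have hA : AnalyticOnNhd ℂ F Set.univ := fun z _ => hF.analyticAt z
    exact absurd (hA.eqOn_zero_of_preconnected_of_eventuallyEq_zero isPreconnected_univ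
      (Set.mem_univ u) h (Set.mem_univ w)) hw
  · exact h

/-- The same along an affine line. -/
theorem eventually_comp_line_ne_zero {F : ℂ → ℂ} (hF : Differentiable ℂ F) (h0 : ∃ u, F u ≠ 0)
    (a : ℂ) {b : ℂ} (hb : b ≠ 0) : ∀ᶠ z in 𝓝[≠] (0 : ℂ), F (a + z * b) ≠ 0 := by
  have hG : Differentiable ℂ (fun z : ℂ => F (a + z * b)) := hF.comp (by fun_prop)
  refine eventually_ne_zero_of_entire hG ?_ 0
  obtain ⟨u, hu⟩ := h0
  exact ⟨(u - a) / b, by rwa [div_mul_cancel₀ _ hb, add_sub_cancel]⟩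

/-- A presentation `cd = f / g` by even entire functions whose Wronskian-like bracket splits. -/
structure CdSystem (τ : ℂ) (f g σ : ℂ → ℂ) : Prop where
  cd_eq : ∀ u, cd τ u = f u / g u
  reg_iff : ∀ u, CdReg τ u ↔ g u ≠ 0
  bracket : ∀ u v, f u * g v - f v * g u = σ (u - v) * σ (u + v)
  f_neg : ∀ u, f (-u) = f u
  g_neg : ∀ u, g (-u) = g u
  σ_neg : ∀ u, σ (-u) = -σ u
  f_diff : Differentiable ℂ f
  g_diff : Differentiable ℂ g
  σ_diff : Differentiable ℂ σ
  f_ne : ∃ u, f u ≠ 0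
  g_ne : ∃ u, g u ≠ 0
  σ_ne : ∃ u, σ u ≠ 0
  surj : ∀ x, ∃ u, g u ≠ 0 ∧ x * g u = f u

/-- A shift by 1 changes the sign of θ₂ but not of θ₃, so the bracket at (1, 0) is −2θ₂(0)θ₃(0). -/
theorem sigmaTheta_exists_ne_zero {τ : ℂ} (hτ : 0 < τ.im) : ∃ u, sigmaTheta τ u ≠ 0 := by
  by_contra! h
  have h1 := theta₂_mul_theta₃_sub hτ 1 0
  have h2 := theta₂_add_one τ 0
  have h3 := theta₃_add_one τ 0
  rw [zero_add] at h2 h3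
  rw [h, zero_mul, h2, h3] at h1
  have h4 : 2 * (theta₂ τ 0 * theta₃ τ 0) = 0 := by linear_combination -h1
  simp [theta₂_zero_ne_zero hτ, theta₃_zero_ne_zero hτ] at h4

/-- At a common zero u the bracket with every v would vanish, so σ(u−v)σ(u+v) would be identically
zero in v. -/
theorem theta₂_theta₃_no_common_zero {τ : ℂ} (hτ : 0 < τ.im) (u : ℂ) :
    theta₂ τ u ≠ 0 ∨ theta₃ τ u ≠ 0 := by
  by_contra! h
  have hd := differentiable_sigmaTheta hτ
  have hs : ∀ v, sigmaTheta τ (u - v) * sigmaTheta τ (u + v) = 0 := fun v => by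
    rw [← theta₂_mul_theta₃_sub hτ, h.1, h.2]; ring
  have h1 := eventually_comp_line_ne_zero hd (sigmaTheta_exists_ne_zero hτ) u one_ne_zero
  have h2 := eventually_comp_line_ne_zero hd (sigmaTheta_exists_ne_zero hτ) u
    (neg_ne_zero.2 one_ne_zero)
  obtain ⟨z, hz1, hz2⟩ := (h1.and h2).exists
  apply mul_ne_zero hz2 hz1
  have := hs z
  rwa [show u + z * -1 = u - z by ring, show u + z * 1 = u + z by ring]

theorem bounded_of_doubly_periodic {F : ℂ → ℂ} (hF : Continuous F) {τ : ℂ} (hτ : 0 < τ.im)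
    (h2 : ∀ v, F (v + 2) = F v) (ht : ∀ v, F (v + τ) = F v) :
    Bornology.IsBounded (Set.range F) := by
  have h2' : Function.Periodic F 2 := h2
  have ht' : Function.Periodic F τ := ht
  have hK : IsCompact ((fun p : ℝ × ℝ => F (p.1 * 2 + p.2 * τ)) ''
      (Set.Icc 0 1 ×ˢ Set.Icc 0 1)) :=
    (isCompact_Icc.prod isCompact_Icc).image (by fun_prop)
  refine hK.isBounded.subset ?_
  rintro _ ⟨v, rfl⟩
  set b : ℝ := v.im / τ.im with hb
  set a : ℝ := (v.re - b * τ.re) / 2 with ha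
  have hv : v = a * 2 + b * τ := by
    apply Complex.ext
    · simp [ha]
    · simp [hb, hτ.ne']
  refine ⟨(Int.fract a, Int.fract b), ⟨⟨Int.fract_nonneg _, (Int.fract_lt_one _).le⟩,
    ⟨Int.fract_nonneg _, (Int.fract_lt_one _).le⟩⟩, ?_⟩
  have e : v = (((Int.fract a : ℝ) : ℂ) * 2 + ((Int.fract b : ℝ) : ℂ) * τ) + (⌊a⌋ : ℂ) * 2 +
      (⌊b⌋ : ℂ) * τ := by
    have e1 : ((Int.fract a : ℝ) : ℂ) = a - (⌊a⌋ : ℂ) := by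
      rw [Int.fract]; push_cast; rfl
    have e2 : ((Int.fract b : ℝ) : ℂ) = b - (⌊b⌋ : ℂ) := by
      rw [Int.fract]; push_cast; rfl
    rw [e1, e2]
    linear_combination hv
  conv_rhs => rw [e, (ht'.int_mul ⌊b⌋) _, (h2'.int_mul ⌊a⌋) _]

/-- Every complex number is a value of `θ₂ / θ₃`. -/
theorem theta₂_div_theta₃_surjective {τ : ℂ} (hτ : 0 < τ.im) (x : ℂ) :
    ∃ v, theta₂ τ v = x * theta₃ τ v := by
  by_contra! hne
  have hne' : ∀ v, theta₂ τ v - x * theta₃ τ v ≠ 0 := fun v => sub_ne_zero.2 (hne v)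
  -- If x were omitted, F would be entire with periods 2 and τ, hence constant by Liouville. Its
  -- values at 0 and 1 differ, because only θ₂ changes sign.
  set F : ℂ → ℂ := fun v => theta₃ τ v / (theta₂ τ v - x * theta₃ τ v) with hFdef
  have hF : Differentiable ℂ F :=
    (differentiable_theta₃ hτ).div
      ((differentiable_theta₂ hτ).sub ((differentiable_theta₃ hτ).const_mul x)) hne'
  have h2 : ∀ v, F (v + 2) = F v := fun v => by
    simp only [hFdef]
    rw [show v + 2 = v + 1 + 1 by ring]
    simp only [theta₂_add_one, theta₃_add_one, neg_neg]
  have ht : ∀ v, F (v + τ) = F v := fun v => by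
    simp only [hFdef]
    rw [theta₂_add_tau, theta₃_add_tau, mul_left_comm, ← mul_sub,
      mul_div_mul_left _ _ (Complex.exp_ne_zero _)]
  have hb := bounded_of_doubly_periodic hF.continuous hτ h2 ht
  have hc := hF.apply_eq_apply_of_bounded hb 1 0
  simp only [hFdef] at hc
  rw [div_eq_div_iff (hne' _) (hne' _)] at hc
  have e2 := theta₂_add_one τ 0
  have e3 := theta₃_add_one τ 0
  rw [zero_add] at e2 e3
  rw [e2, e3] at hc
  have h4 : 2 * (theta₂ τ 0 * theta₃ τ 0) = 0 := by linear_combination hc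
  simp [theta₂_zero_ne_zero hτ, theta₃_zero_ne_zero hτ] at h4

theorem exists_cdSystem {τ : ℂ} (hτ : 0 < τ.im) : ∃ f g σ, CdSystem τ f g σ := by
  have h2 := theta₂_zero_ne_zero hτ
  have h3 := theta₃_zero_ne_zero hτ
  have hk : (Real.pi * theta₃ τ 0 ^ 2 : ℂ) ≠ 0 :=
    mul_ne_zero (by exact_mod_cast Real.pi_ne_zero) (pow_ne_zero _ h3)
  -- The factor θ₃(0)/θ₂(0) of f appears once in the bracket, so each of the two σ factors receives
  -- its square root.
  obtain ⟨r, hr⟩ := IsAlgClosed.exists_pow_nat_eq (theta₃ τ 0 / theta₂ τ 0) (two_pos)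
  have hr0 : r ≠ 0 := by
    rintro rfl
    exact div_ne_zero h3 h2 (by simpa using hr.symm)
  have hA : Differentiable ℂ (thetaArg τ) := by unfold thetaArg; fun_prop
  have hAs : ∀ v, thetaArg τ (v * (Real.pi * theta₃ τ 0 ^ 2)) = v := fun v =>
    mul_div_cancel_right₀ _ hk
  have hneg : ∀ u, thetaArg τ (-u) = -thetaArg τ u := fun u => neg_div _ _
  have hsub : ∀ u v, thetaArg τ (u - v) = thetaArg τ u - thetaArg τ v := fun u v => sub_div _ _ _
  have hadd : ∀ u v, thetaArg τ (u + v) = thetaArg τ u + thetaArg τ v := fun u v => add_div _ _ _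
  refine ⟨fun u => theta₃ τ 0 / theta₂ τ 0 * theta₂ τ (thetaArg τ u),
    fun u => theta₃ τ (thetaArg τ u), fun u => r * sigmaTheta τ (thetaArg τ u), ?_⟩
  constructor
  · intro u
    rw [cd, mul_div_mul_comm, mul_div_assoc]
  · exact fun u => Iff.rfl
  · intro u v
    rw [hsub, hadd]
    linear_combination (theta₃ τ 0 / theta₂ τ 0) *
      theta₂_mul_theta₃_sub hτ (thetaArg τ u) (thetaArg τ v) -
      sigmaTheta τ (thetaArg τ u - thetaArg τ v) * sigmaTheta τ (thetaArg τ u + thetaArg τ v) * hr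
  · intro u
    simp only [hneg, theta₂_neg]
  · intro u
    simp only [hneg, theta₃_neg]
  · intro u
    simp only [hneg, sigmaTheta_neg, mul_neg]
  · exact ((differentiable_theta₂ hτ).comp hA).const_mul _
  · exact (differentiable_theta₃ hτ).comp hA
  · exact ((differentiable_sigmaTheta hτ).comp hA).const_mul _
  · refine ⟨0 * (Real.pi * theta₃ τ 0 ^ 2), ?_⟩
    simp only [hAs]
    exact mul_ne_zero (div_ne_zero h3 h2) h2
  · refine ⟨0 * (Real.pi * theta₃ τ 0 ^ 2), ?_⟩
    simp only [hAs]
    exact h3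
  · obtain ⟨v, hv⟩ := sigmaTheta_exists_ne_zero hτ
    refine ⟨v * (Real.pi * theta₃ τ 0 ^ 2), ?_⟩
    simp only [hAs]
    exact mul_ne_zero hr0 hv
  · intro x
    obtain ⟨v, hv⟩ := theta₂_div_theta₃_surjective hτ (x * (theta₂ τ 0 / theta₃ τ 0))
    refine ⟨v * (Real.pi * theta₃ τ 0 ^ 2), ?_⟩
    simp only [hAs]
    refine ⟨fun h0 => ?_, ?_⟩
    · rcases theta₂_theta₃_no_common_zero hτ v with h | h
      · exact h (by rw [hv, h0, mul_zero])
      · exact h h0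
    · rw [hv]
      field_simp

end EllipticPainleve

end

noncomputable section

namespace EllipticPainleve

namespace CdSystem

variable {τ : ℂ} {f g σ : ℂ → ℂ}

/-! ### Factorizations through the sigma function -/

/-- This is the Plücker relation for the 2×2 minors of the vectors (f, g) at a, b, c, d. -/
theorem three_term (S : CdSystem τ f g σ) (a b c d : ℂ) :
    σ (a - b) * σ (a + b) * (σ (c - d) * σ (c + d)) -
      σ (a - c) * σ (a + c) * (σ (b - d) * σ (b + d)) +
      σ (a - d) * σ (a + d) * (σ (b - c) * σ (b + c)) = 0 := by
  simp only [← S.bracket]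
  ring

theorem cd_sub_cd (S : CdSystem τ f g σ) {u v : ℂ} (hu : CdReg τ u) (hv : CdReg τ v) :
    cd τ u - cd τ v = σ (u - v) * σ (u + v) / (g u * g v) := by
  rw [S.reg_iff] at hu hv
  rw [S.cd_eq, S.cd_eq, div_sub_div _ _ hu hv, ← S.bracket]
  ring

theorem cd_neg (S : CdSystem τ f g σ) (u : ℂ) : cd τ (-u) = cd τ u := by
  rw [S.cd_eq, S.cd_eq, S.f_neg, S.g_neg]

theorem cdReg_neg (S : CdSystem τ f g σ) (u : ℂ) : CdReg τ (-u) ↔ CdReg τ u := by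
  rw [S.reg_iff, S.reg_iff, S.g_neg]

theorem cdQuotReg_iff (S : CdSystem τ f g σ) {u v w : ℂ} :
    CdQuotReg τ u v w ↔
      g u ≠ 0 ∧ g v ≠ 0 ∧ g w ≠ 0 ∧ f w ≠ 0 ∧ σ (w - v) ≠ 0 ∧ σ (w + v) ≠ 0 := by
  unfold CdQuotReg
  simp only [S.reg_iff]
  refine and_congr_right fun hu => and_congr_right fun hv => and_congr_right fun hw => ?_
  rw [S.cd_eq w, div_ne_zero_iff]
  constructor
  · rintro ⟨⟨hf, -⟩, h⟩
    refine ⟨hf, ?_⟩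
    rw [← mul_ne_zero_iff, ← S.bracket]
    contrapose! h
    rw [S.cd_eq v]
    field_simp
    linear_combination h
  · rintro ⟨hf, h⟩
    refine ⟨⟨hf, hw⟩, ?_⟩
    rw [← mul_ne_zero_iff, ← S.bracket] at h
    contrapose! h
    rw [S.cd_eq v] at h
    field_simp at h
    linear_combination h

/-- Normalizing by w cancels f(w) and g(w); only sigma functions and the denominators g(u), g(v)
remain. -/
theorem cdQuot_eq (S : CdSystem τ f g σ) {u v w : ℂ} (h : CdQuotReg τ u v w) :
    cdQuot τ u v w = σ (w - u) * σ (w + u) * g v / (σ (w - v) * σ (w + v) * g u) := by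
  obtain ⟨hu, hv, hw, hf, h1, h2⟩ := S.cdQuotReg_iff.1 h
  have hb : f w * g v - f v * g w ≠ 0 := by
    rw [S.bracket]; exact mul_ne_zero h1 h2
  rw [cdQuot, S.cd_eq, S.cd_eq v, S.cd_eq w, ← S.bracket, ← S.bracket]
  have e1 : 1 - f u / g u / (f w / g w) = (f w * g u - f u * g w) / (g u * f w) := by
    field_simp
  have e2 : 1 - f v / g v / (f w / g w) = (f w * g v - f v * g w) / (g v * f w) := by
    field_simp
  rw [e1, e2]
  field_simp

/-- The form `y g(a) - f(a)`, which vanishes at `y = cd a`. -/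
def _root_.EllipticPainleve.cdForm (f g : ℂ → ℂ) (y a : ℂ) : ℂ := y * g a - f a

theorem sub_cd (S : CdSystem τ f g σ) {a : ℂ} (ha : CdReg τ a) (y : ℂ) :
    y - cd τ a = cdForm f g y a / g a := by
  rw [S.reg_iff] at ha
  rw [S.cd_eq, cdForm]
  field_simp

theorem cdForm_mul (S : CdSystem τ f g σ) {x u : ℂ} (hx : x * g u = f u) (a : ℂ) :
    cdForm f g x a * g u = σ (u - a) * σ (u + a) := by
  rw [← S.bracket, cdForm]
  linear_combination g a * hx

/-- Three vectors (f, g) in a plane are linearly dependent, with their brackets as coefficients; y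
need not be written as a value of cd. -/
theorem cdForm_three_term (S : CdSystem τ f g σ) (y a b c : ℂ) :
    cdForm f g y a * (σ (b - c) * σ (b + c)) - cdForm f g y b * (σ (a - c) * σ (a + c)) +
      cdForm f g y c * (σ (a - b) * σ (a + b)) = 0 := by
  simp only [← S.bracket, cdForm]
  ring

/-! ### The reflection `s₂` in adapted coordinates -/

/-- All sigma factors cancel in pairs. What is left only converts differences y − cd a into the
forms `cdForm`. -/
theorem s₂Const_eq (S : CdSystem τ f g σ) {c₁ c₂ η : ℂ}
    (h1 : CdQuotReg τ (η - c₂) (η - c₁) η) (h2 : CdQuotReg τ (η + c₁) (η + c₂) η)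
    (h3 : CdQuotReg τ (2 * η - (c₁ - c₂) / 2) (2 * η + (c₁ - c₂) / 2) ((c₁ + c₂) / 2)) :
    s₂Const τ c₁ c₂ η = g (η - c₁) * g (η + c₂) * g (2 * η + (c₁ - c₂) / 2) /
      (g (η - c₂) * g (η + c₁) * g (2 * η - (c₁ - c₂) / 2)) := by
  rw [s₂Const, S.cdQuot_eq h1, S.cdQuot_eq h2, S.cdQuot_eq h3]
  obtain ⟨g1, g2, -, -, a1, a2⟩ := S.cdQuotReg_iff.1 h1
  obtain ⟨g3, g4, -, -, a3, a4⟩ := S.cdQuotReg_iff.1 h2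
  obtain ⟨g5, g6, -, -, a5, a6⟩ := S.cdQuotReg_iff.1 h3
  rw [show η - (η - c₁) = c₁ by ring, show η + (η - c₁) = 2 * η - c₁ by ring,
    show η - (η + c₂) = -c₂ by ring, show η + (η + c₂) = 2 * η + c₂ by ring,
    show (c₁ + c₂) / 2 - (2 * η + (c₁ - c₂) / 2) = -(2 * η - c₂) by ring,
    show (c₁ + c₂) / 2 + (2 * η + (c₁ - c₂) / 2) = 2 * η + c₁ by ring] at *
  rw [show η - (η - c₂) = c₂ by ring, show η + (η - c₂) = 2 * η - c₂ by ring,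
    show η - (η + c₁) = -c₁ by ring, show η + (η + c₁) = 2 * η + c₁ by ring,
    show (c₁ + c₂) / 2 - (2 * η - (c₁ - c₂) / 2) = -(2 * η - c₁) by ring,
    show (c₁ + c₂) / 2 + (2 * η - (c₁ - c₂) / 2) = 2 * η + c₂ by ring]
  simp only [S.σ_neg, neg_ne_zero] at *
  field_simp

/-- The common denominator of `s₂(y)` up to nonvanishing factors. -/
def _root_.EllipticPainleve.s₂Form (f g σ : ℂ → ℂ) (c₁ c₂ η u y : ℂ) : ℂ :=
  g (2 * η - (c₁ - c₂) / 2) *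
      (σ (u - (η + c₁)) * σ (u + (η + c₁)) * cdForm f g y (η - c₂)) -
    g (2 * η + (c₁ - c₂) / 2) *
      (σ (u - (η + c₂)) * σ (u + (η + c₂)) * cdForm f g y (η - c₁))

theorem s₂Y_eq (S : CdSystem τ f g σ) {c₁ c₂ η x y u : ℂ} (h : S₂Reg τ c₁ c₂ η x y)
    (hu : g u ≠ 0) (hx : x * g u = f u) :
    s₂Form f g σ c₁ c₂ η u y ≠ 0 ∧
    s₂Y τ c₁ c₂ η x y * s₂Form f g σ c₁ c₂ η u y =
      f (2 * η - (c₁ - c₂) / 2) *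
        (σ (u - (η + c₁)) * σ (u + (η + c₁)) * cdForm f g y (η - c₂)) -
      f (2 * η + (c₁ - c₂) / 2) *
        (σ (u - (η + c₂)) * σ (u + (η + c₂)) * cdForm f g y (η - c₁)) := by
  obtain ⟨h1, h2, h3, -, -, -, -, hD⟩ := h
  have hK := S.s₂Const_eq h1 h2 h3
  obtain ⟨g1, g2, -⟩ := S.cdQuotReg_iff.1 h1
  obtain ⟨g3, g4, -⟩ := S.cdQuotReg_iff.1 h2
  obtain ⟨g5, g6, -⟩ := S.cdQuotReg_iff.1 h3
  have x1 := S.cdForm_mul hx (η + c₁)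
  have x2 := S.cdForm_mul hx (η + c₂)
  unfold s₂Y
  have eD : s₂Den τ c₁ c₂ η x y = σ (u - (η + c₁)) * σ (u + (η + c₁)) * cdForm f g y (η - c₂) /
      (g u * g (η + c₁) * g (η - c₂)) := by
    rw [s₂Den, S.sub_cd h2.1, S.sub_cd h1.1, ← x1]
    field_simp
  have eN : s₂Num τ c₁ c₂ η x y = g (2 * η + (c₁ - c₂) / 2) *
      (σ (u - (η + c₂)) * σ (u + (η + c₂)) * cdForm f g y (η - c₁)) /
      (g u * g (η + c₁) * g (η - c₂) * g (2 * η - (c₁ - c₂) / 2)) := by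
    rw [s₂Num, S.sub_cd h2.2.1, S.sub_cd h1.2.1, hK, ← x2]
    field_simp
  have eDN : s₂Den τ c₁ c₂ η x y - s₂Num τ c₁ c₂ η x y = s₂Form f g σ c₁ c₂ η u y /
      (g u * g (η + c₁) * g (η - c₂) * g (2 * η - (c₁ - c₂) / 2)) := by
    rw [eD, eN, s₂Form]
    generalize 2 * η - (c₁ - c₂) / 2 = A at *
    generalize 2 * η + (c₁ - c₂) / 2 = B at *
    field_simp
  rw [eDN] at hD ⊢
  have hF : s₂Form f g σ c₁ c₂ η u y ≠ 0 := fun h0 => hD (by rw [h0, zero_div])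
  refine ⟨hF, ?_⟩
  rw [eD, eN, S.cd_eq, S.cd_eq]
  generalize 2 * η - (c₁ - c₂) / 2 = A at *
  generalize 2 * η + (c₁ - c₂) / 2 = B at *
  field_simp

/-- At this argument the brackets with 2η ∓ (c₁−c₂)/2 supply σ(u+η+c₂) and σ(u+η+c₁). Both terms
then contain their product, and the rest is the three-term relation of y at η−c₁, η−c₂, 2η−u. -/
theorem s₂_step_minus (S : CdSystem τ f g σ) {c₁ c₂ η Y y u : ℂ}
    (hY : Y * s₂Form f g σ c₁ c₂ η u y =
      f (2 * η - (c₁ - c₂) / 2) *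
        (σ (u - (η + c₁)) * σ (u + (η + c₁)) * cdForm f g y (η - c₂)) -
      f (2 * η + (c₁ - c₂) / 2) *
        (σ (u - (η + c₂)) * σ (u + (η + c₂)) * cdForm f g y (η - c₁))) :
    s₂Form f g σ c₁ c₂ η u y * cdForm f g Y (η - (c₁ + c₂) / 2 - u) =
      σ (u + (η + c₁)) * σ (u + (η + c₂)) * (σ (c₂ - c₁) * σ (2 * η - c₁ - c₂)) *
        cdForm f g y (2 * η - u) := by
  have b1 := S.bracket (2 * η - (c₁ - c₂) / 2) (η - (c₁ + c₂) / 2 - u)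
  have b2 := S.bracket (2 * η + (c₁ - c₂) / 2) (η - (c₁ + c₂) / 2 - u)
  rw [show 2 * η - (c₁ - c₂) / 2 - (η - (c₁ + c₂) / 2 - u) = u + (η + c₂) by ring,
    show 2 * η - (c₁ - c₂) / 2 + (η - (c₁ + c₂) / 2 - u) = 3 * η - c₁ - u by ring] at b1
  rw [show 2 * η + (c₁ - c₂) / 2 - (η - (c₁ + c₂) / 2 - u) = u + (η + c₁) by ring,
    show 2 * η + (c₁ - c₂) / 2 + (η - (c₁ + c₂) / 2 - u) = 3 * η - c₂ - u by ring] at b2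
  have b3 := S.cdForm_three_term y (η - c₁) (η - c₂) (2 * η - u)
  rw [show η - c₂ - (2 * η - u) = u - (η + c₂) by ring,
    show η - c₂ + (2 * η - u) = 3 * η - c₂ - u by ring,
    show η - c₁ - (2 * η - u) = u - (η + c₁) by ring,
    show η - c₁ + (2 * η - u) = 3 * η - c₁ - u by ring,
    show η - c₁ - (η - c₂) = c₂ - c₁ by ring,
    show η - c₁ + (η - c₂) = 2 * η - c₁ - c₂ by ring] at b3
  set s := s₂Form f g σ c₁ c₂ η u y with hs
  have e : s * cdForm f g Y (η - (c₁ + c₂) / 2 - u) =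
      σ (u - (η + c₁)) * σ (u + (η + c₁)) * cdForm f g y (η - c₂) *
        (σ (u + (η + c₂)) * σ (3 * η - c₁ - u)) -
      σ (u - (η + c₂)) * σ (u + (η + c₂)) * cdForm f g y (η - c₁) *
        (σ (u + (η + c₁)) * σ (3 * η - c₂ - u)) := by
    rw [← b1, ← b2, cdForm, mul_sub, ← mul_assoc, mul_comm s Y, hY, hs, s₂Form]
    ring
  rw [e]
  linear_combination -σ (u + (η + c₁)) * σ (u + (η + c₂)) * b3

/-- Both u and −u label the fibre x = cd u. Hence the two relations of `s₂_step` are one relation at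
u and at −u, with the same denominator. -/
theorem s₂Form_neg (S : CdSystem τ f g σ) (c₁ c₂ η u y : ℂ) :
    s₂Form f g σ c₁ c₂ η (-u) y = s₂Form f g σ c₁ c₂ η u y := by
  unfold s₂Form
  rw [show -u - (η + c₁) = -(u + (η + c₁)) by ring, show -u + (η + c₁) = -(u - (η + c₁)) by ring,
    show -u - (η + c₂) = -(u + (η + c₂)) by ring, show -u + (η + c₂) = -(u - (η + c₂)) by ring]
  simp only [S.σ_neg]
  ring

/-- In the pencil parameters `y - cd(2η ∓ u)` on the fibre `x = cd u`, the reflection `s₂` is a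
multiplication by explicit products of sigma functions. -/
theorem s₂_step (S : CdSystem τ f g σ) {c₁ c₂ η x y u : ℂ} (h : S₂Reg τ c₁ c₂ η x y)
    (hu : g u ≠ 0) (hx : x * g u = f u) :
    ∃ k,
      cdForm f g (s₂Y τ c₁ c₂ η x y) (η - (c₁ + c₂) / 2 - u) =
        k * (σ (u + (η + c₁)) * σ (u + (η + c₂))) * cdForm f g y (2 * η - u) ∧
      cdForm f g (s₂Y τ c₁ c₂ η x y) (η - (c₁ + c₂) / 2 + u) =
        k * (σ (u - (η + c₁)) * σ (u - (η + c₂))) * cdForm f g y (2 * η + u) := by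
  obtain ⟨hF, hY⟩ := S.s₂Y_eq h hu hx
  have hu' : g (-u) ≠ 0 := by rwa [S.g_neg]
  have hx' : x * g (-u) = f (-u) := by rwa [S.g_neg, S.f_neg]
  obtain ⟨-, hY'⟩ := S.s₂Y_eq h hu' hx'
  have m1 := S.s₂_step_minus hY
  have m2 := S.s₂_step_minus hY'
  rw [S.s₂Form_neg] at m2
  refine ⟨σ (c₂ - c₁) * σ (2 * η - c₁ - c₂) / s₂Form f g σ c₁ c₂ η u y, ?_, ?_⟩
  · rw [div_mul_eq_mul_div, div_mul_eq_mul_div, eq_div_iff hF]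
    linear_combination m1
  · rw [show η - (c₁ + c₂) / 2 - -u = η - (c₁ + c₂) / 2 + u by ring,
      show 2 * η - -u = 2 * η + u by ring, show -u + (η + c₁) = -(u - (η + c₁)) by ring,
      show -u + (η + c₂) = -(u - (η + c₂)) by ring, S.σ_neg, S.σ_neg] at m2
    rw [div_mul_eq_mul_div, div_mul_eq_mul_div, eq_div_iff hF]
    linear_combination m2

end CdSystem

end EllipticPainleve

end

noncomputable section

namespace EllipticPainleve

/-! ### The word `R` -/

/-- The state reached from `p` along a word. -/
def run (τ : ℂ) (w : List (Fin 9)) (p : State) : State := w.foldl (fun q i => step τ i q) p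

/-- The action on functions is by substitution, so evaluation at a point applies the letters from
left to right. -/
theorem actWord_eq_run {α : Type*} (τ : ℂ) (w : List (Fin 9)) (F : State → α) (p : State) :
    actWord τ w F p = F (run τ w p) := by
  induction w generalizing p with
  | nil => rfl
  | cons i w ih => exact ih (step τ i p)

theorem run_append (τ : ℂ) (w w' : List (Fin 9)) (p : State) :
    run τ (w ++ w') p = run τ w' (run τ w p) := List.foldl_append

theorem wordReg_append (τ : ℂ) (w w' : List (Fin 9)) (p : State) :
    WordReg τ (w ++ w') p ↔ WordReg τ w p ∧ WordReg τ w' (run τ w p) := by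
  induction w generalizing p with
  | nil => simp [WordReg, run]
  | cons i w ih =>
    rw [List.cons_append, WordReg, WordReg, ih, and_assoc]
    rfl

theorem wordReg_of_two_notMem (τ : ℂ) (w : List (Fin 9)) (hw : 2 ∉ w) (p : State) :
    WordReg τ w p := by
  induction w generalizing p with
  | nil => trivial
  | cons i w ih =>
    rw [List.mem_cons, not_or] at hw
    exact ⟨fun h => absurd h.symm hw.1, ih hw.2 _⟩

theorem run_two (τ a₁ a₂ a₃ a₄ a₅ a₆ a₇ a₈ η x y : ℂ) :
    run τ [2] (![a₁, a₂, a₃, a₄, a₅, a₆, a₇, a₈], η, x, y) =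
      (![a₁ - 3 * ((2 * η + a₁ + a₂) / 4), a₂ - 3 * ((2 * η + a₁ + a₂) / 4),
        a₃ + (2 * η + a₁ + a₂) / 4, a₄ + (2 * η + a₁ + a₂) / 4, a₅ + (2 * η + a₁ + a₂) / 4,
        a₆ + (2 * η + a₁ + a₂) / 4, a₇ + (2 * η + a₁ + a₂) / 4, a₈ + (2 * η + a₁ + a₂) / 4],
        η - (2 * η + a₁ + a₂) / 4, x, s₂Y τ a₁ a₂ η x y) := by
  refine Prod.ext ?_ rfl
  funext j
  simp only [run, List.foldl, step, State.c, State.η]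
  fin_cases j <;> simp [mul_div_assoc]

theorem run_swap_fst_snd (τ a₁ a₂ a₃ a₄ a₅ a₆ a₇ a₈ η x y : ℂ) :
    run τ [3, 4, 8, 3] (![a₁, a₂, a₃, a₄, a₅, a₆, a₇, a₈], η, x, y) =
      (![a₃, a₄, a₁, a₂, a₅, a₆, a₇, a₈], η, x, y) := by
  refine Prod.ext ?_ rfl
  funext j
  fin_cases j <;> rfl

theorem run_swap_halves (τ a₁ a₂ a₃ a₄ a₅ a₆ a₇ a₈ η x y : ℂ) :
    run τ [5, 6, 4, 5, 7, 0, 6, 7, 3, 4, 8, 3, 5, 6, 4, 5]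
        (![a₁, a₂, a₃, a₄, a₅, a₆, a₇, a₈], η, x, y) =
      (![a₅, a₆, a₇, a₈, a₁, a₂, a₃, a₄], η, x, y) := by
  refine Prod.ext ?_ rfl
  funext j
  fin_cases j <;> rfl

/-- Each s₂ acts on the pair in the first two places; the words between bring the next pair there.
The original pairs are used in the order (c₁,c₂), (c₃,c₄), (c₅,c₆), (c₇,c₈). -/
theorem RJ2_eq : RJ2 = [2] ++ ([3, 4, 8, 3] ++ ([2] ++
    ([5, 6, 4, 5, 7, 0, 6, 7, 3, 4, 8, 3, 5, 6, 4, 5] ++ ([2] ++ ([3, 4, 8, 3] ++ ([2] ++ [1])))))) :=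
  rfl

/-- The shift of the parameters at a reflection `s₂`. -/
def shift (c₁ c₂ η : ℂ) : ℂ := (2 * η + c₁ + c₂) / 4

/-- The values of `y` after the successive reflections `s₂` in `R`. -/
def stageY₁ (τ : ℂ) (c : Fin 8 → ℂ) (η x y : ℂ) : ℂ := s₂Y τ (c 0) (c 1) η x y

/-- A shift by s preserves 2η + c_i + c_j for a pair not yet used, since 2(η−s) + (c_i+s) + (c_j+s)
is unchanged. So the accumulated shift is the sum of the `shift`s of the original pairs. -/
def stageY₂ (τ : ℂ) (c : Fin 8 → ℂ) (η x y : ℂ) : ℂ :=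
  s₂Y τ (c 2 + shift (c 0) (c 1) η) (c 3 + shift (c 0) (c 1) η) (η - shift (c 0) (c 1) η) x
    (stageY₁ τ c η x y)

def stageY₃ (τ : ℂ) (c : Fin 8 → ℂ) (η x y : ℂ) : ℂ :=
  s₂Y τ (c 4 + shift (c 0) (c 1) η + shift (c 2) (c 3) η)
    (c 5 + shift (c 0) (c 1) η + shift (c 2) (c 3) η)
    (η - shift (c 0) (c 1) η - shift (c 2) (c 3) η) x (stageY₂ τ c η x y)

def stageY₄ (τ : ℂ) (c : Fin 8 → ℂ) (η x y : ℂ) : ℂ :=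
  s₂Y τ (c 6 + shift (c 0) (c 1) η + shift (c 2) (c 3) η + shift (c 4) (c 5) η)
    (c 7 + shift (c 0) (c 1) η + shift (c 2) (c 3) η + shift (c 4) (c 5) η)
    (η - shift (c 0) (c 1) η - shift (c 2) (c 3) η - shift (c 4) (c 5) η) x (stageY₃ τ c η x y)

/-- All reflections in `R` are defined. -/
def StageReg (τ : ℂ) (c : Fin 8 → ℂ) (η x y : ℂ) : Prop :=
  S₂Reg τ (c 0) (c 1) η x y ∧
  S₂Reg τ (c 2 + shift (c 0) (c 1) η) (c 3 + shift (c 0) (c 1) η) (η - shift (c 0) (c 1) η) x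
    (stageY₁ τ c η x y) ∧
  S₂Reg τ (c 4 + shift (c 0) (c 1) η + shift (c 2) (c 3) η)
    (c 5 + shift (c 0) (c 1) η + shift (c 2) (c 3) η)
    (η - shift (c 0) (c 1) η - shift (c 2) (c 3) η) x (stageY₂ τ c η x y) ∧
  S₂Reg τ (c 6 + shift (c 0) (c 1) η + shift (c 2) (c 3) η + shift (c 4) (c 5) η)
    (c 7 + shift (c 0) (c 1) η + shift (c 2) (c 3) η + shift (c 4) (c 5) η)
    (η - shift (c 0) (c 1) η - shift (c 2) (c 3) η - shift (c 4) (c 5) η) x (stageY₃ τ c η x y)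

theorem wordReg_two (τ : ℂ) (p : State) :
    WordReg τ [2] p ↔ S₂Reg τ (p.c 0) (p.c 1) p.η p.x p.y := by
  simp [WordReg]

theorem eta_vec (c : Fin 8 → ℂ) : c = ![c 0, c 1, c 2, c 3, c 4, c 5, c 6, c 7] := by
  funext j
  fin_cases j <;> rfl

theorem sum_vec (c : Fin 8 → ℂ) :
    ∑ j, c j = c 0 + c 1 + c 2 + c 3 + c 4 + c 5 + c 6 + c 7 := by
  rw [Fin.sum_univ_eight]

/-- The four shifts add up to 2η + λ/2, so η becomes −η − λ/2 and s₁ restores the sign. A member of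
a pair gets this sum minus four times its own shift, which sends c₁ to λ/2 − c₂ and c₂ to λ/2 − c₁;
the permutations reverse the order of the pairs. -/
theorem run_RJ2 (τ : ℂ) (c : Fin 8 → ℂ) (η x y : ℂ) :
    run τ RJ2 (c, η, x, y) = (fun j => (∑ i, c i) / 2 / 2 - c (Fin.rev j),
      η + (∑ i, c i) / 2 / 2, stageY₄ τ c η x y, x) := by
  conv_lhs => rw [eta_vec c]
  rw [RJ2_eq]
  simp only [run_append, run_two, run_swap_fst_snd, run_swap_halves]
  refine Prod.ext ?_ (Prod.ext ?_ (Prod.ext ?_ rfl))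
  · rw [sum_vec]
    funext j
    simp only [run, List.foldl, step, State.c]
    fin_cases j <;> simp <;> ring
  · rw [sum_vec]
    simp only [run, List.foldl, step, State.η]
    ring
  · simp only [run, List.foldl, step, State.y, stageY₄, stageY₃, stageY₂, stageY₁, shift]
    ring_nf

theorem wordReg_RJ2_iff (τ : ℂ) (c : Fin 8 → ℂ) (η x y : ℂ) :
    WordReg τ RJ2 (c, η, x, y) ↔ StageReg τ c η x y := by
  conv_lhs => rw [eta_vec c]
  rw [RJ2_eq]
  simp only [wordReg_append, run_two, run_swap_fst_snd, run_swap_halves]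
  rw [wordReg_two, wordReg_two, wordReg_two, wordReg_two]
  have h1 := fun p => wordReg_of_two_notMem τ [3, 4, 8, 3] (by decide) p
  have h2 := fun p => wordReg_of_two_notMem τ
    [5, 6, 4, 5, 7, 0, 6, 7, 3, 4, 8, 3, 5, 6, 4, 5] (by decide) p
  have h3 := fun p => wordReg_of_two_notMem τ [1] (by decide) p
  simp only [h1, h2, h3, true_and, and_true]
  simp only [State.c, State.η, State.x, State.y, StageReg, stageY₃, stageY₂, stageY₁, shift]
  simp
  ring_nf
  exact fun _ _ => trivial

end EllipticPainleve

end

/-! ### The four reflections composed, and sigma factorizations of G, P and Q. -/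

noncomputable section

namespace EllipticPainleve

namespace CdSystem

variable {τ : ℂ} {f g σ : ℂ → ℂ}

/-- The product of the four reflections `s₂` of `R` on the fibre `x = cd u`. -/
theorem stageY₄_cdForm (S : CdSystem τ f g σ) {c : Fin 8 → ℂ} {η x y u l : ℂ}
    (h : StageReg τ c η x y) (hu : g u ≠ 0) (hx : x * g u = f u)
    (hl : l = (c 0 + c 1 + c 2 + c 3 + c 4 + c 5 + c 6 + c 7) / 2) :
    ∃ k,
      cdForm f g (stageY₄ τ c η x y) (2 * η + l + u) =
        k * (σ (u + (η + c 0)) * σ (u + (η + c 1)) * σ (u + (η + c 2)) * σ (u + (η + c 3)) *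
          σ (u + (η + c 4)) * σ (u + (η + c 5)) * σ (u + (η + c 6)) * σ (u + (η + c 7))) *
          cdForm f g y (2 * η - u) ∧
      cdForm f g (stageY₄ τ c η x y) (2 * η + l - u) =
        k * (σ (u - (η + c 0)) * σ (u - (η + c 1)) * σ (u - (η + c 2)) * σ (u - (η + c 3)) *
          σ (u - (η + c 4)) * σ (u - (η + c 5)) * σ (u - (η + c 6)) * σ (u - (η + c 7))) *
          cdForm f g y (2 * η + u) := by
  obtain ⟨h1, h2, h3, h4⟩ := h
  obtain ⟨k1, a1, b1⟩ := S.s₂_step h1 hu hx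
  obtain ⟨k2, a2, b2⟩ := S.s₂_step h2 hu hx
  obtain ⟨k3, a3, b3⟩ := S.s₂_step h3 hu hx
  obtain ⟨k4, a4, b4⟩ := S.s₂_step h4 hu hx
  change cdForm f g (stageY₁ τ c η x y) _ = _ at a1 b1
  change cdForm f g (stageY₂ τ c η x y) _ = _ at a2 b2
  change cdForm f g (stageY₃ τ c η x y) _ = _ at a3 b3
  change cdForm f g (stageY₄ τ c η x y) _ = _ at a4 b4
  have cdForm_neg : ∀ z a, cdForm f g z (-a) = cdForm f g z a := fun z a => by
    rw [cdForm, cdForm, S.f_neg, S.g_neg]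
  -- The sums η + c_i of the pairs still to be used are unaffected by the earlier shifts.
  have e2 : η - shift (c 0) (c 1) η + (c 2 + shift (c 0) (c 1) η) = η + c 2 := by ring
  have e3 : η - shift (c 0) (c 1) η + (c 3 + shift (c 0) (c 1) η) = η + c 3 := by ring
  have e4 : η - shift (c 0) (c 1) η - shift (c 2) (c 3) η +
    (c 4 + shift (c 0) (c 1) η + shift (c 2) (c 3) η) = η + c 4 := by ring
  have e5 : η - shift (c 0) (c 1) η - shift (c 2) (c 3) η +
    (c 5 + shift (c 0) (c 1) η + shift (c 2) (c 3) η) = η + c 5 := by ring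
  have e6 : η - shift (c 0) (c 1) η - shift (c 2) (c 3) η - shift (c 4) (c 5) η +
    (c 6 + shift (c 0) (c 1) η + shift (c 2) (c 3) η + shift (c 4) (c 5) η) = η + c 6 := by ring
  have e7 : η - shift (c 0) (c 1) η - shift (c 2) (c 3) η - shift (c 4) (c 5) η +
    (c 7 + shift (c 0) (c 1) η + shift (c 2) (c 3) η + shift (c 4) (c 5) η) = η + c 7 := by ring
  -- The forms produced by one reflection are centred at twice the new η, which is where the next
  -- reflection expects them.
  have t1 : 2 * (η - shift (c 0) (c 1) η) = η - (c 0 + c 1) / 2 := by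
    unfold shift; ring
  have t2 : 2 * (η - shift (c 0) (c 1) η - shift (c 2) (c 3) η) =
      η - shift (c 0) (c 1) η -
        (c 2 + shift (c 0) (c 1) η + (c 3 + shift (c 0) (c 1) η)) / 2 := by
    unfold shift; ring
  have t3 : 2 * (η - shift (c 0) (c 1) η - shift (c 2) (c 3) η - shift (c 4) (c 5) η) =
      η - shift (c 0) (c 1) η - shift (c 2) (c 3) η -
        (c 4 + shift (c 0) (c 1) η + shift (c 2) (c 3) η +
          (c 5 + shift (c 0) (c 1) η + shift (c 2) (c 3) η)) / 2 := by
    unfold shift; ring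
  -- The last centre comes out negated; evenness of the forms (`cdForm_neg`) then exchanges the
  -- arguments with +u and −u.
  have t4 : η - shift (c 0) (c 1) η - shift (c 2) (c 3) η - shift (c 4) (c 5) η -
        (c 6 + shift (c 0) (c 1) η + shift (c 2) (c 3) η + shift (c 4) (c 5) η +
          (c 7 + shift (c 0) (c 1) η + shift (c 2) (c 3) η + shift (c 4) (c 5) η)) / 2 =
      -(2 * η + l) := by
    rw [hl]; unfold shift; ring
  rw [e2, e3, t1, a1] at a2
  rw [e2, e3, t1, b1] at b2
  rw [e4, e5, t2, a2] at a3
  rw [e4, e5, t2, b2] at b3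
  rw [e6, e7, t3, a3, t4, show -(2 * η + l) - u = -(2 * η + l + u) by ring, cdForm_neg] at a4
  rw [e6, e7, t3, b3, t4, show -(2 * η + l) + u = -(2 * η + l - u) by ring, cdForm_neg] at b4
  refine ⟨k4 * k3 * k2 * k1, ?_, ?_⟩
  · rw [a4]; ring
  · rw [b4]; ring

/-! ### The coefficient functions on the pencil -/

/-- All other sigma factors cancel. The value of G is what replaces the constants of P with a₃ by
those of P with a₄, so that the two terms of `mixForm` can be combined. -/
theorem gG_eq (S : CdSystem τ f g σ) {a₁ a₂ a₃ a₄ b : ℂ} (h : GReg τ a₁ a₂ a₃ a₄ b) :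
    g (b - a₃) ≠ 0 ∧ g (b - a₄) ≠ 0 ∧ g (b + a₃ - (a₁ + a₂ + a₃ + a₄) / 2) ≠ 0 ∧
    g (b + a₄ - (a₁ + a₂ + a₃ + a₄) / 2) ≠ 0 ∧ σ (a₂ - a₃) ≠ 0 ∧ σ (a₃ - a₁) ≠ 0 ∧
    gG τ a₁ a₂ a₃ a₄ b =
      σ (a₂ - a₄) * σ (a₄ - a₁) * g (b - a₃) * g (b + a₃ - (a₁ + a₂ + a₃ + a₄) / 2) /
      (σ (a₂ - a₃) * σ (a₃ - a₁) * g (b - a₄) * g (b + a₄ - (a₁ + a₂ + a₃ + a₄) / 2)) := by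
  obtain ⟨h1, h2, h3, h4⟩ := h
  rw [gG, S.cdQuot_eq h1, S.cdQuot_eq h2, S.cdQuot_eq h3, S.cdQuot_eq h4]
  obtain ⟨n1, n2, -, -, n3, n4⟩ := S.cdQuotReg_iff.1 h1
  obtain ⟨n5, n6, -, -, n7, n8⟩ := S.cdQuotReg_iff.1 h2
  obtain ⟨n9, n10, -, -, n11, n12⟩ := S.cdQuotReg_iff.1 h3
  obtain ⟨n13, n14, -, -, n15, n16⟩ := S.cdQuotReg_iff.1 h4
  rw [show a₂ + (a₁ + a₂) / 2 - (a₃ + (a₁ + a₂) / 2) = a₂ - a₃ by ring] at *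
  rw [show a₂ + (a₁ + a₂) / 2 + (a₃ + (a₁ + a₂) / 2) = a₁ + 2 * a₂ + a₃ by ring] at *
  rw [show b - a₁ - (b - a₃) = a₃ - a₁ by ring] at *
  rw [show b - a₁ + (b - a₃) = 2 * b - a₁ - a₃ by ring] at *
  rw [show b + a₂ + (a₁ + a₂ + a₃ + a₄) / 2 - (b + a₃ - (a₁ + a₂ + a₃ + a₄) / 2) =
    a₁ + 2 * a₂ + a₄ by ring] at *
  rw [show b + a₂ + (a₁ + a₂ + a₃ + a₄) / 2 + (b + a₃ - (a₁ + a₂ + a₃ + a₄) / 2) =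
    2 * b + a₂ + a₃ by ring] at *
  rw [show 2 * b + a₂ - (a₁ + a₂) / 2 - (a₄ + (a₁ + a₂) / 2) = 2 * b - a₁ - a₄ by ring] at *
  rw [show 2 * b + a₂ - (a₁ + a₂) / 2 + (a₄ + (a₁ + a₂) / 2) = 2 * b + a₂ + a₄ by ring] at *
  rw [show a₂ + (a₁ + a₂) / 2 - (a₄ + (a₁ + a₂) / 2) = a₂ - a₄ by ring,
    show a₂ + (a₁ + a₂) / 2 + (a₄ + (a₁ + a₂) / 2) = a₁ + 2 * a₂ + a₄ by ring,
    show b - a₁ - (b - a₄) = a₄ - a₁ by ring, show b - a₁ + (b - a₄) = 2 * b - a₁ - a₄ by ring,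
    show b + a₂ + (a₁ + a₂ + a₃ + a₄) / 2 - (b + a₄ - (a₁ + a₂ + a₃ + a₄) / 2) =
      a₁ + 2 * a₂ + a₃ by ring,
    show b + a₂ + (a₁ + a₂ + a₃ + a₄) / 2 + (b + a₄ - (a₁ + a₂ + a₃ + a₄) / 2) =
      2 * b + a₂ + a₄ by ring,
    show 2 * b + a₂ - (a₁ + a₂) / 2 - (a₃ + (a₁ + a₂) / 2) = 2 * b - a₁ - a₃ by ring,
    show 2 * b + a₂ - (a₁ + a₂) / 2 + (a₃ + (a₁ + a₂) / 2) = 2 * b + a₂ + a₃ by ring]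
  refine ⟨n6, n5, n10, n9, n3, n7, ?_⟩
  generalize (b + a₃ - (a₁ + a₂ + a₃ + a₄) / 2) = r₃ at *
  generalize (b + a₄ - (a₁ + a₂ + a₃ + a₄) / 2) = r₄ at *
  generalize (a₃ + (a₁ + a₂) / 2) = r₅ at *
  generalize (a₄ + (a₁ + a₂) / 2) = r₆ at *
  generalize a₁ + 2 * a₂ + a₃ = r₇ at *
  generalize a₁ + 2 * a₂ + a₄ = r₈ at *
  field_simp

/-- The homogenization of `pP` in the last variable. -/
def _root_.EllipticPainleve.pForm (τ a₁ a₂ a₃ b X F E : ℂ) : ℂ :=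
  (pP τ a₁ a₂ a₃ b X 1 - pP τ a₁ a₂ a₃ b X 0) * F + pP τ a₁ a₂ a₃ b X 0 * E

/-- P is of bidegree (1,1) and vanishes at the three points (cd(b+aᵢ), cd(b−aᵢ)) of the curve u ↦
(cd u, cd(2b−u)). The fourth zero on the curve is u = b − a₁ − a₂ − a₃, so the zeros sum to 4b. -/
theorem pForm_curve (S : CdSystem τ f g σ) {a₁ a₂ a₃ b X u : ℂ} (h : PReg τ a₁ a₂ a₃ b)
    (hu : g u ≠ 0) (hX : X * g u = f u) :
    pForm τ a₁ a₂ a₃ b X (f (2 * b - u)) (g (2 * b - u)) =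
      σ (4 * b) * σ (a₂ - a₁) * σ (a₃ - a₁) * σ (a₂ - a₃) *
        (σ (u - (b + a₁)) * σ (u - (b + a₂)) * σ (u - (b + a₃)) * σ (u - b + a₁ + a₂ + a₃)) /
      (g u * (g (b + a₁) * g (b - a₁)) * (g (b + a₂) * g (b - a₂)) *
        (g (b + a₃) * g (b - a₃))) := by
  obtain ⟨p1, p2, p3, m1, m2, m3⟩ := h
  rw [S.reg_iff] at p1 p2 p3 m1 m2 m3
  have hX' : X = f u / g u := by rw [eq_div_iff hu, hX]
  -- Two products of brackets, interchanged by a₂ ↔ a₃ up to sign conventions. Both contain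
  -- σ(u−(b+a₂))σ(u−(b+a₃)), and the cofactor is a single three-term identity.
  have key : pForm τ a₁ a₂ a₃ b X (f (2 * b - u)) (g (2 * b - u)) *
      (g u * (g (b + a₁) * g (b - a₁)) * (g (b + a₂) * g (b - a₂)) *
        (g (b + a₃) * g (b - a₃))) =
      (f (b + a₁) * g (b + a₃) - f (b + a₃) * g (b + a₁)) *
        (f (b + a₂) * g u - f u * g (b + a₂)) *
        ((f (b - a₁) * g (b - a₂) - f (b - a₂) * g (b - a₁)) *
        (f (b - a₃) * g (2 * b - u) - f (2 * b - u) * g (b - a₃))) -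
      (f (b + a₁) * g (b + a₂) - f (b + a₂) * g (b + a₁)) *
        (f (b + a₃) * g u - f u * g (b + a₃)) *
        ((f (b - a₁) * g (b - a₃) - f (b - a₃) * g (b - a₁)) *
        (f (b - a₂) * g (2 * b - u) - f (2 * b - u) * g (b - a₂))) := by
    rw [pForm, pP, pP]
    simp only [S.cd_eq, hX']
    generalize g (2 * b - u) = E
    generalize f (2 * b - u) = F
    generalize f (b + a₁) = f1
    generalize f (b + a₂) = f2
    generalize f (b + a₃) = f3
    generalize f (b - a₁) = f1'
    generalize f (b - a₂) = f2'
    generalize f (b - a₃) = f3'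
    generalize f u = fu
    generalize g (b + a₁) = g1 at *
    generalize g (b + a₂) = g2 at *
    generalize g (b + a₃) = g3 at *
    generalize g (b - a₁) = g1' at *
    generalize g (b - a₂) = g2' at *
    generalize g (b - a₃) = g3' at *
    generalize g u = gu at *
    field_simp
    ring
  have t := S.three_term (2 * b + (a₃ - a₂) / 2) (a₁ + (a₂ + a₃) / 2) (2 * b + (a₂ - a₃) / 2)
    (u - b + (a₂ + a₃) / 2)
  rw [show 2 * b + (a₃ - a₂) / 2 - (a₁ + (a₂ + a₃) / 2) = 2 * b - a₁ - a₂ by ring,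
    show 2 * b + (a₃ - a₂) / 2 + (a₁ + (a₂ + a₃) / 2) = 2 * b + a₁ + a₃ by ring,
    show 2 * b + (a₂ - a₃) / 2 - (u - b + (a₂ + a₃) / 2) = 3 * b - a₃ - u by ring,
    show 2 * b + (a₂ - a₃) / 2 + (u - b + (a₂ + a₃) / 2) = u + (b + a₂) by ring,
    show 2 * b + (a₃ - a₂) / 2 - (2 * b + (a₂ - a₃) / 2) = -(a₂ - a₃) by ring,
    show 2 * b + (a₃ - a₂) / 2 + (2 * b + (a₂ - a₃) / 2) = 4 * b by ring,
    show a₁ + (a₂ + a₃) / 2 - (u - b + (a₂ + a₃) / 2) = -(u - (b + a₁)) by ring,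
    show a₁ + (a₂ + a₃) / 2 + (u - b + (a₂ + a₃) / 2) = u - b + a₁ + a₂ + a₃ by ring,
    show 2 * b + (a₃ - a₂) / 2 - (u - b + (a₂ + a₃) / 2) = 3 * b - a₂ - u by ring,
    show 2 * b + (a₃ - a₂) / 2 + (u - b + (a₂ + a₃) / 2) = u + (b + a₃) by ring,
    show a₁ + (a₂ + a₃) / 2 - (2 * b + (a₂ - a₃) / 2) = -(2 * b - a₁ - a₃) by ring,
    show a₁ + (a₂ + a₃) / 2 + (2 * b + (a₂ - a₃) / 2) = 2 * b + a₁ + a₂ by ring] at t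
  rw [eq_div_iff (by simp [*]), key]
  simp only [S.bracket]
  rw [show b + a₁ - (b + a₃) = -(a₃ - a₁) by ring, show b + a₁ + (b + a₃) = 2 * b + a₁ + a₃ by ring,
    show b + a₂ - u = -(u - (b + a₂)) by ring, show b + a₂ + u = u + (b + a₂) by ring,
    show b - a₁ - (b - a₂) = a₂ - a₁ by ring, show b - a₁ + (b - a₂) = 2 * b - a₁ - a₂ by ring,
    show b - a₃ - (2 * b - u) = u - (b + a₃) by ring,
    show b - a₃ + (2 * b - u) = 3 * b - a₃ - u by ring,
    show b + a₁ - (b + a₂) = -(a₂ - a₁) by ring, show b + a₁ + (b + a₂) = 2 * b + a₁ + a₂ by ring,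
    show b + a₃ - u = -(u - (b + a₃)) by ring, show b + a₃ + u = u + (b + a₃) by ring,
    show b - a₁ - (b - a₃) = a₃ - a₁ by ring, show b - a₁ + (b - a₃) = 2 * b - a₁ - a₃ by ring,
    show b - a₂ - (2 * b - u) = u - (b + a₂) by ring,
    show b - a₂ + (2 * b - u) = 3 * b - a₂ - u by ring]
  simp only [S.σ_neg] at t ⊢
  linear_combination σ (a₂ - a₁) * σ (a₃ - a₁) * σ (u - (b + a₂)) * σ (u - (b + a₃)) * t

/-- Lagrange interpolation of `qQ` in its last variable. -/
theorem _root_.EllipticPainleve.qQ_eq (τ a₁ a₂ a₃ a₄ a₅ b X : ℂ) :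
    qQ τ a₁ a₂ a₃ a₄ a₅ b X =
      (cd τ (b + a₃ - a₅ / 2) - cd τ (b + a₁ + a₅ / 2)) *
        ((cd τ (b + a₄ + a₅ / 2) - cd τ (b + a₂ + a₅ / 2)) *
        (cd τ (b + a₁) - cd τ (b + a₄)) * (X - cd τ (b + a₂))) +
      (cd τ (b + a₃ - a₅ / 2) - cd τ (b + a₂ + a₅ / 2)) *
        ((cd τ (b + a₁ + a₅ / 2) - cd τ (b + a₄ + a₅ / 2)) *
        (cd τ (b + a₂) - cd τ (b + a₄)) * (X - cd τ (b + a₁))) := by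
  unfold qQ
  ring

/-- A combination of two values of `qQ` factorizes. -/
theorem qQ_combination (S : CdSystem τ f g σ) {d₁ d₂ d₃ d₄ d₅ d₆ z s b X u : ℂ}
    (hs : s = d₁ + d₂ + d₃ + d₄)
    (h3 : QReg τ d₅ d₆ d₃ z s b) (h4 : QReg τ d₅ d₆ d₄ z s b)
    (hu : g u ≠ 0) (hX : X * g u = f u) :
    σ (u + (b + d₄)) * σ (u - b + d₁ + d₂ + d₃) * (g (b + d₃ - s / 2) * qQ τ d₅ d₆ d₃ z s b X) -
      σ (u + (b + d₃)) * σ (u - b + d₁ + d₂ + d₄) *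
        (g (b + d₄ - s / 2) * qQ τ d₅ d₆ d₄ z s b X) =
    σ (d₃ - d₄) * σ (d₁ + d₂ - 2 * b) * σ s * σ (d₆ - d₅) *
      (σ (u - (b + d₅)) * σ (u - (b + d₆))) /
      (g u * g (b + d₅) * g (b + d₆) * g (b + d₅ + s / 2) * g (b + d₆ + s / 2)) *
      (σ (z - d₆) * σ (d₅ - z) / (g (b + z) * g (b + z + s / 2))) *
      (σ (u - (b + z)) * σ (u + 3 * b + d₅ + d₆ + z + s)) := by
  obtain ⟨p5, p6, p7, r3, t5, t6, t7⟩ := h3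
  obtain ⟨-, -, -, r4, -, -, -⟩ := h4
  have xu : ∀ a, CdReg τ a → X - cd τ a = σ (u - a) * σ (u + a) / (g u * g a) := by
    intro a ha
    have h := S.cdForm_mul hX a
    rw [S.sub_cd ha]
    rw [S.reg_iff] at ha
    rw [← h]
    field_simp
  -- A three-term identity because s is the sum of d₁, …, d₄; it is needed for d = d₅ and d = d₆.
  have bracket : ∀ d, 
      σ (u + (b + d₄)) * σ (u - b + d₁ + d₂ + d₃) * (σ (d₃ - d - s) * σ (2 * b + d₃ + d)) -
      σ (u + (b + d₃)) * σ (u - b + d₁ + d₂ + d₄) * (σ (d₄ - d - s) * σ (2 * b + d₄ + d)) =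
      -(σ (d₃ - d₄) * σ (d₁ + d₂ - 2 * b) * σ (u - (b + d)) * σ (u + (b + d) + s)) := by
    intro d
    have t := S.three_term (b + d + s / 2) ((d₃ - d₄ - d₁ - d₂) / 2 + b) (u + s / 2)
      ((d₃ - d₄ + d₁ + d₂) / 2 - b)
    rw [show b + d + s / 2 - ((d₃ - d₄ - d₁ - d₂) / 2 + b) = -(d₃ - d - s) by rw [hs]; ring,
      show b + d + s / 2 + ((d₃ - d₄ - d₁ - d₂) / 2 + b) = 2 * b + d₃ + d by rw [hs]; ring,
      show u + s / 2 - ((d₃ - d₄ + d₁ + d₂) / 2 - b) = u + (b + d₄) by rw [hs]; ring,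
      show u + s / 2 + ((d₃ - d₄ + d₁ + d₂) / 2 - b) = u - b + d₁ + d₂ + d₃ by rw [hs]; ring,
      show b + d + s / 2 - (u + s / 2) = -(u - (b + d)) by ring,
      show b + d + s / 2 + (u + s / 2) = u + (b + d) + s by ring,
      show (d₃ - d₄ - d₁ - d₂) / 2 + b - ((d₃ - d₄ + d₁ + d₂) / 2 - b) =
        -(d₁ + d₂ - 2 * b) by ring,
      show (d₃ - d₄ - d₁ - d₂) / 2 + b + ((d₃ - d₄ + d₁ + d₂) / 2 - b) = d₃ - d₄ by ring,
      show b + d + s / 2 - ((d₃ - d₄ + d₁ + d₂) / 2 - b) = 2 * b + d₄ + d by rw [hs]; ring,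
      show b + d + s / 2 + ((d₃ - d₄ + d₁ + d₂) / 2 - b) = -(d₄ - d - s) by rw [hs]; ring,
      show (d₃ - d₄ - d₁ - d₂) / 2 + b - (u + s / 2) = -(u - b + d₁ + d₂ + d₄) by rw [hs]; ring,
      show (d₃ - d₄ - d₁ - d₂) / 2 + b + (u + s / 2) = u + (b + d₃) by rw [hs]; ring] at t
    simp only [S.σ_neg] at t
    linear_combination -t
  have b5 := bracket d₅
  have b6 := bracket d₆
  -- A second three-term identity joins the d₅ and d₆ contributions into one product.
  have b7 : σ (2 * b + z + d₆ + s) * σ (2 * b + d₅ + z) * (σ (u + (b + d₅) + s) * σ (u + (b + d₆))) -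
      σ (2 * b + d₅ + z + s) * σ (2 * b + d₆ + z) * (σ (u + (b + d₆) + s) * σ (u + (b + d₅))) =
      σ (u - (b + z)) * σ (u + 3 * b + d₅ + d₆ + z + s) * (σ s * σ (d₅ - d₆)) := by
    have t := S.three_term (2 * b + z + (d₅ + d₆) / 2 + s / 2) ((d₆ - d₅ + s) / 2)
      (u + b + (d₅ + d₆) / 2 + s / 2) ((d₅ - d₆ + s) / 2)
    rw [show 2 * b + z + (d₅ + d₆) / 2 + s / 2 - (d₆ - d₅ + s) / 2 = 2 * b + d₅ + z by ring,
      show 2 * b + z + (d₅ + d₆) / 2 + s / 2 + (d₆ - d₅ + s) / 2 = 2 * b + z + d₆ + s by ring,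
      show u + b + (d₅ + d₆) / 2 + s / 2 - (d₅ - d₆ + s) / 2 = u + (b + d₆) by ring,
      show u + b + (d₅ + d₆) / 2 + s / 2 + (d₅ - d₆ + s) / 2 = u + (b + d₅) + s by ring,
      show 2 * b + z + (d₅ + d₆) / 2 + s / 2 - (u + b + (d₅ + d₆) / 2 + s / 2) =
        -(u - (b + z)) by ring,
      show 2 * b + z + (d₅ + d₆) / 2 + s / 2 + (u + b + (d₅ + d₆) / 2 + s / 2) =
        u + 3 * b + d₅ + d₆ + z + s by ring,
      show (d₆ - d₅ + s) / 2 - (d₅ - d₆ + s) / 2 = -(d₅ - d₆) by ring,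
      show (d₆ - d₅ + s) / 2 + (d₅ - d₆ + s) / 2 = s by ring,
      show 2 * b + z + (d₅ + d₆) / 2 + s / 2 - (d₅ - d₆ + s) / 2 = 2 * b + d₆ + z by ring,
      show 2 * b + z + (d₅ + d₆) / 2 + s / 2 + (d₅ - d₆ + s) / 2 = 2 * b + d₅ + z + s by ring,
      show (d₆ - d₅ + s) / 2 - (u + b + (d₅ + d₆) / 2 + s / 2) = -(u + (b + d₅)) by ring,
      show (d₆ - d₅ + s) / 2 + (u + b + (d₅ + d₆) / 2 + s / 2) = u + (b + d₆) + s by ring] at t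
    simp only [S.σ_neg] at t
    linear_combination t
  set D := g u * g (b + d₅) * g (b + d₆) * g (b + d₅ + s / 2) * g (b + d₆ + s / 2) *
    (g (b + z) * g (b + z + s / 2)) with hD
  -- The third parameter enters `qQ` only through r. Hence A₅ and A₆ are the same for d₃ and d₄, and
  -- the combination can be taken termwise.
  set A₅ := σ (z - d₆) * σ (2 * b + z + d₆ + s) * (σ (d₅ - z) * σ (2 * b + d₅ + z)) *
    (σ (u - (b + d₆)) * σ (u + (b + d₆))) / D with hA₅
  set A₆ := σ (d₅ - z) * σ (2 * b + d₅ + z + s) * (σ (d₆ - z) * σ (2 * b + d₆ + z)) *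
    (σ (u - (b + d₅)) * σ (u + (b + d₅))) / D with hA₆
  have expand : ∀ d, CdReg τ (b + d - s / 2) →
      g (b + d - s / 2) * qQ τ d₅ d₆ d z s b X =
        σ (d - d₅ - s) * σ (2 * b + d + d₅) * A₅ + σ (d - d₆ - s) * σ (2 * b + d + d₆) * A₆ := by
    intro d r
    rw [qQ_eq, S.cd_sub_cd r t5, S.cd_sub_cd r t6, S.cd_sub_cd t7 t6, S.cd_sub_cd t5 t7,
      S.cd_sub_cd p5 p7, S.cd_sub_cd p6 p7, xu _ p5, xu _ p6, hA₅, hA₆, hD]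
    rw [S.reg_iff] at p5 p6 p7 r t5 t6 t7
    rw [show b + d - s / 2 - (b + d₅ + s / 2) = d - d₅ - s by ring,
      show b + d - s / 2 + (b + d₅ + s / 2) = 2 * b + d + d₅ by ring,
      show b + d - s / 2 - (b + d₆ + s / 2) = d - d₆ - s by ring,
      show b + d - s / 2 + (b + d₆ + s / 2) = 2 * b + d + d₆ by ring,
      show b + z + s / 2 - (b + d₆ + s / 2) = z - d₆ by ring,
      show b + z + s / 2 + (b + d₆ + s / 2) = 2 * b + z + d₆ + s by ring,
      show b + d₅ + s / 2 - (b + z + s / 2) = d₅ - z by ring,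
      show b + d₅ + s / 2 + (b + z + s / 2) = 2 * b + d₅ + z + s by ring,
      show b + d₅ - (b + z) = d₅ - z by ring, show b + d₅ + (b + z) = 2 * b + d₅ + z by ring,
      show b + d₆ - (b + z) = d₆ - z by ring, show b + d₆ + (b + z) = 2 * b + d₆ + z by ring]
    generalize b + d - s / 2 = w₀ at *
    generalize b + d₅ + s / 2 = w₁ at *
    generalize b + d₆ + s / 2 = w₂ at *
    generalize b + z + s / 2 = w₃ at *
    field_simp
  rw [expand d₃ r3, expand d₄ r4]
  have e : σ (u + (b + d₄)) * σ (u - b + d₁ + d₂ + d₃) *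
        (σ (d₃ - d₅ - s) * σ (2 * b + d₃ + d₅) * A₅ + σ (d₃ - d₆ - s) * σ (2 * b + d₃ + d₆) * A₆) -
      σ (u + (b + d₃)) * σ (u - b + d₁ + d₂ + d₄) *
        (σ (d₄ - d₅ - s) * σ (2 * b + d₄ + d₅) * A₅ + σ (d₄ - d₆ - s) * σ (2 * b + d₄ + d₆) * A₆) =
      -(σ (d₃ - d₄) * σ (d₁ + d₂ - 2 * b)) *
        (σ (u - (b + d₅)) * σ (u + (b + d₅) + s) * A₅ +
          σ (u - (b + d₆)) * σ (u + (b + d₆) + s) * A₆) := by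
    linear_combination A₅ * b5 + A₆ * b6
  rw [e, hA₅, hA₆, ← mul_div_mul_comm, ← hD, show d₆ - z = -(z - d₆) by ring,
    show d₆ - d₅ = -(d₅ - d₆) by ring, S.σ_neg, S.σ_neg]
  linear_combination -(σ (d₃ - d₄) * σ (d₁ + d₂ - 2 * b) * (σ (z - d₆) * σ (d₅ - z)) *
    (σ (u - (b + d₅)) * σ (u - (b + d₆))) / D) * b7

end CdSystem

end EllipticPainleve

end

/-! ### The numerator of N_d on the pencil of forms over the fibre x = cd u. -/

noncomputable section

namespace EllipticPainleve

/-- The factor of the numerators of `mixN` that depends on `z` but not on `u`. -/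
def mixFactor (g σ : ℂ → ℂ) (d₅ d₆ z s b : ℂ) : ℂ :=
  σ (z - d₆) * σ (d₅ - z) / (g (b + z) * g (b + z + s / 2))

/-- The factor of the numerators of `mixN` that does not depend on `z`. -/
def mixConst (g σ : ℂ → ℂ) (d₁ d₂ d₃ d₄ d₅ d₆ s b u : ℂ) : ℂ :=
  σ (4 * b) * σ (d₂ - d₁) * σ (d₂ - d₄) * σ (d₄ - d₁) /
    (g u ^ 2 * (g (b + d₁) * g (b - d₁)) * (g (b + d₂) * g (b - d₂)) * g (b + d₃) * g (b + d₄) *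
      g (b - d₄) * g (b + d₄ - s / 2)) *
  (σ (d₃ - d₄) * σ (d₁ + d₂ - 2 * b) * σ s * σ (d₆ - d₅) /
      (g u * g (b + d₅) * g (b + d₆) * g (b + d₅ + s / 2) * g (b + d₆ + s / 2)))

/-- The numerator of `mixN` over a denominator free of z, with y replaced by a homogeneous pair (F :
E). -/
def mixForm (τ d₁ d₂ d₃ d₄ d₅ d₆ z s b X F E : ℂ) : ℂ :=
  gG τ d₁ d₂ d₃ d₄ b * (X - cd τ (b + d₄)) * qQ τ d₅ d₆ d₃ z s b X * pForm τ d₁ d₂ d₃ b X F E -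
    (X - cd τ (b + d₃)) * qQ τ d₅ d₆ d₄ z s b X * pForm τ d₁ d₂ d₄ b X F E

namespace CdSystem

variable {τ : ℂ} {f g σ : ℂ → ℂ}

theorem sub_cd_eq (S : CdSystem τ f g σ) {X u a : ℂ} (hu : g u ≠ 0) (hX : X * g u = f u)
    (ha : CdReg τ a) : X - cd τ a = σ (u - a) * σ (u + a) / (g u * g a) := by
  have h := S.cdForm_mul hX a
  rw [S.sub_cd ha]
  rw [S.reg_iff] at ha
  rw [← h]
  field_simp

/-- On the curve u ↦ (cd u, cd(2b−u)) both terms share the zeros b+d₁, …, b+d₄, and `qQ_combination`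
factors the rest. Of eight zeros, seven are b+dᵢ and b+z. -/
theorem mixForm_curve (S : CdSystem τ f g σ) {d₁ d₂ d₃ d₄ d₅ d₆ z s b X u : ℂ}
    (hs : s = d₁ + d₂ + d₃ + d₄)
    (h3 : QReg τ d₅ d₆ d₃ z s b) (h4 : QReg τ d₅ d₆ d₄ z s b)
    (hP4 : PReg τ d₁ d₂ d₄ b) (hP3 : PReg τ d₁ d₂ d₃ b) (hG : GReg τ d₁ d₂ d₃ d₄ b)
    (hu : g u ≠ 0) (hX : X * g u = f u) :
    mixForm τ d₁ d₂ d₃ d₄ d₅ d₆ z s b X (f (2 * b - u)) (g (2 * b - u)) =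
      mixConst g σ d₁ d₂ d₃ d₄ d₅ d₆ s b u * mixFactor g σ d₅ d₆ z s b *
      (σ (u - (b + d₁)) * σ (u - (b + d₂)) * σ (u - (b + d₃)) * σ (u - (b + d₄)) *
        σ (u - (b + d₅)) * σ (u - (b + d₆)) * σ (u - (b + z)) *
        σ (u + (3 * b + d₅ + d₆ + z + s))) := by
  have hD := S.qQ_combination hs h3 h4 hu hX
  obtain ⟨n1, n2, n3, n4, n5, n6, eG⟩ := S.gG_eq hG
  rw [mixForm, S.pForm_curve hP3 hu hX, S.pForm_curve hP4 hu hX, eG,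
    S.sub_cd_eq hu hX hP3.2.2.1, S.sub_cd_eq hu hX hP4.2.2.1]
  obtain ⟨p1, p2, p3, m1, m2, m3⟩ := hP3
  obtain ⟨-, -, p4, -, -, m4⟩ := hP4
  rw [S.reg_iff] at p1 p2 p3 p4 m1 m2 m3 m4
  have e : ∀ q₃ q₄ : ℂ,
      σ (d₂ - d₄) * σ (d₄ - d₁) * g (b - d₃) * g (b + d₃ - (d₁ + d₂ + d₃ + d₄) / 2) /
      (σ (d₂ - d₃) * σ (d₃ - d₁) * g (b - d₄) * g (b + d₄ - (d₁ + d₂ + d₃ + d₄) / 2)) *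
      (σ (u - (b + d₄)) * σ (u + (b + d₄)) / (g u * g (b + d₄))) * q₃ *
      (σ (4 * b) * σ (d₂ - d₁) * σ (d₃ - d₁) * σ (d₂ - d₃) *
        (σ (u - (b + d₁)) * σ (u - (b + d₂)) * σ (u - (b + d₃)) * σ (u - b + d₁ + d₂ + d₃)) /
      (g u * (g (b + d₁) * g (b - d₁)) * (g (b + d₂) * g (b - d₂)) *
        (g (b + d₃) * g (b - d₃)))) -
      σ (u - (b + d₃)) * σ (u + (b + d₃)) / (g u * g (b + d₃)) * q₄ *
      (σ (4 * b) * σ (d₂ - d₁) * σ (d₄ - d₁) * σ (d₂ - d₄) *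
        (σ (u - (b + d₁)) * σ (u - (b + d₂)) * σ (u - (b + d₄)) * σ (u - b + d₁ + d₂ + d₄)) /
      (g u * (g (b + d₁) * g (b - d₁)) * (g (b + d₂) * g (b - d₂)) *
        (g (b + d₄) * g (b - d₄)))) =
      σ (4 * b) * σ (d₂ - d₁) * σ (d₂ - d₄) * σ (d₄ - d₁) /
    (g u ^ 2 * (g (b + d₁) * g (b - d₁)) * (g (b + d₂) * g (b - d₂)) * g (b + d₃) * g (b + d₄) *
      g (b - d₄) * g (b + d₄ - (d₁ + d₂ + d₃ + d₄) / 2)) *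
      (σ (u - (b + d₁)) * σ (u - (b + d₂)) * σ (u - (b + d₃)) * σ (u - (b + d₄))) *
      (σ (u + (b + d₄)) * σ (u - b + d₁ + d₂ + d₃) *
        (g (b + d₃ - (d₁ + d₂ + d₃ + d₄) / 2) * q₃) -
      σ (u + (b + d₃)) * σ (u - b + d₁ + d₂ + d₄) *
        (g (b + d₄ - (d₁ + d₂ + d₃ + d₄) / 2) * q₄)) := by
    intro q₃ q₄
    generalize b + d₃ - (d₁ + d₂ + d₃ + d₄) / 2 = r₃ at *
    generalize b + d₄ - (d₁ + d₂ + d₃ + d₄) / 2 = r₄ at *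
    generalize 4 * b = r₅ at *
    field_simp
  rw [e, ← hs, hD, mixConst, mixFactor,
    show u + (3 * b + d₅ + d₆ + z + s) = u + 3 * b + d₅ + d₆ + z + s by ring]
  ring

theorem mixForm_neg (S : CdSystem τ f g σ) {d₁ d₂ d₃ d₄ d₅ d₆ z s b X u : ℂ}
    (hs : s = d₁ + d₂ + d₃ + d₄)
    (h3 : QReg τ d₅ d₆ d₃ z s b) (h4 : QReg τ d₅ d₆ d₄ z s b)
    (hP4 : PReg τ d₁ d₂ d₄ b) (hP3 : PReg τ d₁ d₂ d₃ b) (hG : GReg τ d₁ d₂ d₃ d₄ b)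
    (hu : g u ≠ 0) (hX : X * g u = f u) :
    mixForm τ d₁ d₂ d₃ d₄ d₅ d₆ z s b X (f (2 * b + u)) (g (2 * b + u)) =
      mixConst g σ d₁ d₂ d₃ d₄ d₅ d₆ s b u * mixFactor g σ d₅ d₆ z s b *
      (σ (u + (b + d₁)) * σ (u + (b + d₂)) * σ (u + (b + d₃)) * σ (u + (b + d₄)) *
        σ (u + (b + d₅)) * σ (u + (b + d₆)) * σ (u + (b + z)) *
        σ (u - (3 * b + d₅ + d₆ + z + s))) := by
  have h := S.mixForm_curve (u := -u) hs h3 h4 hP4 hP3 hG (by rwa [S.g_neg])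
    (by rwa [S.g_neg, S.f_neg])
  rw [show 2 * b - -u = 2 * b + u by ring] at h
  have hc : mixConst g σ d₁ d₂ d₃ d₄ d₅ d₆ s b (-u) = mixConst g σ d₁ d₂ d₃ d₄ d₅ d₆ s b u := by
    rw [mixConst, mixConst, S.g_neg]
  rw [h, hc]
  simp only [show ∀ a : ℂ, -u - a = -(u + a) from fun a => by ring,
    show ∀ a : ℂ, -u + a = -(u - a) from fun a => by ring, S.σ_neg]
  ring

/-- `mixForm` is linear in (F, E), so Cramer's rule recovers it from its values at two vectors. -/
theorem _root_.EllipticPainleve.mixForm_affine (τ d₁ d₂ d₃ d₄ d₅ d₆ z s b X y FA EA FB EB : ℂ) :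
    mixForm τ d₁ d₂ d₃ d₄ d₅ d₆ z s b X y 1 * (FA * EB - FB * EA) =
      mixForm τ d₁ d₂ d₃ d₄ d₅ d₆ z s b X FA EA * (y * EB - FB) -
      mixForm τ d₁ d₂ d₃ d₄ d₅ d₆ z s b X FB EB * (y * EA - FA) := by
  unfold mixForm pForm
  ring

theorem _root_.EllipticPainleve.pForm_one (τ a₁ a₂ a₃ b X y : ℂ) :
    pForm τ a₁ a₂ a₃ b X y 1 = pP τ a₁ a₂ a₃ b X y := by
  unfold pForm pP
  ring

/-- The denominator contains neither z nor d₅, d₆, so it cancels in the quotient of two `mixN` that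
differ in z. -/
theorem _root_.EllipticPainleve.mixN_eq {τ d₁ d₂ d₃ d₄ d₅ d₆ z s b X y : ℂ}
    (h4 : pP τ d₁ d₂ d₄ b X y ≠ 0) (h3 : pP τ d₁ d₂ d₃ b X y ≠ 0) (hG : gG τ d₁ d₂ d₃ d₄ b ≠ 0)
    (hX : X - cd τ (b + d₄) ≠ 0) :
    mixN τ d₁ d₂ d₃ d₄ d₅ d₆ z s b X y =
      mixForm τ d₁ d₂ d₃ d₄ d₅ d₆ z s b X y 1 /
        (gG τ d₁ d₂ d₃ d₄ b * (X - cd τ (b + d₄)) * pP τ d₁ d₂ d₃ b X y * pP τ d₁ d₂ d₄ b X y) := by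
  rw [mixN, mixForm, pForm_one, pForm_one, linQuot]
  field_simp

/-- The value of the numerator of `mixN` at any point of the fibre `x = cd u`. -/
theorem mixForm_value (S : CdSystem τ f g σ) {d₁ d₂ d₃ d₄ d₅ d₆ z s b X u y : ℂ}
    (hs : s = d₁ + d₂ + d₃ + d₄)
    (h3 : QReg τ d₅ d₆ d₃ z s b) (h4 : QReg τ d₅ d₆ d₄ z s b)
    (hP4 : PReg τ d₁ d₂ d₄ b) (hP3 : PReg τ d₁ d₂ d₃ b) (hG : GReg τ d₁ d₂ d₃ d₄ b)
    (hu : g u ≠ 0) (hX : X * g u = f u) :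
    mixForm τ d₁ d₂ d₃ d₄ d₅ d₆ z s b X y 1 * (σ (2 * u) * σ (4 * b)) =
      mixConst g σ d₁ d₂ d₃ d₄ d₅ d₆ s b u * mixFactor g σ d₅ d₆ z s b *
      ((σ (u + (b + d₁)) * σ (u + (b + d₂)) * σ (u + (b + d₃)) * σ (u + (b + d₄)) *
        σ (u + (b + d₅)) * σ (u + (b + d₆)) * σ (u + (b + z)) *
        σ (u - (3 * b + d₅ + d₆ + z + s))) * cdForm f g y (2 * b - u) -
       (σ (u - (b + d₁)) * σ (u - (b + d₂)) * σ (u - (b + d₃)) * σ (u - (b + d₄)) *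
        σ (u - (b + d₅)) * σ (u - (b + d₆)) * σ (u - (b + z)) *
        σ (u + (3 * b + d₅ + d₆ + z + s))) * cdForm f g y (2 * b + u)) := by
  have hA := mixForm_affine τ d₁ d₂ d₃ d₄ d₅ d₆ z s b X y (f (2 * b + u)) (g (2 * b + u))
    (f (2 * b - u)) (g (2 * b - u))
  rw [S.bracket, S.mixForm_curve hs h3 h4 hP4 hP3 hG hu hX,
    S.mixForm_neg hs h3 h4 hP4 hP3 hG hu hX,
    show 2 * b + u - (2 * b - u) = 2 * u by ring,
    show 2 * b + u + (2 * b - u) = 4 * b by ring] at hA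
  rw [hA, cdForm, cdForm]
  ring

end CdSystem

end EllipticPainleve

end

/-! ### The first equation off the branch locus. -/

noncomputable section

namespace EllipticPainleve

namespace CdSystem

variable {τ : ℂ} {f g σ : ℂ → ℂ}

/-- The numerator of `mixN` at `(x, y)` in terms of the image `Y` of `y`. -/
theorem mixForm_mul_eq (S : CdSystem τ f g σ) {d₁ d₂ d₃ d₄ d₅ d₆ z w s b l X u y Y k : ℂ}
    (hs : s = d₁ + d₂ + d₃ + d₄) (hl : l = (d₁ + d₂ + d₃ + d₄ + d₅ + d₆ + z + w) / 2)
    (h3 : QReg τ d₅ d₆ d₃ z s b) (h4 : QReg τ d₅ d₆ d₄ z s b)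
    (hP4 : PReg τ d₁ d₂ d₄ b) (hP3 : PReg τ d₁ d₂ d₃ b) (hG : GReg τ d₁ d₂ d₃ d₄ b)
    (hu : g u ≠ 0) (hX : X * g u = f u)
    (hA : cdForm f g Y (2 * b + l + u) =
      k * (σ (u + (b + d₁)) * σ (u + (b + d₂)) * σ (u + (b + d₃)) * σ (u + (b + d₄)) *
        σ (u + (b + d₅)) * σ (u + (b + d₆)) * σ (u + (b + z)) * σ (u + (b + w))) *
        cdForm f g y (2 * b - u))
    (hB : cdForm f g Y (2 * b + l - u) =
      k * (σ (u - (b + d₁)) * σ (u - (b + d₂)) * σ (u - (b + d₃)) * σ (u - (b + d₄)) *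
        σ (u - (b + d₅)) * σ (u - (b + d₆)) * σ (u - (b + z)) * σ (u - (b + w))) *
        cdForm f g y (2 * b + u)) :
    k * (σ (u - (b + w)) * σ (u + (b + w))) *
        (mixForm τ d₁ d₂ d₃ d₄ d₅ d₆ z s b X y 1 * (σ (2 * u) * σ (4 * b))) =
      -(mixConst g σ d₁ d₂ d₃ d₄ d₅ d₆ s b u * mixFactor g σ d₅ d₆ z s b) *
        (cdForm f g Y (b - w + l) * (σ (2 * u) * σ (4 * b + 2 * l))) := by
  -- The eighth zero in `mixForm_value` is the one for which these arguments agree with the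
  -- expansion of the form of Y at b−w+l. The factors σ(u∓(b+w)) complete the products over seven
  -- points to those over eight.
  have t := S.cdForm_three_term Y (b - w + l) (2 * b + l - u) (2 * b + l + u)
  rw [show 2 * b + l - u - (2 * b + l + u) = -(2 * u) by ring,
    show 2 * b + l - u + (2 * b + l + u) = 4 * b + 2 * l by ring,
    show b - w + l - (2 * b + l + u) = -(u + (b + w)) by ring,
    show b - w + l + (2 * b + l + u) = u + (3 * b + d₅ + d₆ + z + s) by rw [hs, hl]; ring,
    show b - w + l - (2 * b + l - u) = u - (b + w) by ring,
    show b - w + l + (2 * b + l - u) = -(u - (3 * b + d₅ + d₆ + z + s)) by rw [hs, hl]; ring,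
    S.σ_neg, S.σ_neg, S.σ_neg, hA, hB] at t
  rw [S.mixForm_value hs h3 h4 hP4 hP3 hG hu hX]
  linear_combination -(mixConst g σ d₁ d₂ d₃ d₄ d₅ d₆ s b u * mixFactor g σ d₅ d₆ z s b) * t

/-- The constant of the first equation. -/
theorem firstConst_eq (S : CdSystem τ f g σ) {c₁ c₂ c₃ c₄ c₅ c₆ c₇ c₈ η l s : ℂ}
    (hs : s = c₁ + c₂ + c₃ + c₄) (hl : l = (c₁ + c₂ + c₃ + c₄ + c₅ + c₆ + c₇ + c₈) / 2)
    (h1 : CdQuotReg τ (η - c₈ + l) (η - c₇ + l) (3 * η + c₆ + l))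
    (h2 : CdQuotReg τ (2 * η + (c₇ - c₈) / 2 + l) (2 * η - (c₇ - c₈) / 2 + l)
      (c₆ + (c₇ + c₈) / 2 - l))
    (h3 : CdQuotReg τ (2 * η - (c₇ - c₈) / 2 + l) (2 * η + (c₇ - c₈) / 2 + l)
      (2 * η + c₆ - (c₇ + c₈) / 2 + l))
    (h4 : CdQuotReg τ (η + c₈ + s / 2) (η + c₇ + s / 2) (η + c₅ + s / 2)) :
    cdQuot τ (η - c₈ + l) (η - c₇ + l) (3 * η + c₆ + l) *
    cdQuot τ (2 * η + (c₇ - c₈) / 2 + l) (2 * η - (c₇ - c₈) / 2 + l) (c₆ + (c₇ + c₈) / 2 - l) *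
    cdQuot τ (2 * η - (c₇ - c₈) / 2 + l) (2 * η + (c₇ - c₈) / 2 + l)
      (2 * η + c₆ - (c₇ + c₈) / 2 + l) *
    cdQuot τ (η + c₈ + s / 2) (η + c₇ + s / 2) (η + c₅ + s / 2) =
    σ (c₆ - c₈) * σ (c₅ - c₈) * g (η + c₇ + s / 2) * g (η - c₇ + l) /
      (σ (c₆ - c₇) * σ (c₅ - c₇) * g (η + c₈ + s / 2) * g (η - c₈ + l)) := by
  rw [S.cdQuot_eq h1, S.cdQuot_eq h2, S.cdQuot_eq h3, S.cdQuot_eq h4]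
  obtain ⟨n1, n2, -, -, n3, n4⟩ := S.cdQuotReg_iff.1 h1
  obtain ⟨n5, n6, -, -, n7, n8⟩ := S.cdQuotReg_iff.1 h2
  obtain ⟨n9, n10, -, -, n11, n12⟩ := S.cdQuotReg_iff.1 h3
  obtain ⟨n13, n14, -, -, n15, n16⟩ := S.cdQuotReg_iff.1 h4
  clear h1 h2 h3 h4
  rw [show 3 * η + c₆ + l - (η - c₇ + l) = 2 * η + c₆ + c₇ by ring] at *
  rw [show 3 * η + c₆ + l + (η - c₇ + l) = 4 * η + c₆ - c₇ + 2 * l by ring] at *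
  rw [show c₆ + (c₇ + c₈) / 2 - l - (2 * η - (c₇ - c₈) / 2 + l) =
    -(2 * η + c₅ + c₈ + s) by rw [hl, hs]; ring] at *
  rw [show c₆ + (c₇ + c₈) / 2 - l + (2 * η - (c₇ - c₈) / 2 + l) = 2 * η + c₆ + c₈ by ring] at *
  rw [show 2 * η + c₆ - (c₇ + c₈) / 2 + l - (2 * η + (c₇ - c₈) / 2 + l) = c₆ - c₇ by ring] at *
  rw [show 2 * η + c₆ - (c₇ + c₈) / 2 + l + (2 * η + (c₇ - c₈) / 2 + l) =
    4 * η + c₆ - c₈ + 2 * l by ring] at *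
  rw [show η + c₅ + s / 2 - (η + c₇ + s / 2) = c₅ - c₇ by ring] at *
  rw [show η + c₅ + s / 2 + (η + c₇ + s / 2) = 2 * η + c₅ + c₇ + s by ring] at *
  rw [show 3 * η + c₆ + l - (η - c₈ + l) = 2 * η + c₆ + c₈ by ring,
    show 3 * η + c₆ + l + (η - c₈ + l) = 4 * η + c₆ - c₈ + 2 * l by ring,
    show c₆ + (c₇ + c₈) / 2 - l - (2 * η + (c₇ - c₈) / 2 + l) =
      -(2 * η + c₅ + c₇ + s) by rw [hl, hs]; ring,
    show c₆ + (c₇ + c₈) / 2 - l + (2 * η + (c₇ - c₈) / 2 + l) = 2 * η + c₆ + c₇ by ring,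
    show 2 * η + c₆ - (c₇ + c₈) / 2 + l - (2 * η - (c₇ - c₈) / 2 + l) = c₆ - c₈ by ring,
    show 2 * η + c₆ - (c₇ + c₈) / 2 + l + (2 * η - (c₇ - c₈) / 2 + l) =
      4 * η + c₆ - c₇ + 2 * l by ring,
    show η + c₅ + s / 2 - (η + c₈ + s / 2) = c₅ - c₈ by ring,
    show η + c₅ + s / 2 + (η + c₈ + s / 2) = 2 * η + c₅ + c₈ + s by ring]
  simp only [S.σ_neg, neg_ne_zero] at *
  generalize 2 * η + c₆ + c₇ = r₁ at *
  generalize 2 * η + c₆ + c₈ = r₂ at *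
  generalize 4 * η + c₆ - c₇ + 2 * l = r₃ at *
  generalize 4 * η + c₆ - c₈ + 2 * l = r₄ at *
  generalize 2 * η + c₅ + c₇ + s = r₅ at *
  generalize 2 * η + c₅ + c₈ + s = r₆ at *
  generalize 2 * η - (c₇ - c₈) / 2 + l = r₇ at *
  generalize 2 * η + (c₇ - c₈) / 2 + l = r₈ at *
  generalize η + c₇ + s / 2 = r₉ at *
  generalize η + c₈ + s / 2 = r₁₀ at *
  field_simp

/-- The first equation at points outside the branch locus of the pencil. -/
theorem msyFirst_of_unramified (S : CdSystem τ f g σ) {c : Fin 8 → ℂ} {η l x y u : ℂ}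
    (hl : l = (∑ j, c j) / 2) (hS : StageReg τ c η x y)
    (hR : MSYFirstReg τ (c 0) (c 1) (c 2) (c 3) (c 4) (c 5) (c 6) (c 7) η l x y
      (stageY₄ τ c η x y))
    (hu : g u ≠ 0) (hx : x * g u = f u) (h2 : σ (2 * u) ≠ 0) (h4 : σ (4 * η) ≠ 0)
    (hl4 : σ (4 * η + 2 * l) ≠ 0) :
    MSYFirst τ (c 0) (c 1) (c 2) (c 3) (c 4) (c 5) (c 6) (c 7) η l x y (stageY₄ τ c η x y) := by
  rw [sum_vec] at hl
  obtain ⟨k, hA, hB⟩ := S.stageY₄_cdForm hS hu hx hl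
  generalize stageY₄ τ c η x y = Y at *
  generalize c 0 = c₁ at *
  generalize c 1 = c₂ at *
  generalize c 2 = c₃ at *
  generalize c 3 = c₄ at *
  generalize c 4 = c₅ at *
  generalize c 5 = c₆ at *
  generalize c 6 = c₇ at *
  generalize c 7 = c₈ at *
  obtain ⟨rY, rx, q1, q2, q3, q4, m7, m8, hm8⟩ := hR
  have hK := S.firstConst_eq rfl hl q1 q2 q3 q4
  obtain ⟨Q3, Q4, P4, P3, G, hp4, hp3, hG, rX⟩ := m7
  obtain ⟨Q3', Q4', -⟩ := m8
  -- The roles of c₇ and c₈ as z and as the omitted parameter w are exchanged between `E7` and `E8`.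
  have E7 := S.mixForm_mul_eq (w := c₈) rfl hl Q3 Q4 P4 P3 G hu hx hA hB
  have E8 := S.mixForm_mul_eq (z := c₈) (w := c₇) (l := l) (Y := Y) (k := k) (y := y) rfl
    (by rw [hl]; ring) Q3' Q4' P4 P3 G hu hx (by rw [hA]; ring) (by rw [hB]; ring)
  have V8 := S.mixForm_value (y := y) rfl Q3' Q4' P4 P3 G hu hx
  -- Otherwise the numerator of N_d(c₈) would vanish by `mixForm_value`, contrary to the regularity
  -- assumption.
  have hW : mixConst g σ c₁ c₂ c₃ c₄ c₅ c₆ (c₁ + c₂ + c₃ + c₄) η u *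
      mixFactor g σ c₅ c₆ c₈ (c₁ + c₂ + c₃ + c₄) η ≠ 0 := by
    intro h0
    rw [h0, zero_mul] at V8
    rw [mixN_eq hp4 hp3 hG rX.2.2] at hm8
    exact mul_ne_zero (div_ne_zero_iff.1 hm8).1 (mul_ne_zero h2 h4) V8
  clear V8
  rw [MSYFirst, hK, mixN_eq hp4 hp3 hG rX.2.2]
  rw [mixN_eq hp4 hp3 hG rX.2.2] at hm8 ⊢
  have hm8' : mixForm τ c₁ c₂ c₃ c₄ c₅ c₆ c₈ (c₁ + c₂ + c₃ + c₄) η x y 1 ≠ 0 :=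
    (div_ne_zero_iff.1 hm8).1
  rw [div_div_div_cancel_right₀ (div_ne_zero_iff.1 hm8).2]
  have v7 := S.sub_cd rY.2.1 Y
  have v8 := S.sub_cd rY.1 Y
  have x7 := S.sub_cd_eq hu hx rx.1
  have x8 := S.sub_cd_eq hu hx rx.2.1
  have hY7 := rY.2.2
  have hx8 := rx.2.2
  rw [linQuot, linQuot, v7, v8, x7, x8]
  rw [v7] at hY7
  rw [x8] at hx8
  have hY7' := (div_ne_zero_iff.1 hY7).1
  have hx8' := (div_ne_zero_iff.1 hx8).1
  obtain ⟨n1, n2, -, -, n3, n4⟩ := S.cdQuotReg_iff.1 q1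
  obtain ⟨n11, n12, -, -, n13, -⟩ := S.cdQuotReg_iff.1 q3
  obtain ⟨n14, n15, -, -, n16, -⟩ := S.cdQuotReg_iff.1 q4
  rw [show 2 * η + c₆ - (c₇ + c₈) / 2 + l - (2 * η + (c₇ - c₈) / 2 + l) = c₆ - c₇ by ring] at n13
  rw [show η + c₅ + (c₁ + c₂ + c₃ + c₄) / 2 - (η + c₇ + (c₁ + c₂ + c₃ + c₄) / 2) =
    c₅ - c₇ by ring] at n16
  have g7 := (S.reg_iff _).1 rx.1
  have g8 := (S.reg_iff _).1 rx.2.1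
  have hk : k ≠ 0 := by
    rintro rfl
    rw [zero_mul, zero_mul] at E8
    exact mul_ne_zero (neg_ne_zero.2 hW) (mul_ne_zero hY7' (mul_ne_zero h2 hl4)) E8.symm
  have hT := mul_ne_zero h2 h4
  -- Cross-multiplying `E7` and `E8` eliminates `mixConst`; the common nonzero factor k·σ(2u)·σ(4η)
  -- is then cancelled.
  have cross : cdForm f g Y (η - c₈ + l) * (σ (u - (η + c₇)) * σ (u + (η + c₇))) *
      mixForm τ c₁ c₂ c₃ c₄ c₅ c₆ c₈ (c₁ + c₂ + c₃ + c₄) η x y 1 *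
        mixFactor g σ c₅ c₆ c₇ (c₁ + c₂ + c₃ + c₄) η =
      cdForm f g Y (η - c₇ + l) * (σ (u - (η + c₈)) * σ (u + (η + c₈))) *
      mixForm τ c₁ c₂ c₃ c₄ c₅ c₆ c₇ (c₁ + c₂ + c₃ + c₄) η x y 1 *
        mixFactor g σ c₅ c₆ c₈ (c₁ + c₂ + c₃ + c₄) η := by
    refine mul_left_cancel₀ (mul_ne_zero hk hT) ?_
    linear_combination
      cdForm f g Y (η - c₈ + l) * mixFactor g σ c₅ c₆ c₇ (c₁ + c₂ + c₃ + c₄) η * E8 -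
      cdForm f g Y (η - c₇ + l) * mixFactor g σ c₅ c₆ c₈ (c₁ + c₂ + c₃ + c₄) η * E7
  clear E7 E8 hA hB hK hW hm8 rY rx q1 q2 q3 q4 v7 v8 x7 x8 hp4 hp3 hG rX Q3 Q4 Q3' Q4' P4 P3 G
  unfold mixFactor at cross
  rw [show c₇ - c₆ = -(c₆ - c₇) by ring, show c₈ - c₆ = -(c₆ - c₈) by ring, S.σ_neg,
    S.σ_neg] at cross
  generalize η + c₇ + (c₁ + c₂ + c₃ + c₄) / 2 = r₉ at *
  generalize η + c₈ + (c₁ + c₂ + c₃ + c₄) / 2 = r₁₀ at *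
  generalize mixForm τ c₁ c₂ c₃ c₄ c₅ c₆ c₇ (c₁ + c₂ + c₃ + c₄) η x y 1 = N₇ at *
  generalize mixForm τ c₁ c₂ c₃ c₄ c₅ c₆ c₈ (c₁ + c₂ + c₃ + c₄) η x y 1 = N₈ at *
  generalize σ (u - (η + c₇)) * σ (u + (η + c₇)) = P₇ at *
  generalize σ (u - (η + c₈)) * σ (u + (η + c₈)) = P₈ at *
  clear hl
  generalize η - c₇ + l = v₇ at *
  generalize η - c₈ + l = v₈ at *
  generalize η + c₇ = e₇ at *
  generalize η + c₈ = e₈ at *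
  field_simp at cross ⊢
  linear_combination -cross

end CdSystem

end EllipticPainleve

end

noncomputable section

namespace EllipticPainleve

open Filter Topology

namespace CdSystem

variable {τ : ℂ} {f g σ : ℂ → ℂ} {Z : Type*} [TopologicalSpace Z] {z : Z}

/-! ### Continuity, and openness of the domains of definition -/

theorem cdReg_eventually (S : CdSystem τ f g σ) {u : Z → ℂ} (hu : ContinuousAt u z)
    (h : CdReg τ (u z)) : ∀ᶠ t in 𝓝 z, CdReg τ (u t) := by
  simp only [S.reg_iff] at h ⊢
  exact (S.g_diff.continuous.continuousAt.comp hu).eventually_ne h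

theorem continuousAt_cd (S : CdSystem τ f g σ) {u : Z → ℂ} (hu : ContinuousAt u z)
    (h : CdReg τ (u z)) : ContinuousAt (fun t => cd τ (u t)) z := by
  simp only [S.reg_iff] at h
  simp only [S.cd_eq]
  exact (S.f_diff.continuous.continuousAt.comp hu).div
    (S.g_diff.continuous.continuousAt.comp hu) h

theorem continuousAt_cdQuot (S : CdSystem τ f g σ) {u v w : Z → ℂ} (hu : ContinuousAt u z)
    (hv : ContinuousAt v z) (hw : ContinuousAt w z) (h : CdQuotReg τ (u z) (v z) (w z)) :
    ContinuousAt (fun t => cdQuot τ (u t) (v t) (w t)) z := by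
  obtain ⟨h1, h2, h3, h4, h5⟩ := h
  have c1 := S.continuousAt_cd hu h1
  have c2 := S.continuousAt_cd hv h2
  have c3 := S.continuousAt_cd hw h3
  exact (continuousAt_const.sub (c1.div c3 h4)).div (continuousAt_const.sub (c2.div c3 h4)) h5

theorem cdQuotReg_eventually (S : CdSystem τ f g σ) {u v w : Z → ℂ} (hu : ContinuousAt u z)
    (hv : ContinuousAt v z) (hw : ContinuousAt w z) (h : CdQuotReg τ (u z) (v z) (w z)) :
    ∀ᶠ t in 𝓝 z, CdQuotReg τ (u t) (v t) (w t) := by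
  obtain ⟨h1, h2, h3, h4, h5⟩ := h
  have c2 := S.continuousAt_cd hv h2
  have c3 := S.continuousAt_cd hw h3
  filter_upwards [S.cdReg_eventually hu h1, S.cdReg_eventually hv h2, S.cdReg_eventually hw h3,
    c3.eventually_ne h4, (continuousAt_const.sub (c2.div c3 h4)).eventually_ne h5]
    with t a1 a2 a3 a4 a5
  exact ⟨a1, a2, a3, a4, a5⟩

theorem continuousAt_linQuot (S : CdSystem τ f g σ) {X u v : Z → ℂ} (hX : ContinuousAt X z)
    (hu : ContinuousAt u z) (hv : ContinuousAt v z) (h : LinQuotReg τ (X z) (u z) (v z)) :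
    ContinuousAt (fun t => linQuot τ (X t) (u t) (v t)) z :=
  (hX.sub (S.continuousAt_cd hu h.1)).div (hX.sub (S.continuousAt_cd hv h.2.1)) h.2.2

theorem linQuotReg_eventually (S : CdSystem τ f g σ) {X u v : Z → ℂ} (hX : ContinuousAt X z)
    (hu : ContinuousAt u z) (hv : ContinuousAt v z) (h : LinQuotReg τ (X z) (u z) (v z)) :
    ∀ᶠ t in 𝓝 z, LinQuotReg τ (X t) (u t) (v t) := by
  filter_upwards [S.cdReg_eventually hu h.1, S.cdReg_eventually hv h.2.1,
    (hX.sub (S.continuousAt_cd hv h.2.1)).eventually_ne h.2.2] with t a1 a2 a3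
  exact ⟨a1, a2, a3⟩

theorem s₂Reg_continuity (S : CdSystem τ f g σ) {c₁ c₂ η x y : Z → ℂ}
    (h1 : ContinuousAt c₁ z) (h2 : ContinuousAt c₂ z) (he : ContinuousAt η z)
    (hx : ContinuousAt x z) (hy : ContinuousAt y z) (h : S₂Reg τ (c₁ z) (c₂ z) (η z) (x z) (y z)) :
    (∀ᶠ t in 𝓝 z, S₂Reg τ (c₁ t) (c₂ t) (η t) (x t) (y t)) ∧
      ContinuousAt (fun t => s₂Y τ (c₁ t) (c₂ t) (η t) (x t) (y t)) z := by
  obtain ⟨q1, q2, q3, a1, a2, a3, a4, a5⟩ := h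
  have u1 : ContinuousAt (fun t => η t - c₂ t) z := by fun_prop
  have u2 : ContinuousAt (fun t => η t - c₁ t) z := by fun_prop
  have u3 : ContinuousAt (fun t => η t + c₁ t) z := by fun_prop
  have u4 : ContinuousAt (fun t => η t + c₂ t) z := by fun_prop
  have u5 : ContinuousAt (fun t => 2 * η t - (c₁ t - c₂ t) / 2) z := by fun_prop
  have u6 : ContinuousAt (fun t => 2 * η t + (c₁ t - c₂ t) / 2) z := by fun_prop
  have u7 : ContinuousAt (fun t => (c₁ t + c₂ t) / 2) z := by fun_prop
  have d1 := S.continuousAt_cd u1 q1.1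
  have d2 := S.continuousAt_cd u2 q1.2.1
  have d3 := S.continuousAt_cd u3 q2.1
  have d4 := S.continuousAt_cd u4 q2.2.1
  have d5 := S.continuousAt_cd u5 q3.1
  have d6 := S.continuousAt_cd u6 q3.2.1
  have k : ContinuousAt (fun t => s₂Const τ (c₁ t) (c₂ t) (η t)) z :=
    ((S.continuousAt_cdQuot u1 u2 he q1).mul (S.continuousAt_cdQuot u3 u4 he q2)).mul
      (S.continuousAt_cdQuot u5 u6 u7 q3)
  have hD : ContinuousAt (fun t => s₂Den τ (c₁ t) (c₂ t) (η t) (x t) (y t)) z :=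
    (hx.sub d3).mul (hy.sub d1)
  have hN : ContinuousAt (fun t => s₂Num τ (c₁ t) (c₂ t) (η t) (x t) (y t)) z :=
    (k.mul (hx.sub d4)).mul (hy.sub d2)
  refine ⟨?_, ((d5.mul hD).sub (d6.mul hN)).div (hD.sub hN) a5⟩
  filter_upwards [S.cdQuotReg_eventually u1 u2 he q1, S.cdQuotReg_eventually u3 u4 he q2,
    S.cdQuotReg_eventually u5 u6 u7 q3, (hx.sub d4).eventually_ne a1, (hy.sub d2).eventually_ne a2,
    (d5.sub d6).eventually_ne (sub_ne_zero.2 a3), hD.eventually_ne a4, (hD.sub hN).eventually_ne a5]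
    with t b1 b2 b3 b4 b5 b6 b7 b8
  exact ⟨b1, b2, b3, b4, b5, sub_ne_zero.1 b6, b7, b8⟩

theorem stage_continuity (S : CdSystem τ f g σ) {c : Z → Fin 8 → ℂ} {η x y : Z → ℂ}
    (hc : ContinuousAt c z) (he : ContinuousAt η z)
    (hx : ContinuousAt x z) (hy : ContinuousAt y z) (h : StageReg τ (c z) (η z) (x z) (y z)) :
    (∀ᶠ t in 𝓝 z, StageReg τ (c t) (η t) (x t) (y t)) ∧
      ContinuousAt (fun t => stageY₄ τ (c t) (η t) (x t) (y t)) z := by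
  obtain ⟨h1, h2, h3, h4⟩ := h
  have hj : ∀ j, ContinuousAt (fun t => c t j) z := fun j =>
    (continuous_apply j).continuousAt.comp hc
  have c0 := hj 0
  have c1 := hj 1
  have c2 := hj 2
  have c3 := hj 3
  have c4 := hj 4
  have c5 := hj 5
  have c6 := hj 6
  have c7 := hj 7
  have s1 : ContinuousAt (fun t => shift (c t 0) (c t 1) (η t)) z := by
    unfold shift; fun_prop
  have s2 : ContinuousAt (fun t => shift (c t 2) (c t 3) (η t)) z := by
    unfold shift; fun_prop
  have s3 : ContinuousAt (fun t => shift (c t 4) (c t 5) (η t)) z := by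
    unfold shift; fun_prop
  obtain ⟨e1, y1⟩ := S.s₂Reg_continuity c0 c1 he hx hy h1
  obtain ⟨e2, y2⟩ := S.s₂Reg_continuity (c2.add s1) (c3.add s1) (he.sub s1) hx y1 h2
  obtain ⟨e3, y3⟩ := S.s₂Reg_continuity ((c4.add s1).add s2) ((c5.add s1).add s2)
    ((he.sub s1).sub s2) hx y2 h3
  obtain ⟨e4, y4⟩ := S.s₂Reg_continuity (((c6.add s1).add s2).add s3) (((c7.add s1).add s2).add s3)
    (((he.sub s1).sub s2).sub s3) hx y3 h4
  refine ⟨?_, y4⟩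
  filter_upwards [e1, e2, e3, e4] with t b1 b2 b3 b4
  exact ⟨b1, b2, b3, b4⟩

theorem gG_continuity (S : CdSystem τ f g σ) {a₁ a₂ a₃ a₄ b : Z → ℂ}
    (h1 : ContinuousAt a₁ z) (h2 : ContinuousAt a₂ z) (h3 : ContinuousAt a₃ z)
    (h4 : ContinuousAt a₄ z) (hb : ContinuousAt b z)
    (h : GReg τ (a₁ z) (a₂ z) (a₃ z) (a₄ z) (b z)) :
    (∀ᶠ t in 𝓝 z, GReg τ (a₁ t) (a₂ t) (a₃ t) (a₄ t) (b t)) ∧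
      ContinuousAt (fun t => gG τ (a₁ t) (a₂ t) (a₃ t) (a₄ t) (b t)) z := by
  obtain ⟨q1, q2, q3, q4⟩ := h
  constructor
  · simp only [GReg, eventually_and]
    refine ⟨?_, ?_, ?_, ?_⟩ <;>
    · refine S.cdQuotReg_eventually (by fun_prop) (by fun_prop) (by fun_prop) ?_
      assumption
  · unfold gG
    refine ((ContinuousAt.mul ?_ ?_).mul ?_).mul ?_ <;>
    · refine S.continuousAt_cdQuot (by fun_prop) (by fun_prop) (by fun_prop) ?_
      assumption

theorem qQ_continuity (S : CdSystem τ f g σ) {a₁ a₂ a₃ a₄ a₅ b X : Z → ℂ}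
    (h1 : ContinuousAt a₁ z) (h2 : ContinuousAt a₂ z) (h3 : ContinuousAt a₃ z)
    (h4 : ContinuousAt a₄ z) (h5 : ContinuousAt a₅ z) (hb : ContinuousAt b z)
    (hX : ContinuousAt X z) (h : QReg τ (a₁ z) (a₂ z) (a₃ z) (a₄ z) (a₅ z) (b z)) :
    (∀ᶠ t in 𝓝 z, QReg τ (a₁ t) (a₂ t) (a₃ t) (a₄ t) (a₅ t) (b t)) ∧
      ContinuousAt (fun t => qQ τ (a₁ t) (a₂ t) (a₃ t) (a₄ t) (a₅ t) (b t) (X t)) z := by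
  obtain ⟨q1, q2, q3, q4, q5, q6, q7⟩ := h
  constructor
  · simp only [QReg, eventually_and]
    refine ⟨?_, ?_, ?_, ?_, ?_, ?_, ?_⟩ <;>
    · refine S.cdReg_eventually (by fun_prop) ?_
      assumption
  · have e1 : ContinuousAt (fun t => cd τ (b t + a₁ t)) z := S.continuousAt_cd (by fun_prop) q1
    have e2 : ContinuousAt (fun t => cd τ (b t + a₂ t)) z := S.continuousAt_cd (by fun_prop) q2
    have e3 : ContinuousAt (fun t => cd τ (b t + a₄ t)) z := S.continuousAt_cd (by fun_prop) q3
    have e4 : ContinuousAt (fun t => cd τ (b t + a₃ t - a₅ t / 2)) z :=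
      S.continuousAt_cd (by fun_prop) q4
    have e5 : ContinuousAt (fun t => cd τ (b t + a₁ t + a₅ t / 2)) z :=
      S.continuousAt_cd (by fun_prop) q5
    have e6 : ContinuousAt (fun t => cd τ (b t + a₂ t + a₅ t / 2)) z :=
      S.continuousAt_cd (by fun_prop) q6
    have e7 : ContinuousAt (fun t => cd τ (b t + a₄ t + a₅ t / 2)) z :=
      S.continuousAt_cd (by fun_prop) q7
    unfold qQ
    fun_prop

theorem pP_continuity (S : CdSystem τ f g σ) {a₁ a₂ a₃ b X Y : Z → ℂ}
    (h1 : ContinuousAt a₁ z) (h2 : ContinuousAt a₂ z) (h3 : ContinuousAt a₃ z)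
    (hb : ContinuousAt b z) (hX : ContinuousAt X z) (hY : ContinuousAt Y z)
    (h : PReg τ (a₁ z) (a₂ z) (a₃ z) (b z)) :
    (∀ᶠ t in 𝓝 z, PReg τ (a₁ t) (a₂ t) (a₃ t) (b t)) ∧
      ContinuousAt (fun t => pP τ (a₁ t) (a₂ t) (a₃ t) (b t) (X t) (Y t)) z := by
  obtain ⟨q1, q2, q3, q4, q5, q6⟩ := h
  constructor
  · simp only [PReg, eventually_and]
    refine ⟨?_, ?_, ?_, ?_, ?_, ?_⟩ <;>
    · refine S.cdReg_eventually (by fun_prop) ?_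
      assumption
  · have e1 : ContinuousAt (fun t => cd τ (b t + a₁ t)) z := S.continuousAt_cd (by fun_prop) q1
    have e2 : ContinuousAt (fun t => cd τ (b t + a₂ t)) z := S.continuousAt_cd (by fun_prop) q2
    have e3 : ContinuousAt (fun t => cd τ (b t + a₃ t)) z := S.continuousAt_cd (by fun_prop) q3
    have e4 : ContinuousAt (fun t => cd τ (b t - a₁ t)) z := S.continuousAt_cd (by fun_prop) q4
    have e5 : ContinuousAt (fun t => cd τ (b t - a₂ t)) z := S.continuousAt_cd (by fun_prop) q5
    have e6 : ContinuousAt (fun t => cd τ (b t - a₃ t)) z := S.continuousAt_cd (by fun_prop) q6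
    unfold pP
    fun_prop

theorem mixN_continuity (S : CdSystem τ f g σ) {d₁ d₂ d₃ d₄ d₅ d₆ w s b X Y : Z → ℂ}
    (h1 : ContinuousAt d₁ z) (h2 : ContinuousAt d₂ z) (h3 : ContinuousAt d₃ z)
    (h4 : ContinuousAt d₄ z) (h5 : ContinuousAt d₅ z) (h6 : ContinuousAt d₆ z)
    (hw : ContinuousAt w z) (hs : ContinuousAt s z)
    (hb : ContinuousAt b z) (hX : ContinuousAt X z) (hY : ContinuousAt Y z)
    (h : MixNReg τ (d₁ z) (d₂ z) (d₃ z) (d₄ z) (d₅ z) (d₆ z) (w z) (s z) (b z) (X z) (Y z)) :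
    (∀ᶠ t in 𝓝 z,
      MixNReg τ (d₁ t) (d₂ t) (d₃ t) (d₄ t) (d₅ t) (d₆ t) (w t) (s t) (b t) (X t) (Y t)) ∧
    ContinuousAt (fun t =>
      mixN τ (d₁ t) (d₂ t) (d₃ t) (d₄ t) (d₅ t) (d₆ t) (w t) (s t) (b t) (X t) (Y t)) z := by
  obtain ⟨q3, q4, p4, p3, hG, n4, n3, nG, hL⟩ := h
  obtain ⟨a1, b1⟩ := S.qQ_continuity h5 h6 h3 hw hs hb hX q3
  obtain ⟨a2, b2⟩ := S.qQ_continuity h5 h6 h4 hw hs hb hX q4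
  obtain ⟨a3, b3⟩ := S.pP_continuity h1 h2 h4 hb hX hY p4
  obtain ⟨a4, b4⟩ := S.pP_continuity h1 h2 h3 hb hX hY p3
  obtain ⟨a5, b5⟩ := S.gG_continuity h1 h2 h3 h4 hb hG
  constructor
  · filter_upwards [a1, a2, a3, a4, a5, b3.eventually_ne n4, b4.eventually_ne n3,
      b5.eventually_ne nG, S.linQuotReg_eventually hX (hb.add h3) (hb.add h4) hL]
      with t c1 c2 c3 c4 c5 c6 c7 c8 c9
    exact ⟨c1, c2, c3, c4, c5, c6, c7, c8, c9⟩
  · exact (b1.div b3 n4).sub ((S.continuousAt_linQuot hX (hb.add h3) (hb.add h4) hL).mul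
      (b2.div (b5.mul b4) (mul_ne_zero nG n3)))

theorem msyFirstReg_eventually (S : CdSystem τ f g σ)
    {c₁ c₂ c₃ c₄ c₅ c₆ c₇ c₈ η l x y Y : Z → ℂ}
    (h1 : ContinuousAt c₁ z) (h2 : ContinuousAt c₂ z) (h3 : ContinuousAt c₃ z)
    (h4 : ContinuousAt c₄ z) (h5 : ContinuousAt c₅ z) (h6 : ContinuousAt c₆ z)
    (h7 : ContinuousAt c₇ z) (h8 : ContinuousAt c₈ z) (he : ContinuousAt η z)
    (hl : ContinuousAt l z) (hx : ContinuousAt x z) (hy : ContinuousAt y z)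
    (hY : ContinuousAt Y z)
    (h : MSYFirstReg τ (c₁ z) (c₂ z) (c₃ z) (c₄ z) (c₅ z) (c₆ z) (c₇ z) (c₈ z) (η z) (l z)
      (x z) (y z) (Y z)) :
    ∀ᶠ t in 𝓝 z, MSYFirstReg τ (c₁ t) (c₂ t) (c₃ t) (c₄ t) (c₅ t) (c₆ t) (c₇ t) (c₈ t) (η t)
      (l t) (x t) (y t) (Y t) := by
  obtain ⟨r1, r2, q1, q2, q3, q4, m7, m8, n8⟩ := h
  obtain ⟨a7, -⟩ := S.mixN_continuity (s := fun t => c₁ t + c₂ t + c₃ t + c₄ t)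
    h1 h2 h3 h4 h5 h6 h7 (by fun_prop) he hx hy m7
  obtain ⟨a8, b8⟩ := S.mixN_continuity (s := fun t => c₁ t + c₂ t + c₃ t + c₄ t)
    h1 h2 h3 h4 h5 h6 h8 (by fun_prop) he hx hy m8
  simp only [MSYFirstReg, eventually_and]
  refine ⟨?_, ?_, ?_, ?_, ?_, ?_, a7, a8, b8.eventually_ne n8⟩
  · exact S.linQuotReg_eventually (u := fun t => η t - c₈ t + l t)
      (v := fun t => η t - c₇ t + l t) hY (by fun_prop) (by fun_prop) r1
  · exact S.linQuotReg_eventually hx (he.add h7) (he.add h8) r2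
  all_goals
    refine S.cdQuotReg_eventually (by fun_prop) (by fun_prop) (by fun_prop) ?_
    assumption

/-- Both sides are continuous wherever all terms are defined, so failure of the equation at z would
persist nearby. -/
theorem msyFirst_continuity (S : CdSystem τ f g σ)
    {c₁ c₂ c₃ c₄ c₅ c₆ c₇ c₈ η l x y Y : Z → ℂ}
    (h1 : ContinuousAt c₁ z) (h2 : ContinuousAt c₂ z) (h3 : ContinuousAt c₃ z)
    (h4 : ContinuousAt c₄ z) (h5 : ContinuousAt c₅ z) (h6 : ContinuousAt c₆ z)
    (h7 : ContinuousAt c₇ z) (h8 : ContinuousAt c₈ z) (he : ContinuousAt η z)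
    (hl : ContinuousAt l z) (hx : ContinuousAt x z) (hy : ContinuousAt y z)
    (hY : ContinuousAt Y z)
    (h : MSYFirstReg τ (c₁ z) (c₂ z) (c₃ z) (c₄ z) (c₅ z) (c₆ z) (c₇ z) (c₈ z) (η z) (l z)
      (x z) (y z) (Y z))
    (hf : ∃ᶠ t in 𝓝 z, MSYFirst τ (c₁ t) (c₂ t) (c₃ t) (c₄ t) (c₅ t) (c₆ t) (c₇ t) (c₈ t) (η t)
      (l t) (x t) (y t) (Y t)) :
    MSYFirst τ (c₁ z) (c₂ z) (c₃ z) (c₄ z) (c₅ z) (c₆ z) (c₇ z) (c₈ z) (η z) (l z)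
      (x z) (y z) (Y z) := by
  obtain ⟨r1, r2, q1, q2, q3, q4, m7, m8, n8⟩ := h
  obtain ⟨-, b7⟩ := S.mixN_continuity (s := fun t => c₁ t + c₂ t + c₃ t + c₄ t)
    h1 h2 h3 h4 h5 h6 h7 (by fun_prop) he hx hy m7
  obtain ⟨-, b8⟩ := S.mixN_continuity (s := fun t => c₁ t + c₂ t + c₃ t + c₄ t)
    h1 h2 h3 h4 h5 h6 h8 (by fun_prop) he hx hy m8
  by_contra hne
  unfold MSYFirst at hne hf
  refine hf (ContinuousAt.eventually_ne (ContinuousAt.sub ?_ ?_) (sub_ne_zero.2 hne) |>.mono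
    fun t ht => sub_ne_zero.1 ht)
  · exact (S.continuousAt_linQuot (u := fun t => η t - c₈ t + l t)
      (v := fun t => η t - c₇ t + l t) hY (by fun_prop) (by fun_prop) r1).mul
      (S.continuousAt_linQuot hx (he.add h7) (he.add h8) r2)
  · refine (((ContinuousAt.mul ?_ ?_).mul ?_).mul ?_).mul (b7.div b8 n8)
    all_goals
      refine S.continuousAt_cdQuot (by fun_prop) (by fun_prop) (by fun_prop) ?_
      assumption

/-- The first equation at all points where it is defined. -/
theorem msyFirst (S : CdSystem τ f g σ) {c : Fin 8 → ℂ} {η l x y : ℂ}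
    (hl : l = (∑ j, c j) / 2) (hS : StageReg τ c η x y)
    (hR : MSYFirstReg τ (c 0) (c 1) (c 2) (c 3) (c 4) (c 5) (c 6) (c 7) η l x y
      (stageY₄ τ c η x y)) :
    MSYFirst τ (c 0) (c 1) (c 2) (c 3) (c 4) (c 5) (c 6) (c 7) η l x y (stageY₄ τ c η x y) := by
  obtain ⟨u, hu, hx⟩ := S.surj x
  have e0 : x = cd τ (u + 0) := by
    rw [S.cd_eq, add_zero, ← hx, mul_div_cancel_right₀ _ hu]
  have e1 : η = η + 0 := (add_zero η).symm
  have hη' : ContinuousAt (fun t : ℂ => η + t) 0 := by fun_prop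
  have hut : ContinuousAt (fun t : ℂ => u + t) 0 := by fun_prop
  have hu0 : CdReg τ (u + 0) := by rw [S.reg_iff, add_zero]; exact hu
  have hx' : ContinuousAt (fun t : ℂ => cd τ (u + t)) 0 := S.continuousAt_cd hut hu0
  rw [e0, e1] at hS hR ⊢
  obtain ⟨eS, hY⟩ := S.stage_continuity (z := (0 : ℂ)) (c := fun _ => c) (η := fun t => η + t)
    (x := fun t => cd τ (u + t)) (y := fun _ => y) continuousAt_const hη' hx' continuousAt_const hS
  have eR := S.msyFirstReg_eventually (z := (0 : ℂ)) (c₁ := fun _ => c 0) (c₂ := fun _ => c 1)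
    (c₃ := fun _ => c 2) (c₄ := fun _ => c 3) (c₅ := fun _ => c 4) (c₆ := fun _ => c 5)
    (c₇ := fun _ => c 6) (c₈ := fun _ => c 7) (η := fun t => η + t) (l := fun _ => l)
    (x := fun t => cd τ (u + t)) (y := fun _ => y)
    (Y := fun t => stageY₄ τ c (η + t) (cd τ (u + t)) y)
    continuousAt_const continuousAt_const continuousAt_const continuousAt_const
    continuousAt_const continuousAt_const continuousAt_const continuousAt_const
    hη' continuousAt_const hx' continuousAt_const hY hR
  refine S.msyFirst_continuity (z := (0 : ℂ)) (c₁ := fun _ => c 0) (c₂ := fun _ => c 1)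
    (c₃ := fun _ => c 2) (c₄ := fun _ => c 3) (c₅ := fun _ => c 4) (c₆ := fun _ => c 5)
    (c₇ := fun _ => c 6) (c₈ := fun _ => c 7) (η := fun t => η + t) (l := fun _ => l)
    (x := fun t => cd τ (u + t)) (y := fun _ => y)
    (Y := fun t => stageY₄ τ c (η + t) (cd τ (u + t)) y)
    continuousAt_const continuousAt_const continuousAt_const continuousAt_const
    continuousAt_const continuousAt_const continuousAt_const continuousAt_const
    hη' continuousAt_const hx' continuousAt_const hY hR ?_
  -- Moving u and η by the same t leaves all three exceptional loci at once, with c, λ and y fixed.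
  have n1 := eventually_comp_line_ne_zero S.σ_diff S.σ_ne (2 * u) (two_ne_zero)
  have n2 := eventually_comp_line_ne_zero S.σ_diff S.σ_ne (4 * η) (b := 4) (by norm_num)
  have n3 := eventually_comp_line_ne_zero S.σ_diff S.σ_ne (4 * η + 2 * l) (b := 4) (by norm_num)
  have n4 := (S.cdReg_eventually hut hu0).filter_mono (nhdsWithin_le_nhds (s := {0}ᶜ))
  refine Frequently.filter_mono (Eventually.frequently (f := 𝓝[≠] (0 : ℂ)) ?_) nhdsWithin_le_nhds
  filter_upwards [n1, n2, n3, n4, eS.filter_mono nhdsWithin_le_nhds,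
    eR.filter_mono nhdsWithin_le_nhds] with t m1 m2 m3 m4 m5 m6
  rw [S.reg_iff] at m4
  refine S.msyFirst_of_unramified hl m5 m6 m4 ?_ ?_ ?_ ?_
  · rw [S.cd_eq, div_mul_cancel₀ _ m4]
  · rwa [show 2 * (u + t) = 2 * u + t * 2 by ring]
  · rwa [show 4 * (η + t) = 4 * η + t * 4 by ring]
  · rwa [show 4 * (η + t) + 2 * l = 4 * η + 2 * l + t * 4 by ring]

end CdSystem

end EllipticPainleve

end

noncomputable section

namespace EllipticPainleve

open Filter Topology

/-! ### Dense sets of points over generic parameters -/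

/-- On the complex line from q₀ to a point where F is nonzero, the zeros of F are isolated. -/
theorem dense_ne_zero {E : Type*} [NormedAddCommGroup E] [NormedSpace ℂ E] {F : E → ℂ}
    (hF : Differentiable ℂ F) (h : ∃ q, F q ≠ 0) : Dense {q | F q ≠ 0} := by
  intro q₀
  obtain ⟨q₁, h1⟩ := h
  have hline : Differentiable ℂ (fun z : ℂ => F (q₀ + z • (q₁ - q₀))) := hF.comp (by fun_prop)
  have hev := eventually_ne_zero_of_entire hline ⟨1, by simpa using h1⟩ 0
  have ht : Tendsto (fun z : ℂ => q₀ + z • (q₁ - q₀)) (𝓝[≠] 0) (𝓝 q₀) := by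
    have : ContinuousAt (fun z : ℂ => q₀ + z • (q₁ - q₀)) 0 := by fun_prop
    have h2 := this.tendsto
    simp only [zero_smul, add_zero] at h2
    exact h2.mono_left nhdsWithin_le_nhds
  exact mem_closure_of_tendsto ht hev

theorem isOpen_ne_zero {E : Type*} [TopologicalSpace E] {F : E → ℂ} (hF : Continuous F) :
    IsOpen {q | F q ≠ 0} := isOpen_ne_fun hF continuous_const

/-- One line in parameter space suffices: move slightly along it, then adjust (x, y) within the
fibre. -/
theorem mem_closure_of_dense_fibres {A : Set State} {p : State} {d : Fin 8 → ℂ} {ε : ℂ}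
    (h : ∀ᶠ z in 𝓝[≠] (0 : ℂ),
      Dense {q : ℂ × ℂ | ((fun j => p.1 j + z * d j, p.2.1 + z * ε, q) : State) ∈ A}) :
    p ∈ closure A := by
  rw [mem_closure_iff_nhds]
  intro U hU
  obtain ⟨V, hVU, hV, hpV⟩ := mem_nhds_iff.1 hU
  have hcont : Continuous (fun z : ℂ =>
      ((fun j => p.1 j + z * d j, p.2.1 + z * ε, p.2.2) : State)) := by fun_prop
  have hz : ∀ᶠ z in 𝓝[≠] (0 : ℂ),
      ((fun j => p.1 j + z * d j, p.2.1 + z * ε, p.2.2) : State) ∈ V := by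
    refine Eventually.filter_mono nhdsWithin_le_nhds ?_
    refine hcont.continuousAt.eventually_mem (hV.mem_nhds ?_)
    simpa using hpV
  obtain ⟨z, h1, h2⟩ := (h.and hz).exists
  have hq : Continuous (fun q : ℂ × ℂ =>
      ((fun j => p.1 j + z * d j, p.2.1 + z * ε, q) : State)) := by fun_prop
  obtain ⟨q, hqV, hqA⟩ := h1.inter_open_nonempty _ (hV.preimage hq) ⟨p.2.2, h2⟩
  exact ⟨_, hVU hqV, hqA⟩

/-- The conditions on the parameters under which `s₂` is birational in `(x, y)`. -/
def S₂ParamReg (τ c₁ c₂ η : ℂ) : Prop :=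
  CdQuotReg τ (η - c₂) (η - c₁) η ∧ CdQuotReg τ (η + c₁) (η + c₂) η ∧
  CdQuotReg τ (2 * η - (c₁ - c₂) / 2) (2 * η + (c₁ - c₂) / 2) ((c₁ + c₂) / 2) ∧
  cd τ (2 * η - (c₁ - c₂) / 2) ≠ cd τ (2 * η + (c₁ - c₂) / 2) ∧
  cd τ (η + c₁) ≠ cd τ (η + c₂) ∧ cd τ (η - c₁) ≠ cd τ (η - c₂)

theorem dense_s₂Reg {τ c₁ c₂ η : ℂ} (h : S₂ParamReg τ c₁ c₂ η) :
    Dense {q : ℂ × ℂ | S₂Reg τ c₁ c₂ η q.1 q.2} := by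
  obtain ⟨h1, h2, h3, h4, h5, h6⟩ := h
  unfold S₂Reg s₂Num s₂Den
  generalize s₂Const τ c₁ c₂ η = K at *
  generalize cd τ (η + c₁) = p₁ at *
  generalize cd τ (η + c₂) = p₂ at *
  generalize cd τ (η - c₁) = m₁ at *
  generalize cd τ (η - c₂) = m₂ at *
  have d1 : Differentiable ℂ (fun q : ℂ × ℂ => q.1 - p₂) := by fun_prop
  have d2 : Differentiable ℂ (fun q : ℂ × ℂ => q.2 - m₁) := by fun_prop
  have d3 : Differentiable ℂ (fun q : ℂ × ℂ => (q.1 - p₁) * (q.2 - m₂)) := by fun_prop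
  have d4 : Differentiable ℂ (fun q : ℂ × ℂ =>
    (q.1 - p₁) * (q.2 - m₂) - K * (q.1 - p₂) * (q.2 - m₁)) := by fun_prop
  have D1 := dense_ne_zero d1 ⟨(p₂ + 1, 0), by simp⟩
  have D2 := dense_ne_zero d2 ⟨(0, m₁ + 1), by simp⟩
  have D3 := dense_ne_zero d3 ⟨(p₁ + 1, m₂ + 1), by simp⟩
  -- At x = p₂ the K-term disappears and p₂ − p₁ remains.
  have D4 := dense_ne_zero d4 ⟨(p₂, m₂ + 1), by simpa [sub_eq_zero] using h5.symm⟩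
  refine (((D1.inter_of_isOpen_right D2 (isOpen_ne_zero d2.continuous)).inter_of_isOpen_right D3
    (isOpen_ne_zero d3.continuous)).inter_of_isOpen_right D4
    (isOpen_ne_zero d4.continuous)).mono ?_
  rintro q ⟨⟨⟨a1, a2⟩, a3⟩, a4⟩
  exact ⟨h1, h2, h3, a1, a2, h4, a3, a4⟩

namespace CdSystem

variable {τ : ℂ} {f g σ : ℂ → ℂ}

theorem s₂Const_ne_zero (S : CdSystem τ f g σ) {c₁ c₂ η : ℂ}
    (h1 : CdQuotReg τ (η - c₂) (η - c₁) η) (h2 : CdQuotReg τ (η + c₁) (η + c₂) η)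
    (h3 : CdQuotReg τ (2 * η - (c₁ - c₂) / 2) (2 * η + (c₁ - c₂) / 2) ((c₁ + c₂) / 2)) :
    s₂Const τ c₁ c₂ η ≠ 0 := by
  rw [S.s₂Const_eq h1 h2 h3]
  obtain ⟨g1, g2, -⟩ := S.cdQuotReg_iff.1 h1
  obtain ⟨g3, g4, -⟩ := S.cdQuotReg_iff.1 h2
  obtain ⟨g5, g6, -⟩ := S.cdQuotReg_iff.1 h3
  exact div_ne_zero (mul_ne_zero (mul_ne_zero g2 g4) g6) (mul_ne_zero (mul_ne_zero g1 g3) g5)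

/-- The inverse of `s₂` in `y`. -/
def _root_.EllipticPainleve.s₂Inv (τ c₁ c₂ η x Y : ℂ) : ℂ :=
  ((Y - cd τ (2 * η - (c₁ - c₂) / 2)) * (x - cd τ (η + c₁)) * cd τ (η - c₂) -
    s₂Const τ c₁ c₂ η * (Y - cd τ (2 * η + (c₁ - c₂) / 2)) * (x - cd τ (η + c₂)) *
      cd τ (η - c₁)) /
  ((Y - cd τ (2 * η - (c₁ - c₂) / 2)) * (x - cd τ (η + c₁)) -
    s₂Const τ c₁ c₂ η * (Y - cd τ (2 * η + (c₁ - c₂) / 2)) * (x - cd τ (η + c₂)))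

theorem isOpen_s₂Reg (S : CdSystem τ f g σ) (c₁ c₂ η : ℂ) :
    IsOpen {q : ℂ × ℂ | S₂Reg τ c₁ c₂ η q.1 q.2} := by
  rw [isOpen_iff_mem_nhds]
  intro q hq
  exact (S.s₂Reg_continuity (c₁ := fun _ : ℂ × ℂ => c₁) (c₂ := fun _ => c₂) (η := fun _ => η)
    (x := fun q => q.1) (y := fun q => q.2) continuousAt_const continuousAt_const
    continuousAt_const continuousAt_fst continuousAt_snd hq).1

/-- D is only dense, not open, so an inverse is needed: `s₂Inv` is continuous near the image of a
regular point and carries nearby points of D back into U. -/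
theorem dense_preimage_s₂ (S : CdSystem τ f g σ) {c₁ c₂ η : ℂ} (h : S₂ParamReg τ c₁ c₂ η)
    {D : Set (ℂ × ℂ)} (hD : Dense D) :
    Dense {q : ℂ × ℂ | S₂Reg τ c₁ c₂ η q.1 q.2 ∧ (q.1, s₂Y τ c₁ c₂ η q.1 q.2) ∈ D} := by
  have hR := dense_s₂Reg h
  have hO := S.isOpen_s₂Reg c₁ c₂ η
  rw [dense_iff_inter_open]
  intro U hU hUne
  obtain ⟨⟨x₀, y₀⟩, hq₀U, hq₀R⟩ := hR.inter_open_nonempty U hU hUne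
  obtain ⟨h1, h2, h3, h4, h5, h6⟩ := h
  have hK := S.s₂Const_ne_zero h1 h2 h3
  have hrel := (s₂Relation_iff τ c₁ c₂ η x₀ y₀ _ hq₀R).2 rfl
  set Y₀ := s₂Y τ c₁ c₂ η x₀ y₀ with hY₀
  obtain ⟨hYB, hrel⟩ := hrel
  obtain ⟨-, -, -, hx, hy, -, hDen, -⟩ := id hq₀R
  have hx1 : x₀ - cd τ (η + c₁) ≠ 0 := left_ne_zero_of_mul hDen
  have hy2 : y₀ - cd τ (η - c₂) ≠ 0 := right_ne_zero_of_mul hDen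
  have hpoly : (Y₀ - cd τ (2 * η - (c₁ - c₂) / 2)) * (x₀ - cd τ (η + c₁)) *
      (y₀ - cd τ (η - c₂)) =
      s₂Const τ c₁ c₂ η * (Y₀ - cd τ (2 * η + (c₁ - c₂) / 2)) * (x₀ - cd τ (η + c₂)) *
        (y₀ - cd τ (η - c₁)) := by
    unfold S₂Relation linQuot at hrel
    rw [← mul_div_mul_comm, ← mul_div_mul_comm, div_eq_iff (mul_ne_zero (mul_ne_zero hYB hx) hy)] at hrel
    linear_combination hrel
  -- If this denominator vanished, the relation would force cd(η−c₁) = cd(η−c₂), because the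
  -- constant, Y₀−cd(…) and x₀−cd(η+c₂) are nonzero.
  have hnd : (Y₀ - cd τ (2 * η - (c₁ - c₂) / 2)) * (x₀ - cd τ (η + c₁)) -
      s₂Const τ c₁ c₂ η * (Y₀ - cd τ (2 * η + (c₁ - c₂) / 2)) * (x₀ - cd τ (η + c₂)) ≠ 0 := by
    intro h0
    have : s₂Const τ c₁ c₂ η * (Y₀ - cd τ (2 * η + (c₁ - c₂) / 2)) * (x₀ - cd τ (η + c₂)) *
        (cd τ (η - c₁) - cd τ (η - c₂)) = 0 := by
      linear_combination hpoly - (y₀ - cd τ (η - c₂)) * h0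
    exact mul_ne_zero (mul_ne_zero (mul_ne_zero hK hYB) hx) (sub_ne_zero.2 h6) this
  have hinv : s₂Inv τ c₁ c₂ η x₀ Y₀ = y₀ := by
    rw [s₂Inv, div_eq_iff hnd]
    linear_combination -hpoly
  let φ : ℂ × ℂ → ℂ × ℂ := fun q => (q.1, s₂Inv τ c₁ c₂ η q.1 q.2)
  have hφ : ContinuousAt φ (x₀, Y₀) := by
    refine continuousAt_fst.prodMk ?_
    unfold s₂Inv
    exact ContinuousAt.div (by fun_prop) (by fun_prop) hnd
  have hφ0 : φ (x₀, Y₀) = (x₀, y₀) := Prod.ext rfl hinv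
  have e1 : ∀ᶠ q in 𝓝 (x₀, Y₀), φ q ∈ U ∩ {q : ℂ × ℂ | S₂Reg τ c₁ c₂ η q.1 q.2} := by
    refine hφ.eventually_mem ((hU.inter hO).mem_nhds ?_)
    rw [hφ0]
    exact ⟨hq₀U, hq₀R⟩
  have e2 : ∀ᶠ q : ℂ × ℂ in 𝓝 (x₀, Y₀), q.2 - cd τ (2 * η + (c₁ - c₂) / 2) ≠ 0 :=
    ContinuousAt.eventually_ne (by fun_prop) hYB
  have e3 : ∀ᶠ q : ℂ × ℂ in 𝓝 (x₀, Y₀),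
      (q.2 - cd τ (2 * η - (c₁ - c₂) / 2)) * (q.1 - cd τ (η + c₁)) -
      s₂Const τ c₁ c₂ η * (q.2 - cd τ (2 * η + (c₁ - c₂) / 2)) * (q.1 - cd τ (η + c₂)) ≠ 0 :=
    ContinuousAt.eventually_ne (by fun_prop) hnd
  obtain ⟨⟨x, Y⟩, hqD, ⟨a1, a1'⟩, a2, a3⟩ :=
    (mem_closure_iff_frequently.1 (hD (x₀, Y₀))).and_eventually (e1.and (e2.and e3)) |>.exists
  refine ⟨φ (x, Y), a1, a1', ?_⟩
  have hYeq : Y = s₂Y τ c₁ c₂ η x (s₂Inv τ c₁ c₂ η x Y) := by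
    refine (s₂Relation_iff τ c₁ c₂ η x _ Y a1').1 ⟨a2, ?_⟩
    obtain ⟨-, -, -, hx, hy, -, -, -⟩ := a1'
    change s₂Inv τ c₁ c₂ η x Y - _ ≠ 0 at hy
    unfold S₂Relation linQuot
    change x - _ ≠ 0 at hx
    dsimp only at a2 a3
    rw [← mul_div_mul_comm, ← mul_div_mul_comm, div_eq_iff (mul_ne_zero (mul_ne_zero a2 hx) hy)]
    have := div_mul_cancel₀ ((Y - cd τ (2 * η - (c₁ - c₂) / 2)) * (x - cd τ (η + c₁)) *
      cd τ (η - c₂) - s₂Const τ c₁ c₂ η * (Y - cd τ (2 * η + (c₁ - c₂) / 2)) *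
      (x - cd τ (η + c₂)) * cd τ (η - c₁)) a3
    change s₂Inv τ c₁ c₂ η x Y * _ = _ at this
    linear_combination this
  change (x, s₂Y τ c₁ c₂ η x (s₂Inv τ c₁ c₂ η x Y)) ∈ D
  rw [← hYeq]
  exact hqD

end CdSystem

end EllipticPainleve

end

/-! ### Density of the domain of the first equation over generic parameters. -/

noncomputable section

namespace EllipticPainleve

open Filter Topology

/-- The conditions on the parameters under which `R` is birational in `(x, y)`. -/
def StageParamReg (τ : ℂ) (c : Fin 8 → ℂ) (η : ℂ) : Prop :=
  S₂ParamReg τ (c 0) (c 1) η ∧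
  S₂ParamReg τ (c 2 + shift (c 0) (c 1) η) (c 3 + shift (c 0) (c 1) η)
    (η - shift (c 0) (c 1) η) ∧
  S₂ParamReg τ (c 4 + shift (c 0) (c 1) η + shift (c 2) (c 3) η)
    (c 5 + shift (c 0) (c 1) η + shift (c 2) (c 3) η)
    (η - shift (c 0) (c 1) η - shift (c 2) (c 3) η) ∧
  S₂ParamReg τ (c 6 + shift (c 0) (c 1) η + shift (c 2) (c 3) η + shift (c 4) (c 5) η)
    (c 7 + shift (c 0) (c 1) η + shift (c 2) (c 3) η + shift (c 4) (c 5) η)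
    (η - shift (c 0) (c 1) η - shift (c 2) (c 3) η - shift (c 4) (c 5) η)

/-- The conditions on the parameters under which the first equation is meaningful at generic
`(x, y)`. -/
def FirstParamReg (τ : ℂ) (σ : ℂ → ℂ) (c₁ c₂ c₃ c₄ c₅ c₆ c₇ c₈ η l : ℂ) : Prop :=
  CdReg τ (η + c₇) ∧ CdReg τ (η + c₈) ∧
  CdQuotReg τ (η - c₈ + l) (η - c₇ + l) (3 * η + c₆ + l) ∧
  CdQuotReg τ (2 * η + (c₇ - c₈) / 2 + l) (2 * η - (c₇ - c₈) / 2 + l) (c₆ + (c₇ + c₈) / 2 - l) ∧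
  CdQuotReg τ (2 * η - (c₇ - c₈) / 2 + l) (2 * η + (c₇ - c₈) / 2 + l)
    (2 * η + c₆ - (c₇ + c₈) / 2 + l) ∧
  CdQuotReg τ (η + c₈ + (c₁ + c₂ + c₃ + c₄) / 2) (η + c₇ + (c₁ + c₂ + c₃ + c₄) / 2)
    (η + c₅ + (c₁ + c₂ + c₃ + c₄) / 2) ∧
  QReg τ c₅ c₆ c₃ c₇ (c₁ + c₂ + c₃ + c₄) η ∧ QReg τ c₅ c₆ c₄ c₇ (c₁ + c₂ + c₃ + c₄) η ∧
  QReg τ c₅ c₆ c₃ c₈ (c₁ + c₂ + c₃ + c₄) η ∧ QReg τ c₅ c₆ c₄ c₈ (c₁ + c₂ + c₃ + c₄) η ∧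
  PReg τ c₁ c₂ c₄ η ∧ PReg τ c₁ c₂ c₃ η ∧ GReg τ c₁ c₂ c₃ c₄ η ∧
  σ (4 * η) ≠ 0 ∧ σ (c₂ - c₁) ≠ 0 ∧ σ (c₂ - c₄) ≠ 0 ∧ σ (c₄ - c₁) ≠ 0 ∧ σ (c₃ - c₄) ≠ 0 ∧
  σ (c₁ + c₂ - 2 * η) ≠ 0 ∧ σ (c₁ + c₂ + c₃ + c₄) ≠ 0 ∧ σ (c₆ - c₅) ≠ 0 ∧ σ (c₈ - c₆) ≠ 0 ∧
  σ (c₅ - c₈) ≠ 0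

/-- The points where `R` is defined and the first equation is meaningful. -/
def FirstDomain (τ : ℂ) (c : Fin 8 → ℂ) (η x y : ℂ) : Prop :=
  StageReg τ c η x y ∧
  MSYFirstReg τ (c 0) (c 1) (c 2) (c 3) (c 4) (c 5) (c 6) (c 7) η ((∑ j, c j) / 2) x y
    (stageY₄ τ c η x y)

namespace CdSystem

variable {τ : ℂ} {f g σ : ℂ → ℂ}

theorem dense_preimage_stage (S : CdSystem τ f g σ) {c : Fin 8 → ℂ} {η : ℂ}
    (h : StageParamReg τ c η) {D : Set (ℂ × ℂ)} (hD : Dense D) :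
    Dense {q : ℂ × ℂ | StageReg τ c η q.1 q.2 ∧ (q.1, stageY₄ τ c η q.1 q.2) ∈ D} := by
  obtain ⟨h1, h2, h3, h4⟩ := h
  refine (S.dense_preimage_s₂ h1 (S.dense_preimage_s₂ h2 (S.dense_preimage_s₂ h3
    (S.dense_preimage_s₂ h4 hD)))).mono ?_
  rintro q ⟨a1, a2, a3, a4, a5⟩
  exact ⟨⟨a1, a2, a3, a4⟩, a5⟩

theorem differentiable_pForm (τ a₁ a₂ a₃ b : ℂ) :
    Differentiable ℂ (fun q : ℂ × ℂ => pP τ a₁ a₂ a₃ b q.1 q.2) := by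
  unfold pP
  fun_prop

theorem pForm_homogeneous (τ a₁ a₂ a₃ b X F E : ℂ) (hE : E ≠ 0) :
    pForm τ a₁ a₂ a₃ b X F E = E * pP τ a₁ a₂ a₃ b X (F / E) := by
  rw [← pForm_one, pForm, pForm]
  field_simp

theorem mixForm_homogeneous (τ d₁ d₂ d₃ d₄ d₅ d₆ w s b X F E : ℂ) (hE : E ≠ 0) :
    mixForm τ d₁ d₂ d₃ d₄ d₅ d₆ w s b X F E =
      E * mixForm τ d₁ d₂ d₃ d₄ d₅ d₆ w s b X (F / E) 1 := by
  rw [mixForm, mixForm, pForm_homogeneous _ _ _ _ _ _ _ _ hE,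
    pForm_homogeneous _ _ _ _ _ _ _ _ hE, pForm_one, pForm_one]
  ring

theorem differentiable_mixForm (τ d₁ d₂ d₃ d₄ d₅ d₆ w s b : ℂ) :
    Differentiable ℂ (fun q : ℂ × ℂ => mixForm τ d₁ d₂ d₃ d₄ d₅ d₆ w s b q.1 q.2 1) := by
  simp only [mixForm, pForm_one]
  have h1 := differentiable_pForm τ d₁ d₂ d₃ b
  have h2 := differentiable_pForm τ d₁ d₂ d₄ b
  unfold qQ
  fun_prop

/-- `F (a + u) ≠ 0` for all `u` near `0`, except possibly `0`. -/
theorem eventually_add_ne_zero {F : ℂ → ℂ} (hF : Differentiable ℂ F) (h0 : ∃ u, F u ≠ 0)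
    (a : ℂ) : ∀ᶠ u in 𝓝[≠] (0 : ℂ), F (u + a) ≠ 0 := by
  have h := eventually_comp_line_ne_zero hF h0 a one_ne_zero
  filter_upwards [h] with u hu
  rwa [show u + a = a + u * 1 by ring]

/-- The factorization along the curve gives an explicit nonzero value at any u away from isolated
zeros; the same method is used for `mixForm`. -/
theorem exists_pP_ne_zero (S : CdSystem τ f g σ) {a₁ a₂ a₃ b : ℂ} (h : PReg τ a₁ a₂ a₃ b)
    (h4 : σ (4 * b) ≠ 0) (h21 : σ (a₂ - a₁) ≠ 0) (h31 : σ (a₃ - a₁) ≠ 0)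
    (h23 : σ (a₂ - a₃) ≠ 0) : ∃ q : ℂ × ℂ, pP τ a₁ a₂ a₃ b q.1 q.2 ≠ 0 := by
  have n := fun a => eventually_add_ne_zero S.σ_diff S.σ_ne a
  have m := eventually_comp_line_ne_zero S.g_diff S.g_ne (2 * b) (b := -1) (by norm_num)
  obtain ⟨u, n1, n2, n3, n4, n5, n6⟩ := ((n (-(b + a₁))).and ((n (-(b + a₂))).and
    ((n (-(b + a₃))).and ((n (-b + a₁ + a₂ + a₃)).and
    ((eventually_add_ne_zero S.g_diff S.g_ne 0).and m))))).exists
  rw [add_zero] at n5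
  rw [show 2 * b + u * -1 = 2 * b - u by ring] at n6
  have key := S.pForm_curve (X := f u / g u) h n5 (div_mul_cancel₀ _ n5)
  rw [pForm_homogeneous _ _ _ _ _ _ _ _ n6] at key
  refine ⟨(f u / g u, f (2 * b - u) / g (2 * b - u)), ?_⟩
  obtain ⟨p1, p2, p3, m1, m2, m3⟩ := h
  rw [S.reg_iff] at p1 p2 p3 m1 m2 m3
  refine right_ne_zero_of_mul (a := g (2 * b - u)) ?_
  rw [key]
  rw [← sub_eq_add_neg] at n1 n2 n3
  rw [show u + (-b + a₁ + a₂ + a₃) = u - b + a₁ + a₂ + a₃ by ring] at n4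
  refine div_ne_zero ?_ (by simp [*])
  simp only [ne_eq, mul_eq_zero, not_or]
  exact ⟨⟨⟨⟨h4, h21⟩, h31⟩, h23⟩, ⟨⟨⟨n1, n2⟩, n3⟩, n4⟩⟩

theorem exists_mixForm_ne_zero (S : CdSystem τ f g σ) {d₁ d₂ d₃ d₄ d₅ d₆ w s b : ℂ}
    (hs : s = d₁ + d₂ + d₃ + d₄)
    (h3 : QReg τ d₅ d₆ d₃ w s b) (h4 : QReg τ d₅ d₆ d₄ w s b)
    (hP4 : PReg τ d₁ d₂ d₄ b) (hP3 : PReg τ d₁ d₂ d₃ b) (hG : GReg τ d₁ d₂ d₃ d₄ b)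
    (k1 : σ (4 * b) ≠ 0) (k2 : σ (d₂ - d₁) ≠ 0) (k3 : σ (d₂ - d₄) ≠ 0) (k4 : σ (d₄ - d₁) ≠ 0)
    (k5 : σ (d₃ - d₄) ≠ 0) (k6 : σ (d₁ + d₂ - 2 * b) ≠ 0) (k7 : σ s ≠ 0) (k8 : σ (d₆ - d₅) ≠ 0)
    (k9 : σ (w - d₆) ≠ 0) (k10 : σ (d₅ - w) ≠ 0) :
    ∃ q : ℂ × ℂ, mixForm τ d₁ d₂ d₃ d₄ d₅ d₆ w s b q.1 q.2 1 ≠ 0 := by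
  have n := fun a => eventually_add_ne_zero S.σ_diff S.σ_ne a
  have m := eventually_comp_line_ne_zero S.g_diff S.g_ne (2 * b) (b := -1) (by norm_num)
  obtain ⟨u, n1, n2, n3, n4, n5, n6, n7, n8, n9, n10⟩ := ((n (-(b + d₁))).and
    ((n (-(b + d₂))).and ((n (-(b + d₃))).and ((n (-(b + d₄))).and ((n (-(b + d₅))).and
    ((n (-(b + d₆))).and ((n (-(b + w))).and ((n (3 * b + d₅ + d₆ + w + s)).and
    ((eventually_add_ne_zero S.g_diff S.g_ne 0).and m))))))))).exists
  rw [add_zero] at n9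
  rw [show 2 * b + u * -1 = 2 * b - u by ring] at n10
  rw [← sub_eq_add_neg] at n1 n2 n3 n4 n5 n6 n7
  have key := S.mixForm_curve (X := f u / g u) hs h3 h4 hP4 hP3 hG n9 (div_mul_cancel₀ _ n9)
  rw [mixForm_homogeneous _ _ _ _ _ _ _ _ _ _ _ _ _ n10] at key
  refine ⟨(f u / g u, f (2 * b - u) / g (2 * b - u)), ?_⟩
  refine right_ne_zero_of_mul (a := g (2 * b - u)) ?_
  rw [key, mixConst, mixFactor]
  obtain ⟨p1, p2, p3, m1, m2, m3⟩ := hP3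
  obtain ⟨-, -, p4, -, -, m4⟩ := hP4
  obtain ⟨q1, q2, q3, q4, q5, q6, q7⟩ := h4
  simp only [S.reg_iff] at p1 p2 p3 p4 m1 m2 m3 m4 q1 q2 q3 q4 q5 q6 q7
  simp only [ne_eq, mul_eq_zero, div_eq_zero_iff, pow_eq_zero_iff two_ne_zero, not_or]
  clear hs key h3 hG n m
  simp only [*, not_false_eq_true, and_self]

/-- Over generic parameters, generic points lie in the domain of the first equation, and their
images under `R` in any given dense set. -/
theorem dense_firstDomain (S : CdSystem τ f g σ) {c : Fin 8 → ℂ} {η : ℂ}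
    (h : StageParamReg τ c η)
    (h' : FirstParamReg τ σ (c 0) (c 1) (c 2) (c 3) (c 4) (c 5) (c 6) (c 7) η ((∑ j, c j) / 2))
    {D : Set (ℂ × ℂ)} (hD : Dense D) :
    Dense {q : ℂ × ℂ | FirstDomain τ c η q.1 q.2 ∧ (q.1, stageY₄ τ c η q.1 q.2) ∈ D} := by
  unfold FirstDomain MSYFirstReg
  generalize (∑ j, c j) / 2 = l at *
  -- This condition concerns the image ȳ, not y. It is therefore added to the target set D and
  -- pulled back together with it.
  have d0 : Differentiable ℂ (fun q : ℂ × ℂ => q.2 - cd τ (η - c 6 + l)) := by fun_prop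
  have D0 := dense_ne_zero d0 ⟨(0, cd τ (η - c 6 + l) + 1), by simp⟩
  have hstage := S.dense_preimage_stage h
    (hD.inter_of_isOpen_right D0 (isOpen_ne_zero d0.continuous))
  generalize c 0 = c₁ at *
  generalize c 1 = c₂ at *
  generalize c 2 = c₃ at *
  generalize c 3 = c₄ at *
  generalize c 4 = c₅ at *
  generalize c 5 = c₆ at *
  generalize c 6 = c₇ at *
  generalize c 7 = c₈ at *
  obtain ⟨r7, r8, q1, q2, q3, q4, Q37, Q47, Q38, Q48, P4, P3, hG, k1, k2, k3, k4, k5, k6, k7, k8,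
    k9, k10⟩ := h'
  obtain ⟨g1, g2, g3, g4, g5, g6, eG⟩ := S.gG_eq hG
  have hG0 : gG τ c₁ c₂ c₃ c₄ η ≠ 0 := by
    rw [eG]
    refine div_ne_zero ?_ ?_
    · exact mul_ne_zero (mul_ne_zero (mul_ne_zero k3 k4) g1) g3
    · exact mul_ne_zero (mul_ne_zero (mul_ne_zero g5 g6) g2) g4
  have d1 : Differentiable ℂ (fun q : ℂ × ℂ => q.1 - cd τ (η + c₈)) := by fun_prop
  have d2 : Differentiable ℂ (fun q : ℂ × ℂ => q.1 - cd τ (η + c₄)) := by fun_prop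
  have d3 := differentiable_pForm τ c₁ c₂ c₄ η
  have d4 := differentiable_pForm τ c₁ c₂ c₃ η
  have d5 := differentiable_mixForm τ c₁ c₂ c₃ c₄ c₅ c₆ c₈ (c₁ + c₂ + c₃ + c₄) η
  have D1 := dense_ne_zero d1 ⟨(cd τ (η + c₈) + 1, 0), by simp⟩
  have D2 := dense_ne_zero d2 ⟨(cd τ (η + c₄) + 1, 0), by simp⟩
  have D3 := dense_ne_zero d3 (S.exists_pP_ne_zero P4 k1 k2 k4 k3)
  have D4 := dense_ne_zero d4 (S.exists_pP_ne_zero P3 k1 k2 g6 g5)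
  have D5 := dense_ne_zero d5
    (S.exists_mixForm_ne_zero rfl Q38 Q48 P4 P3 hG k1 k2 k3 k4 k5 k6 k7 k8 k9 k10)
  refine (((((hstage.inter_of_isOpen_right D1 (isOpen_ne_zero d1.continuous)).inter_of_isOpen_right
    D2 (isOpen_ne_zero d2.continuous)).inter_of_isOpen_right
    D3 (isOpen_ne_zero d3.continuous)).inter_of_isOpen_right
    D4 (isOpen_ne_zero d4.continuous)).inter_of_isOpen_right
    D5 (isOpen_ne_zero d5.continuous)).mono ?_
  rintro q ⟨⟨⟨⟨⟨⟨a1, a2, a3⟩, b1⟩, b2⟩, b3⟩, b4⟩, b5⟩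
  simp only [Set.mem_ofPred_eq] at b1 b2 b3 b4 b5 a3
  have hL : LinQuotReg τ q.1 (η + c₃) (η + c₄) := ⟨P3.2.2.1, P4.2.2.1, b2⟩
  refine ⟨⟨a1, ⟨q1.1, q1.2.1, a3⟩, ⟨r7, r8, b1⟩, q1, q2, q3, q4,
    ⟨Q37, Q47, P4, P3, hG, b3, b4, hG0, hL⟩, ⟨Q38, Q48, P4, P3, hG, b3, b4, hG0, hL⟩, ?_⟩, a2⟩
  rw [mixN_eq b3 b4 hG0 b2]
  exact div_ne_zero b5 (mul_ne_zero (mul_ne_zero (mul_ne_zero hG0 b2) b4) b3)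

end CdSystem

end EllipticPainleve

end

/-! ### A generic line of parameters. -/

noncomputable section

namespace EllipticPainleve

open Filter Topology

/-- The increment of `u` from `0` to `1`; the slope of `u` if `u` is affine. -/
def lineSlope (u : ℂ → ℂ) : ℂ := u 1 - u 0

namespace CdSystem

variable {τ : ℂ} {f g σ : ℂ → ℂ}

theorem eventually_comp_affine_ne_zero {F : ℂ → ℂ} (hF : Differentiable ℂ F)
    (h0 : ∃ u, F u ≠ 0) {u : ℂ → ℂ} (hu : ∀ z, u z = u 0 + z * lineSlope u) (h : lineSlope u ≠ 0) :
    ∀ᶠ z in 𝓝[≠] (0 : ℂ), F (u z) ≠ 0 := by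
  filter_upwards [eventually_comp_line_ne_zero hF h0 (u 0) h] with z hz
  rwa [hu]

theorem eventually_σ (S : CdSystem τ f g σ) {u : ℂ → ℂ}
    (hu : ∀ z, u z = u 0 + z * lineSlope u) (h : lineSlope u ≠ 0) :
    ∀ᶠ z in 𝓝[≠] (0 : ℂ), σ (u z) ≠ 0 := eventually_comp_affine_ne_zero S.σ_diff S.σ_ne hu h

theorem eventually_cdReg (S : CdSystem τ f g σ) {u : ℂ → ℂ}
    (hu : ∀ z, u z = u 0 + z * lineSlope u) (h : lineSlope u ≠ 0) :
    ∀ᶠ z in 𝓝[≠] (0 : ℂ), CdReg τ (u z) := by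
  simp only [S.reg_iff]
  exact eventually_comp_affine_ne_zero S.g_diff S.g_ne hu h

theorem eventually_σ_sub (S : CdSystem τ f g σ) {u v : ℂ → ℂ}
    (hu : ∀ z, u z = u 0 + z * lineSlope u) (hv : ∀ z, v z = v 0 + z * lineSlope v)
    (h : lineSlope u - lineSlope v ≠ 0) : ∀ᶠ z in 𝓝[≠] (0 : ℂ), σ (u z - v z) ≠ 0 := by
  have e : lineSlope (fun z => u z - v z) = lineSlope u - lineSlope v := by simp only [lineSlope]; ring
  refine S.eventually_σ (u := fun z => u z - v z) (fun z => ?_) (by rwa [e])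
  rw [e]
  linear_combination hu z - hv z

theorem eventually_σ_add (S : CdSystem τ f g σ) {u v : ℂ → ℂ}
    (hu : ∀ z, u z = u 0 + z * lineSlope u) (hv : ∀ z, v z = v 0 + z * lineSlope v)
    (h : lineSlope u + lineSlope v ≠ 0) : ∀ᶠ z in 𝓝[≠] (0 : ℂ), σ (u z + v z) ≠ 0 := by
  have e : lineSlope (fun z => u z + v z) = lineSlope u + lineSlope v := by simp only [lineSlope]; ring
  refine S.eventually_σ (u := fun z => u z + v z) (fun z => ?_) (by rwa [e])
  rw [e]
  linear_combination hu z + hv z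

theorem eventually_cdQuotReg (S : CdSystem τ f g σ) {u v w : ℂ → ℂ}
    (hu : ∀ z, u z = u 0 + z * lineSlope u) (hv : ∀ z, v z = v 0 + z * lineSlope v)
    (hw : ∀ z, w z = w 0 + z * lineSlope w) (h1 : lineSlope u ≠ 0) (h2 : lineSlope v ≠ 0)
    (h3 : lineSlope w ≠ 0) (h4 : lineSlope w - lineSlope v ≠ 0) (h5 : lineSlope w + lineSlope v ≠ 0) :
    ∀ᶠ z in 𝓝[≠] (0 : ℂ), CdQuotReg τ (u z) (v z) (w z) := by
  filter_upwards [eventually_comp_affine_ne_zero S.g_diff S.g_ne hu h1,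
    eventually_comp_affine_ne_zero S.g_diff S.g_ne hv h2,
    eventually_comp_affine_ne_zero S.g_diff S.g_ne hw h3,
    eventually_comp_affine_ne_zero S.f_diff S.f_ne hw h3,
    S.eventually_σ_sub hw hv h4, S.eventually_σ_add hw hv h5] with z a1 a2 a3 a4 a5 a6
  exact S.cdQuotReg_iff.mpr ⟨a1, a2, a3, a4, a5, a6⟩

theorem eventually_cd_ne (S : CdSystem τ f g σ) {u v : ℂ → ℂ}
    (hu : ∀ z, u z = u 0 + z * lineSlope u) (hv : ∀ z, v z = v 0 + z * lineSlope v)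
    (h1 : lineSlope u ≠ 0) (h2 : lineSlope v ≠ 0)
    (h3 : lineSlope u - lineSlope v ≠ 0) (h4 : lineSlope u + lineSlope v ≠ 0) :
    ∀ᶠ z in 𝓝[≠] (0 : ℂ), cd τ (u z) ≠ cd τ (v z) := by
  filter_upwards [S.eventually_cdReg hu h1, S.eventually_cdReg hv h2,
    S.eventually_σ_sub hu hv h3, S.eventually_σ_add hu hv h4] with z a1 a2 a3 a4
  rw [← sub_ne_zero, S.cd_sub_cd a1 a2]
  rw [S.reg_iff] at a1 a2
  exact div_ne_zero (mul_ne_zero a3 a4) (mul_ne_zero a1 a2)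

end CdSystem

/-- A generic direction in the special parameter subspace. -/
def genericDir : Fin 8 → ℂ := ![1, 20, 400, 8000, 152000, 159600, 159980, 159999]

theorem genericDir_apply : genericDir 0 = 1 ∧ genericDir 1 = 20 ∧ genericDir 2 = 400 ∧
    genericDir 3 = 8000 ∧ genericDir 4 = 152000 ∧ genericDir 5 = 159600 ∧
    genericDir 6 = 159980 ∧ genericDir 7 = 159999 := ⟨rfl, rfl, rfl, rfl, rfl, rfl, rfl, rfl⟩

/-- The first four entries are 20⁰, …, 20³ and the others are their complements to 20⁴ = 160000,
which is half the slope of λ. -/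
theorem genericDir_rev (j : Fin 8) : genericDir (Fin.rev j) = 160000 - genericDir j := by
  fin_cases j <;> norm_num [genericDir, Fin.rev]

theorem sum_genericDir : ∑ j, genericDir j = 640000 := by
  obtain ⟨e0, e1, e2, e3, e4, e5, e6, e7⟩ := genericDir_apply
  rw [sum_vec, e0, e1, e2, e3, e4, e5, e6, e7]
  norm_num

namespace CdSystem

variable {τ : ℂ} {f g σ : ℂ → ℂ}

/-- η has slope 20⁵ along the line at p, and 20⁵ + 20⁴ along its image under R. The powers of 20 act
like separate digits, and the resulting slopes are checked numerically to be nonzero. -/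
theorem eventually_stageParamReg (S : CdSystem τ f g σ) (a : Fin 8 → ℂ) (b : ℂ) {ε : ℂ}
    (hε : ε = 3200000 ∨ ε = 3360000) :
    ∀ᶠ z in 𝓝[≠] (0 : ℂ), StageParamReg τ (fun j => a j + z * genericDir j) (b + z * ε) := by
  obtain ⟨e0, e1, e2, e3, e4, e5, e6, e7⟩ := genericDir_apply
  simp only [StageParamReg, S₂ParamReg, shift, eventually_and, e0, e1, e2, e3, e4, e5, e6, e7]
  constructorm* _ ∧ _
  all_goals first
    | refine S.eventually_cdQuotReg ?_ ?_ ?_ ?_ ?_ ?_ ?_ ?_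
    | refine S.eventually_cd_ne ?_ ?_ ?_ ?_ ?_ ?_
  all_goals simp only [lineSlope]
  all_goals first
    | (intro z; ring)
    | (rcases hε with rfl | rfl <;> ring_nf <;> norm_num)

theorem eventually_firstParamReg (S : CdSystem τ f g σ) (a₁ a₂ a₃ a₄ a₅ a₆ a₇ a₈ b l : ℂ)
    {ε : ℂ} (hε : ε = 3200000 ∨ ε = 3360000) :
    ∀ᶠ z in 𝓝[≠] (0 : ℂ), FirstParamReg τ σ (a₁ + z * 1) (a₂ + z * 20) (a₃ + z * 400)
      (a₄ + z * 8000) (a₅ + z * 152000) (a₆ + z * 159600) (a₇ + z * 159980) (a₈ + z * 159999)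
      (b + z * ε) (l + z * 320000) := by
  simp only [FirstParamReg, QReg, PReg, GReg, eventually_and]
  constructorm* _ ∧ _
  all_goals first
    | refine S.eventually_cdReg ?_ ?_
    | refine S.eventually_cdQuotReg ?_ ?_ ?_ ?_ ?_ ?_ ?_ ?_
    | refine S.eventually_σ ?_ ?_
  all_goals simp only [lineSlope]
  all_goals first
    | (intro z; ring)
    | (rcases hε with rfl | rfl <;> ring_nf <;> norm_num)

end CdSystem

end EllipticPainleve

end

noncomputable section

namespace EllipticPainleve

open Filter Topology

/-! ### The action of `R` on the parameters -/

/-- The parameters `R(c)`. -/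
def reflC (c : Fin 8 → ℂ) : Fin 8 → ℂ := fun j => (∑ i, c i) / 2 / 2 - c (Fin.rev j)

theorem sum_reflC (c : Fin 8 → ℂ) : ∑ j, reflC c j = ∑ j, c j := by
  simp only [reflC, Finset.sum_sub_distrib, Finset.sum_const, Finset.card_univ, Fintype.card_fin,
    Equiv.sum_comp Fin.revPerm c |>.symm]
  simp only [Fin.revPerm_apply, nsmul_eq_mul]
  push_cast
  ring

theorem reflC_reflC (c : Fin 8 → ℂ) : reflC (reflC c) = c := by
  funext j
  rw [reflC, sum_reflC, reflC, Fin.rev_rev, sub_sub_cancel]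

theorem run_RJ2_eq (τ : ℂ) (p : State) :
    run τ RJ2 p = (reflC p.c, p.η + p.lam / 2, stageY₄ τ p.c p.η p.x p.y, p.x) :=
  run_RJ2 τ p.1 p.2.1 p.2.2.1 p.2.2.2

theorem wordReg_RJ2_iff' (τ : ℂ) (p : State) :
    WordReg τ RJ2 p ↔ StageReg τ p.c p.η p.x p.y :=
  wordReg_RJ2_iff τ p.1 p.2.1 p.2.2.1 p.2.2.2

theorem lam_run_RJ2 (τ : ℂ) (p : State) : (run τ RJ2 p).lam = p.lam := by
  rw [run_RJ2_eq, State.lam, State.c, sum_reflC, State.lam]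

theorem run_TJ2 (τ : ℂ) (p : State) :
    run τ TJ2 p = (p.c, p.η + p.lam, stageY₄ τ (reflC p.c) (p.η + p.lam / 2)
      (stageY₄ τ p.c p.η p.x p.y) p.x, stageY₄ τ p.c p.η p.x p.y) := by
  rw [TJ2, run_append, run_RJ2_eq τ (run τ RJ2 p), lam_run_RJ2, run_RJ2_eq]
  simp only [State.c, State.η, State.x, State.y, reflC_reflC]
  rw [add_assoc, add_halves]

theorem xBar_eq (τ : ℂ) (p : State) : xBar τ p = stageY₄ τ (reflC p.c) (p.η + p.lam / 2)
    (stageY₄ τ p.c p.η p.x p.y) p.x := by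
  rw [xBar, actWord_eq_run, run_TJ2, State.x]

theorem yBar_eq (τ : ℂ) (p : State) : yBar τ p = stageY₄ τ p.c p.η p.x p.y := by
  rw [yBar, actWord_eq_run, run_TJ2, State.y]

theorem xTilde_eq (τ : ℂ) (p : State) : xTilde τ p = stageY₄ τ p.c p.η p.x p.y := by
  rw [xTilde, actWord_eq_run, run_RJ2_eq, State.x]

theorem xTildeTilde_eq (τ : ℂ) (p : State) : xTildeTilde τ p = xBar τ p := by
  rw [xTildeTilde, actWord_eq_run, xTilde_eq, xBar_eq, run_RJ2_eq]
  rfl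

/-! ### The second equation as the first equation at the image under `R` -/

namespace CdSystem

variable {τ : ℂ} {f g σ : ℂ → ℂ}

theorem cdQuot_neg_right (S : CdSystem τ f g σ) (u v w : ℂ) :
    cdQuot τ u v (-w) = cdQuot τ u v w := by
  rw [cdQuot, cdQuot, S.cd_neg]

theorem cdQuotReg_neg_right (S : CdSystem τ f g σ) (u v w : ℂ) :
    CdQuotReg τ u v (-w) ↔ CdQuotReg τ u v w := by
  rw [CdQuotReg, CdQuotReg, S.cd_neg, S.cdReg_neg]

/-- The substitution c_j ↦ λ/2 − c_{9−j}, η ↦ η + λ/2 preserves λ and c₁+c₂+c₃+c₄. It matches all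
arguments except one normalizing point, which changes sign; evenness of cd takes care of that. -/
theorem msySecond_iff (S : CdSystem τ f g σ) {c₁ c₂ c₃ c₄ c₅ c₆ c₇ c₈ η l x X Y : ℂ}
    (hl : l = (c₁ + c₂ + c₃ + c₄ + c₅ + c₆ + c₇ + c₈) / 2) :
    (MSYSecond τ c₁ c₂ c₃ c₄ c₅ c₆ c₇ c₈ η l x X Y ↔
      MSYFirst τ (l / 2 - c₈) (l / 2 - c₇) (l / 2 - c₆) (l / 2 - c₅) (l / 2 - c₄) (l / 2 - c₃)
        (l / 2 - c₂) (l / 2 - c₁) (η + l / 2) l Y x X) ∧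
    (MSYSecondReg τ c₁ c₂ c₃ c₄ c₅ c₆ c₇ c₈ η l x X Y ↔
      MSYFirstReg τ (l / 2 - c₈) (l / 2 - c₇) (l / 2 - c₆) (l / 2 - c₅) (l / 2 - c₄) (l / 2 - c₃)
        (l / 2 - c₂) (l / 2 - c₁) (η + l / 2) l Y x X) := by
  rw [MSYSecond, MSYFirst, MSYSecondReg, MSYFirstReg,
    show l / 2 - c₈ + (l / 2 - c₇) + (l / 2 - c₆) + (l / 2 - c₅) = c₁ + c₂ + c₃ + c₄ by
      rw [hl]; ring,
    show η + l / 2 - (l / 2 - c₁) + l = η + c₁ + l by ring,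
    show η + l / 2 - (l / 2 - c₂) + l = η + c₂ + l by ring,
    show η + l / 2 + (l / 2 - c₂) = η - c₂ + l by ring,
    show η + l / 2 + (l / 2 - c₁) = η - c₁ + l by ring,
    show 3 * (η + l / 2) + (l / 2 - c₃) + l = 3 * η - c₃ + 3 * l by ring,
    show 2 * (η + l / 2) + (l / 2 - c₂ - (l / 2 - c₁)) / 2 + l =
      2 * η + (c₁ - c₂) / 2 + 2 * l by ring,
    show 2 * (η + l / 2) - (l / 2 - c₂ - (l / 2 - c₁)) / 2 + l =
      2 * η - (c₁ - c₂) / 2 + 2 * l by ring,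
    show l / 2 - c₃ + (l / 2 - c₂ + (l / 2 - c₁)) / 2 - l = -(c₃ + (c₁ + c₂) / 2) by ring,
    show 2 * (η + l / 2) + (l / 2 - c₃) - (l / 2 - c₂ + (l / 2 - c₁)) / 2 + l =
      2 * η - c₃ + (c₁ + c₂) / 2 + 2 * l by ring,
    show η - c₁ + l + (c₁ + c₂ + c₃ + c₄) / 2 = η - c₁ + (c₁ + c₂ + c₃ + c₄) / 2 + l by ring,
    show η - c₂ + l + (c₁ + c₂ + c₃ + c₄) / 2 = η - c₂ + (c₁ + c₂ + c₃ + c₄) / 2 + l by ring,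
    show η + l / 2 + (l / 2 - c₄) + (c₁ + c₂ + c₃ + c₄) / 2 =
      η - c₄ + (c₁ + c₂ + c₃ + c₄) / 2 + l by ring,
    S.cdQuot_neg_right, S.cdQuotReg_neg_right]
  exact ⟨Iff.rfl, Iff.rfl⟩

end CdSystem

theorem reduced_iff (τ c₁ c₂ c₃ c₄ η l x x₁ x₂ : ℂ) :
    Reduced τ c₁ c₂ c₃ c₄ η l x x₁ x₂ ↔ MSYSecond τ c₁ c₂ c₃ c₄ (l / 2 - c₄) (l / 2 - c₃)
      (l / 2 - c₂) (l / 2 - c₁) η l x x₂ x₁ := by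
  simp only [MSYSecond, sub_sub_cancel, Reduced]

theorem reducedReg_iff (τ c₁ c₂ c₃ c₄ η l x x₁ x₂ : ℂ) :
    ReducedReg τ c₁ c₂ c₃ c₄ η l x x₁ x₂ ↔ MSYSecondReg τ c₁ c₂ c₃ c₄ (l / 2 - c₄) (l / 2 - c₃)
      (l / 2 - c₂) (l / 2 - c₁) η l x x₂ x₁ := by
  simp only [MSYSecondReg, sub_sub_cancel, ReducedReg]

/-- The special parameters are the fixed points of R on the c's, which is why R itself yields a
scalar equation there. -/
theorem mem_specialSet_iff (p : State) : p ∈ SpecialSet ↔ reflC p.c = p.c := by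
  have e : (∑ i, p.c i) / 2 / 2 = p.lam / 2 := rfl
  constructor
  · rintro ⟨h4, h5, h6, h7⟩
    funext j
    rw [reflC, e]
    fin_cases j
    · exact sub_eq_of_eq_add' h7.symm
    · exact sub_eq_of_eq_add' h6.symm
    · exact sub_eq_of_eq_add' h5.symm
    · exact sub_eq_of_eq_add' h4.symm
    · exact sub_eq_of_eq_add h4.symm
    · exact sub_eq_of_eq_add h5.symm
    · exact sub_eq_of_eq_add h6.symm
    · exact sub_eq_of_eq_add h7.symm
  · intro h
    have k : ∀ j, p.c j + p.c (Fin.rev j) = p.lam / 2 := fun j => by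
      have := congrFun h j
      rw [reflC, e] at this
      linear_combination -this
    exact ⟨k 4, k 5, k 6, k 7⟩

/-! ### The domains of the equations -/

theorem mem_firstDomain_run {τ : ℂ} {f g σ : ℂ → ℂ} (S : CdSystem τ f g σ) (p : State) :
    (StageReg τ (reflC p.c) (p.η + p.lam / 2) (stageY₄ τ p.c p.η p.x p.y) p.x ∧
      MSYSecondReg τ (p.c 0) (p.c 1) (p.c 2) (p.c 3) (p.c 4) (p.c 5) (p.c 6) (p.c 7)
        p.η p.lam p.x (xBar τ p) (yBar τ p)) ↔
      FirstDomain τ (reflC p.c) (p.η + p.lam / 2) (stageY₄ τ p.c p.η p.x p.y) p.x := by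
  have hl : p.lam = (p.c 0 + p.c 1 + p.c 2 + p.c 3 + p.c 4 + p.c 5 + p.c 6 + p.c 7) / 2 := by
    rw [State.lam, sum_vec]
  rw [(S.msySecond_iff hl).2, FirstDomain, sum_reflC, xBar_eq, yBar_eq]
  exact Iff.rfl

theorem mem_msyDomain_iff {τ : ℂ} {f g σ : ℂ → ℂ} (S : CdSystem τ f g σ) (p : State) :
    p ∈ MSYDomain τ ↔ FirstDomain τ p.c p.η p.x p.y ∧
      FirstDomain τ (reflC p.c) (p.η + p.lam / 2) (stageY₄ τ p.c p.η p.x p.y) p.x := by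
  rw [← mem_firstDomain_run S, MSYDomain, Set.mem_ofPred_eq, TJ2, wordReg_append,
    wordReg_RJ2_iff', wordReg_RJ2_iff', run_RJ2_eq, FirstDomain, yBar_eq]
  simp only [State.c, State.η, State.x, State.y, State.lam]
  tauto

theorem mem_reducedDomain_iff {τ : ℂ} {f g σ : ℂ → ℂ} (S : CdSystem τ f g σ) (p : State) :
    p ∈ ReducedDomain τ ↔ (StageReg τ p.c p.η p.x p.y ∧
      FirstDomain τ (reflC p.c) (p.η + p.lam / 2) (stageY₄ τ p.c p.η p.x p.y) p.x) ∧
      p ∈ SpecialSet := by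
  rw [← mem_firstDomain_run S, ReducedDomain, Set.mem_ofPred_eq, wordReg_append,
    wordReg_RJ2_iff', wordReg_RJ2_iff', run_RJ2_eq, reducedReg_iff, xTildeTilde_eq,
    xTilde_eq, ← yBar_eq]
  have e : p ∈ SpecialSet → p.c 4 = p.lam / 2 - p.c 3 ∧ p.c 5 = p.lam / 2 - p.c 2 ∧
      p.c 6 = p.lam / 2 - p.c 1 ∧ p.c 7 = p.lam / 2 - p.c 0 := fun h =>
    ⟨eq_sub_of_add_eq h.1, eq_sub_of_add_eq h.2.1, eq_sub_of_add_eq h.2.2.1,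
      eq_sub_of_add_eq h.2.2.2⟩
  by_cases hp : p ∈ SpecialSet
  · obtain ⟨e4, e5, e6, e7⟩ := e hp
    rw [← e4, ← e5, ← e6, ← e7]
    simp only [hp, true_and, and_true, and_assoc]
    simp only [State.c, State.η, State.x, State.y]
  · simp only [hp, false_and, and_false]

namespace CdSystem

variable {τ : ℂ} {f g σ : ℂ → ℂ}

theorem firstDomain_eventually (S : CdSystem τ f g σ) {Z : Type*} [TopologicalSpace Z] {z : Z}
    {c : Z → Fin 8 → ℂ} {η x y : Z → ℂ} (hc : ContinuousAt c z) (he : ContinuousAt η z)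
    (hx : ContinuousAt x z) (hy : ContinuousAt y z) (h : FirstDomain τ (c z) (η z) (x z) (y z)) :
    ∀ᶠ t in 𝓝 z, FirstDomain τ (c t) (η t) (x t) (y t) := by
  obtain ⟨a1, a2⟩ := S.stage_continuity hc he hx hy h.1
  have hj : ∀ j, ContinuousAt (fun t => c t j) z := fun j => continuousAt_pi.mp hc j
  have hl : ContinuousAt (fun t => (∑ j, c t j) / 2) z :=
    (tendsto_finsetSum _ fun j _ => hj j).div_const 2
  exact a1.and (S.msyFirstReg_eventually (hj 0) (hj 1) (hj 2) (hj 3) (hj 4) (hj 5) (hj 6) (hj 7)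
    he hl hx hy a2 h.2)

theorem continuous_reflC : Continuous reflC := by
  unfold reflC
  fun_prop

theorem continuous_eta_lam : Continuous fun p : State => p.η + p.lam / 2 := by
  unfold State.lam State.η State.c
  fun_prop

theorem isOpen_run_firstDomain (S : CdSystem τ f g σ) :
    IsOpen {p : State | StageReg τ p.c p.η p.x p.y ∧
      FirstDomain τ (reflC p.c) (p.η + p.lam / 2) (stageY₄ τ p.c p.η p.x p.y) p.x} := by
  have hc : Continuous fun p : State => p.c := continuous_fst
  have he : Continuous fun p : State => p.η := continuous_fst.comp continuous_snd
  have hx : Continuous fun p : State => p.x := by unfold State.x; fun_prop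
  have hy : Continuous fun p : State => p.y := by unfold State.y; fun_prop
  rw [isOpen_iff_eventually]
  rintro p ⟨h1, h2⟩
  obtain ⟨a1, a2⟩ := S.stage_continuity hc.continuousAt he.continuousAt hx.continuousAt
    hy.continuousAt h1
  exact a1.and (S.firstDomain_eventually (continuous_reflC.comp hc).continuousAt
    continuous_eta_lam.continuousAt a2 hx.continuousAt h2)

theorem isOpen_firstDomain (S : CdSystem τ f g σ) :
    IsOpen {p : State | FirstDomain τ p.c p.η p.x p.y} := by
  have hc : Continuous fun p : State => p.c := continuous_fst
  have he : Continuous fun p : State => p.η := continuous_fst.comp continuous_snd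
  have hx : Continuous fun p : State => p.x := by unfold State.x; fun_prop
  have hy : Continuous fun p : State => p.y := by unfold State.y; fun_prop
  rw [isOpen_iff_eventually]
  exact fun p h => S.firstDomain_eventually hc.continuousAt he.continuousAt hx.continuousAt
    hy.continuousAt h

theorem isOpen_msyDomain (S : CdSystem τ f g σ) : IsOpen (MSYDomain τ) := by
  have e : MSYDomain τ = {p : State | FirstDomain τ p.c p.η p.x p.y} ∩
      {p : State | StageReg τ p.c p.η p.x p.y ∧
        FirstDomain τ (reflC p.c) (p.η + p.lam / 2) (stageY₄ τ p.c p.η p.x p.y) p.x} := by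
    ext p
    rw [mem_msyDomain_iff S]
    exact ⟨fun h => ⟨h.1, h.1.1, h.2⟩, fun h => ⟨h.1, h.2.2⟩⟩
  rw [e]
  exact S.isOpen_firstDomain.inter S.isOpen_run_firstDomain

/-- Stated for c and η given by equations, so that it also applies to the image line under R, which
has the required form only after rewriting. -/
theorem eventually_paramReg (S : CdSystem τ f g σ) (a : Fin 8 → ℂ) (b : ℂ) {ε : ℂ}
    (hε : ε = 3200000 ∨ ε = 3360000) :
    ∀ᶠ z in 𝓝[≠] (0 : ℂ), ∀ c : Fin 8 → ℂ, (c = fun j => a j + z * genericDir j) →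
      ∀ η, η = b + z * ε → StageParamReg τ c η ∧
      FirstParamReg τ σ (c 0) (c 1) (c 2) (c 3) (c 4) (c 5) (c 6) (c 7) η ((∑ j, c j) / 2) := by
  filter_upwards [S.eventually_stageParamReg a b hε,
    S.eventually_firstParamReg (a 0) (a 1) (a 2) (a 3) (a 4) (a 5) (a 6) (a 7) b
      ((∑ j, a j) / 2) hε] with z h1 h2
  rintro c rfl η rfl
  refine ⟨h1, ?_⟩
  have e : (∑ j, (a j + z * genericDir j)) / 2 = (∑ j, a j) / 2 + z * 320000 := by
    rw [Finset.sum_add_distrib, ← Finset.mul_sum, sum_genericDir]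
    ring
  rw [e]
  exact h2

/-- The direction is fixed by R, so the image of the line is a line in the same direction. -/
theorem reflC_line (a : Fin 8 → ℂ) (z : ℂ) :
    reflC (fun j => a j + z * genericDir j) = fun j => reflC a j + z * genericDir j := by
  funext j
  rw [reflC, reflC, Finset.sum_add_distrib, ← Finset.mul_sum, sum_genericDir, genericDir_rev]
  ring

/-- Along the line through the parameters of `p` in the direction `genericDir`, the domain of the
two equations is dense in the fibres near `p`. -/
theorem eventually_dense_fibre (S : CdSystem τ f g σ) (p : State) :
    ∀ᶠ z in 𝓝[≠] (0 : ℂ), Dense {q : ℂ × ℂ |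
      ((fun j => p.1 j + z * genericDir j, p.2.1 + z * 3200000, q) : State) ∈ MSYDomain τ} := by
  filter_upwards [S.eventually_paramReg p.1 p.2.1 (Or.inl rfl),
    S.eventually_paramReg (reflC p.1) (p.2.1 + (∑ j, p.1 j) / 2 / 2) (Or.inr rfl)] with z h1 h2
  obtain ⟨a1, a2⟩ := h1 _ rfl _ rfl
  obtain ⟨b1, b2⟩ := h2 _ (reflC_line p.1 z)
    (p.2.1 + z * 3200000 + (∑ j, (p.1 j + z * genericDir j)) / 2 / 2) (by
      rw [Finset.sum_add_distrib, ← Finset.mul_sum, sum_genericDir]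
      ring)
  -- The coordinates are swapped because R sends (x, y) to (ȳ, x).
  have hD := (S.dense_firstDomain b1 b2 dense_univ).preimage
    (Homeomorph.prodComm ℂ ℂ).isOpenMap
  refine (S.dense_firstDomain a1 a2 hD).mono ?_
  rintro q ⟨k1, k2, -⟩
  exact (mem_msyDomain_iff S _).mpr ⟨k1, k2⟩

theorem dense_msyDomain (S : CdSystem τ f g σ) : Dense (MSYDomain τ) := fun p =>
  mem_closure_of_dense_fibres (S.eventually_dense_fibre p)

/-- The line starts at a special point in a special direction, so the points of `MSYDomain` found
over it are themselves special. -/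
theorem subset_closure_reducedDomain (S : CdSystem τ f g σ) :
    SpecialSet ⊆ closure (ReducedDomain τ) := by
  intro p hp
  refine mem_closure_of_dense_fibres (d := genericDir) (ε := 3200000) ?_
  filter_upwards [S.eventually_dense_fibre p] with z hz
  refine hz.mono fun q hq => ?_
  obtain ⟨h1, h2⟩ := (mem_msyDomain_iff S _).mp hq
  refine (mem_reducedDomain_iff S _).mpr ⟨⟨h1.1, h2⟩, (mem_specialSet_iff _).mpr ?_⟩
  refine (reflC_line p.1 z).trans ?_
  have e : reflC p.1 = p.1 := (mem_specialSet_iff p).mp hp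
  rw [e]
  rfl

/-- The second equation at `p`: it is the first equation at `R p`. -/
theorem msySecond (S : CdSystem τ f g σ) (p : State)
    (h : FirstDomain τ (reflC p.c) (p.η + p.lam / 2) (stageY₄ τ p.c p.η p.x p.y) p.x) :
    MSYSecond τ (p.c 0) (p.c 1) (p.c 2) (p.c 3) (p.c 4) (p.c 5) (p.c 6) (p.c 7)
      p.η p.lam p.x (xBar τ p) (yBar τ p) := by
  have hl : p.lam = (p.c 0 + p.c 1 + p.c 2 + p.c 3 + p.c 4 + p.c 5 + p.c 6 + p.c 7) / 2 := by
    rw [State.lam, sum_vec]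
  rw [(S.msySecond_iff hl).1, xBar_eq, yBar_eq]
  have h' := S.msyFirst rfl h.1 h.2
  rw [sum_reflC] at h'
  exact h'

end CdSystem

/-- A finite integer computation on the nine simple roots. -/
theorem picWord_TJ2 (i : Fin 9) : picWord TJ2 (simpleRoot i) =
      if i = 1 then simpleRoot 1 - 2 • antiCanonical
      else if i = 2 then simpleRoot 2 + antiCanonical
      else simpleRoot i := by
  revert i
  decide +kernel

end EllipticPainleve

end

open EllipticPainleve in
theorem mainTheorem3 (τ : ℂ) (hτ : 0 < τ.im) :
    -- the action of `T = R²` on the root lattice is a translation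
    (∀ i : Fin 9, picWord TJ2 (simpleRoot i) =
      if i = 1 then simpleRoot 1 - 2 • antiCanonical
      else if i = 2 then simpleRoot 2 + antiCanonical
      else simpleRoot i) ∧
    -- the action of `T` on the parameters
    (∀ p : State, actWord τ TJ2 State.c p = p.c ∧ actWord τ TJ2 State.η p = p.η + p.lam) ∧
    -- the action of `T` on `(x, y)` is given by the two MSY equations,
    (∀ p ∈ MSYDomain τ,
      MSYFirst τ (p.c 0) (p.c 1) (p.c 2) (p.c 3) (p.c 4) (p.c 5) (p.c 6) (p.c 7)
        p.η p.lam p.x p.y (yBar τ p) ∧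
      MSYSecond τ (p.c 0) (p.c 1) (p.c 2) (p.c 3) (p.c 4) (p.c 5) (p.c 6) (p.c 7)
        p.η p.lam p.x (xBar τ p) (yBar τ p)) ∧
    -- which are meaningful at generic points
    (IsOpen (MSYDomain τ) ∧ Dense (MSYDomain τ)) ∧
    -- the action of `R` on the special parameters and on `(x, y)`
    (∀ p ∈ SpecialSet, actWord τ RJ2 id p = (p.c, p.η + p.lam / 2, xTilde τ p, p.x)) ∧
    -- the scalar second-order equation for `x`,
    (∀ p ∈ ReducedDomain τ,
      Reduced τ (p.c 0) (p.c 1) (p.c 2) (p.c 3) p.η p.lam p.x (xTilde τ p) (xTildeTilde τ p)) ∧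
    -- which is meaningful at generic special points
    ((∃ U : Set State, IsOpen U ∧ ReducedDomain τ = U ∩ SpecialSet) ∧
      SpecialSet ⊆ closure (ReducedDomain τ)) := by
  obtain ⟨f, g, σ, S⟩ := exists_cdSystem hτ
  refine ⟨picWord_TJ2, fun p => ?_, fun p hp => ?_, ⟨S.isOpen_msyDomain, S.dense_msyDomain⟩,
    fun p hp => ?_, fun p hp => ?_, ⟨_, S.isOpen_run_firstDomain, ?_⟩,
    S.subset_closure_reducedDomain⟩
  · rw [actWord_eq_run, actWord_eq_run, run_TJ2]
    exact ⟨rfl, rfl⟩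
  · obtain ⟨h1, h2⟩ := (mem_msyDomain_iff S p).mp hp
    refine ⟨?_, S.msySecond p h2⟩
    rw [yBar_eq]
    exact S.msyFirst rfl h1.1 h1.2
  · rw [actWord_eq_run, run_RJ2_eq, xTilde_eq, (mem_specialSet_iff p).mp hp]
    rfl
  · obtain ⟨⟨-, h2⟩, hs⟩ := (mem_reducedDomain_iff S p).mp hp
    have h := S.msySecond p h2
    obtain ⟨e4, e5, e6, e7⟩ := hs
    -- Eliminating c₅, …, c₈ by the special relations turns the second equation into the reduced
    -- one.
    rw [eq_sub_of_add_eq e4, eq_sub_of_add_eq e5, eq_sub_of_add_eq e6, eq_sub_of_add_eq e7] at h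
    rw [reduced_iff, xTildeTilde_eq, xTilde_eq, ← yBar_eq]
    exact h
  · ext p
    exact mem_reducedDomain_iff S p
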